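/- Let $\Sigma$ be a compact Riemann surface with a smooth Riemannian metric $g$ compatible with its complex structure, let $\bar K=(T^*\Sigma)^{0,1}$, and let $E\to\Sigma$ be a holomorphic vector bundle of rank $r$ with a smooth Hermitian metric $\langle\cdot,\cdot\rangle$, conjugate linear in the second argument; $\bar KE=\bar K\otimes E$ carries the induced metric. A smooth section $\bar\mu\in\Gamma(\bar K\otimes_{\mathbb C}\mathrm{Sym}^2_{\mathbb C}E)$, locally $\bar\mu=\bar k\,\mu^{ij}e_i\otimes e_j$, defines a conjugate-linear bundle map $\mu:E\to\bar KE$, $\mu(\xi)=\bar k\,\langle e_i,\xi\rangle\mu^{ij}e_j$; let $\mu^*:\bar KE\to E$ be its adjoint for the real inner products $\mathrm{Re}\langle\cdot,\cdot\rangle$, and let $$\mathcal A=\begin{pmatrix}0&\mu^*\\ \mu&0\end{pmatrix}\in\mathrm{End}_{\mathbb R}(E\oplus\bar KE),\qquad Z_{\mathcal A}=\{x\in\Sigma:\ \ker\mathcal A(x)\neq0\}.$$ The top exterior power of the complex-linear map $E^*\cong E\xrightarrow{\mu}\bar KE$ is a section $\det\mu$ of the complex line bundle $L=\bar K^r\otimes\Lambda^rE\otimes\Lambda^rE$;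 locally it is $\det(\mu^{ij})$. A zero $p$ of $\det\mu$ is transverse if $\nabla(\det\mu):T_p\Sigma\to L_p$ is an isomorphism, and it is then called positive or negative according as this isomorphism preserves or reverses the (complex) orientations. For a real covector $u$ let $c(u)=u^{0,1}\wedge\,\cdot\,:E\to\bar KE$ and $c(u)=-(u^{0,1}\wedge\,\cdot\,)^*:\bar KE\to E$. For $p\in Z_{\mathcal A}$, connections $\nabla$ on $E$ and $\bar KE$, and an orthonormal frame $e_1,e_2$ of $T_p\Sigma$ with dual frame $e^1,e^2$, let $$M_\alpha=-c(e^\alpha)\nabla_{e_\alpha}\mu:\ker\mu_p\to\ker\mu_p,\qquad \hat M_\alpha=-c(e^\alpha)\nabla_{e_\alpha}\mu^*:\ker\mu_p^*\to\ker\mu_p^*$$ (composed with the orthogonal projections onto $\ker\mu_p$, $\ker\mu_p^*$), and let $\mathcal K_p=\bigcap_\alpha K_\alpha^+$, where $K_\alpha^+$ is the sum of the eigenspaces of $M_\alpha$ with positive eigenvalue; $\hat{\mathcal K}_p$ is defined in the same way from $\hat M_1,\hat M_2$. The frame is called commuting if $M_1M_2=M_2M_1$ and $\hat M_1\hat M_2=\hat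 M_2\hat M_1$. Then the set of $\bar\mu$ for which all zeros of $\det\mu$ are transverse is open and dense in $\Gamma(\bar K\otimes\mathrm{Sym}^2E)$ with the $C^\infty$ topology. For every such $\bar\mu$ the set $Z_{\mathcal A}$ is finite and equals the zero set of $\det\mu$, and each $p\in Z_{\mathcal A}$ is positive or negative. For every $p\in Z_{\mathcal A}$ and every choice of the connections: commuting orthonormal frames of $T_p\Sigma$ exist; every orthonormal frame is commuting if $p$ is non-degenerate, in the sense that there is a positive-definite symmetric endomorphism $M$ of $\ker\mu_p$ for which the orthogonal projection to $\ker\mu_p^*$ of $(\nabla_v\mu)k$ has square norm $|v|^2\,\mathrm{Re}\langle Mk,k\rangle$ for all $v\in T_p\Sigma$, $k\in\ker\mu_p$; and for every commuting orthonormal frame * if $p$ is positive, then $\mathcal K_p\cong\mathbb R$ and $\hat{\mathcal K}_p=0$; * if $p$ is negative, then $\mathcal K_p=0$ and $\hat{\mathcal K}_p\cong\mathbb R$. -/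

import Mathlib

open scoped Manifold ContDiff Bundle InnerProductSpace TensorProduct UniformConvergence
open Bundle

/-- The smooth real surface underlying a Riemann surface. -/
instance instIsManifoldRealOfComplex (S : Type*) [TopologicalSpace S] [ChartedSpace ℂ S]
    [IsManifold 𝓘(ℂ, ℂ) ω S] : IsManifold 𝓘(ℝ, ℂ) ∞ S := by
  apply isManifold_of_contDiffOn
  intro e e' he he'
  have h := (contDiffGroupoid ω 𝓘(ℂ, ℂ)).compatible he he'
  have h1 : e.symm ≫ₕ e' ∈ contDiffGroupoid ∞ 𝓘(ℂ, ℂ) := contDiffGroupoid_le le_top h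
  rw [contDiffGroupoid, mem_groupoid_of_pregroupoid] at h1
  exact (show ContDiffOn ℂ ∞ _ _ from h1.1).restrict_scalars ℝ

noncomputable section

namespace CrrLemma

-- On a Hermitian space the real inner product is `Re⟨·,·⟩`.
attribute [local instance] InnerProductSpace.complexToReal

/-- The model fibre of a complex vector bundle of rank `r`. -/
abbrev Fib (r : ℕ) : Type := EuclideanSpace ℂ (Fin r)

section Base

variable (S : Type*) [TopologicalSpace S] [ChartedSpace ℂ S] [IsManifold 𝓘(ℂ, ℂ) ω S]

/-- Smooth Riemannian metrics on the underlying real surface. -/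
abbrev SurfaceMetric : Type _ :=
  ContMDiffRiemannianMetric 𝓘(ℝ, ℂ) ∞ ℂ (fun x : S => TangentSpace 𝓘(ℝ, ℂ) x)

variable {S}

/-- The holomorphic tangent line at `x`. The real tangent space `TangentSpace 𝓘(ℝ, ℂ) x` is the
same additive group (both are `ℂ`, through the preferred chart at `x`), so multiplication by `i`
here is the complex structure of the surface. -/
abbrev Tan (x : S) : Type := TangentSpace 𝓘(ℂ, ℂ) x

/-- The tangent vector `1` at `x` in the preferred chart at `x`. -/
def tanOne (x : S) : Tan x := (1 : ℂ)

/-- The real inner product of two tangent vectors. -/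
def metricAt (g : SurfaceMetric S) (x : S) (v w : Tan x) : ℝ :=
  g.inner x (show TangentSpace 𝓘(ℝ, ℂ) x from v) (show TangentSpace 𝓘(ℝ, ℂ) x from w)

/-- The metric is compatible with the complex structure. -/
def IsCompatible (g : SurfaceMetric S) : Prop :=
  ∀ (x : S) (v w : Tan x), metricAt g x (Complex.I • v) (Complex.I • w) = metricAt g x v w

/-- `e` is an orthonormal frame of the real tangent plane at `x`. -/
def IsOrthonormalFrame (g : SurfaceMetric S) (x : S) (e : Fin 2 → Tan x) : Prop :=
  ∀ i j, metricAt g x (e i) (e j) = if i = j then 1 else 0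

/-- The coordinate vector field `∂/∂z` at `x`, for the preferred chart `z` at `p`. -/
def coordVec (p x : S) : Tan x :=
  (trivializationAt ℂ (fun y : S => TangentSpace 𝓘(ℂ, ℂ) y) p).symmL ℂ x (1 : ℂ)

end Base

/-- `Sym²V`, the symmetric tensors in `V ⊗ V`. -/
def symTensors (V : Type*) [AddCommGroup V] [Module ℂ V] : Submodule ℂ (V ⊗[ℂ] V) :=
  LinearMap.ker ((TensorProduct.comm ℂ V V).toLinearMap - LinearMap.id)

section Fibres

variable {S : Type*} [TopologicalSpace S] [ChartedSpace ℂ S] [IsManifold 𝓘(ℂ, ℂ) ω S]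
  (g : SurfaceMetric S) (E : S → Type*) [∀ x, NormedAddCommGroup (E x)]
  [∀ x, InnerProductSpace ℂ (E x)]

/-- The fibre of `K̄ ⊗ Sym²E` at `x`: conjugate-linear maps from the holomorphic tangent line
to `Sym²(E x)`. -/
abbrev QuadFibre (x : S) : Type _ := Tan x →ₛₗ[starRingEnd ℂ] symTensors (E x)

/-- The fibre of `K̄E = K̄ ⊗ E` at `x`: conjugate-linear maps from the holomorphic tangent line
to `E x`. (The metric `g` is recorded in the type because it enters the inner product.) -/
def KbarE (_g : SurfaceMetric S) (E : S → Type*) [∀ x, NormedAddCommGroup (E x)]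
    [∀ x, InnerProductSpace ℂ (E x)] (x : S) : Type _ :=
  Tan x →ₛₗ[starRingEnd ℂ] E x

instance (x : S) : AddCommGroup (KbarE g E x) :=
  inferInstanceAs (AddCommGroup (Tan x →ₛₗ[starRingEnd ℂ] E x))

instance (x : S) : Module ℂ (KbarE g E x) :=
  inferInstanceAs (Module ℂ (Tan x →ₛₗ[starRingEnd ℂ] E x))

variable {g E}

/-- Regard a conjugate-linear map on the tangent line as an element of `K̄E`. -/
def KbarE.mk {x : S} (f : Tan x →ₛₗ[starRingEnd ℂ] E x) : KbarE g E x := f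

/-- Evaluation of an `E`-valued `(0,1)`-form on a tangent vector. -/
def KbarE.ev {x : S} (v : Tan x) : KbarE g E x →ₗ[ℂ] E x where
  toFun η := (show Tan x →ₛₗ[starRingEnd ℂ] E x from η) v
  map_add' _ _ := rfl
  map_smul' _ _ := rfl

theorem KbarE.ext_one {x : S} {η : KbarE g E x} (h : KbarE.ev (tanOne x) η = 0) : η = 0 := by
  refine LinearMap.ext (σ := starRingEnd ℂ) (f := show Tan x →ₛₗ[starRingEnd ℂ] E x from η)
    (g := 0) fun v => ?_
  have hv : v = (show ℂ from v) • tanOne x := (mul_one (show ℂ from v)).symm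
  rw [hv, LinearMap.map_smulₛₗ]
  have h' : (show Tan x →ₛₗ[starRingEnd ℂ] E x from η) (tanOne x) = 0 := h
  rw [h']
  simp

theorem metricAt_tanOne_pos (g : SurfaceMetric S) (x : S) :
    0 < metricAt g x (tanOne x) (tanOne x) :=
  g.pos x _ (show (1 : ℂ) ≠ 0 from one_ne_zero)

/-- The Hermitian inner product on `K̄E` induced by the metrics of the surface and of `E`. With
`z` a coordinate for which `∂/∂x` has length `a`, one has `|dz̄|² = 2 / a²`. -/
@[reducible]
def KbarE.core (g : SurfaceMetric S) (E : S → Type*) [∀ x, NormedAddCommGroup (E x)]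
    [∀ x, InnerProductSpace ℂ (E x)] (x : S) : InnerProductSpace.Core ℂ (KbarE g E x) where
  inner η ζ := ((2 / metricAt g x (tanOne x) (tanOne x) : ℝ) : ℂ) *
    inner ℂ (KbarE.ev (tanOne x) η) (KbarE.ev (tanOne x) ζ)
  conj_inner_symm η ζ := by
    rw [map_mul, Complex.conj_ofReal, inner_conj_symm]
  re_inner_nonneg η := by
    have h := (metricAt_tanOne_pos g x).le
    have h2 : 0 ≤ 2 / metricAt g x (tanOne x) (tanOne x) := by positivity
    have := inner_self_nonneg (𝕜 := ℂ) (x := KbarE.ev (tanOne x) η)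
    rw [RCLike.re_eq_complex_re] at this ⊢
    rw [Complex.re_ofReal_mul]
    exact mul_nonneg h2 this
  add_left η ζ χ := by rw [map_add, inner_add_left, mul_add]
  smul_left η ζ a := by rw [map_smul, inner_smul_left]; ring
  definite η h := by
    have h0 := metricAt_tanOne_pos g x
    have h2 : ((2 / metricAt g x (tanOne x) (tanOne x) : ℝ) : ℂ) ≠ 0 := by
      exact_mod_cast (div_pos two_pos h0).ne'
    exact KbarE.ext_one (inner_self_eq_zero.1 ((mul_eq_zero.1 h).resolve_left h2))

instance (x : S) : NormedAddCommGroup (KbarE g E x) :=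
  (KbarE.core g E x).toNormedAddCommGroup

instance (x : S) : InnerProductSpace ℂ (KbarE g E x) :=
  InnerProductSpace.ofCore (KbarE.core g E x).toCore

instance (x : S) [FiniteDimensional ℂ (E x)] : FiniteDimensional ℂ (KbarE g E x) :=
  FiniteDimensional.of_injective (KbarE.ev (g := g) (E := E) (tanOne x))
    ((injective_iff_map_eq_zero _).2 fun _ h => KbarE.ext_one h)

/-- Contraction of a symmetric tensor `∑ a ⊗ b` with `ξ` through the Hermitian metric:
`∑ ⟨a, ξ⟩ b`, where `⟨a, ξ⟩` is linear in `a` and conjugate linear in `ξ` (this is Mathlib's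
`inner ℂ ξ a`). -/
def contract {V : Type*} [NormedAddCommGroup V] [InnerProductSpace ℂ V] :
    V →ₛₗ[starRingEnd ℂ] (V ⊗[ℂ] V) →ₗ[ℂ] V where
  toFun ξ := (TensorProduct.lid ℂ V).toLinearMap ∘ₗ LinearMap.rTensor V (innerₛₗ ℂ ξ)
  map_add' ξ ζ := by
    ext a b
    simp
  map_smul' c ξ := by
    ext a b
    simp

/-- The conjugate-linear map `μ : E → K̄E` determined by an element of `K̄ ⊗ Sym²E` and the
Hermitian metric of `E`. -/
def mu {x : S} (s : QuadFibre E x) : E x →ₛₗ[starRingEnd ℂ] KbarE g E x where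
  toFun ξ := KbarE.mk (((contract ξ).comp (symTensors (E x)).subtype).comp s)
  map_add' ξ ζ := by
    refine LinearMap.ext (σ := starRingEnd ℂ) fun v => ?_
    change contract (ξ + ζ) (s v : E x ⊗[ℂ] E x) = contract ξ (s v : E x ⊗[ℂ] E x) + contract ζ _
    rw [map_add]; rfl
  map_smul' c ξ := by
    refine LinearMap.ext (σ := starRingEnd ℂ) fun v => ?_
    change contract (c • ξ) (s v : E x ⊗[ℂ] E x) = (starRingEnd ℂ c) • contract ξ _
    rw [LinearMap.map_smulₛₗ]; rfl

variable (g) in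
/-- `μ` as a real-linear map. -/
def muR {x : S} (s : QuadFibre E x) : E x →ₗ[ℝ] KbarE g E x where
  toFun ξ := mu s ξ
  map_add' := map_add _
  map_smul' c ξ := by
    have h : c • ξ = (c : ℂ) • ξ := (RCLike.real_smul_eq_coe_smul (K := ℂ) c ξ)
    have h' : c • (mu s ξ : KbarE g E x) = (c : ℂ) • (mu s ξ : KbarE g E x) :=
      (RCLike.real_smul_eq_coe_smul (K := ℂ) c _)
    rw [RingHom.id_apply, h', h, LinearMap.map_smulₛₗ, Complex.conj_ofReal]

variable [∀ x, FiniteDimensional ℂ (E x)]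

variable (g) in
/-- The adjoint `μ* : K̄E → E` with respect to the real inner products `Re⟨·,·⟩`. -/
def muAdj {x : S} (s : QuadFibre E x) : KbarE g E x →ₗ[ℝ] E x :=
  LinearMap.adjoint (muR g s)

variable (g) in
/-- `𝒜 = (0 μ*; μ 0)`, a real endomorphism of `E ⊕ K̄E`. -/
def bigA {x : S} (s : QuadFibre E x) : (E x × KbarE g E x) →ₗ[ℝ] (E x × KbarE g E x) :=
  LinearMap.prod (muAdj g s ∘ₗ LinearMap.snd ℝ _ _) (muR g s ∘ₗ LinearMap.fst ℝ _ _)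

/-- For a tangent vector `v`, the complex-linear map `E* → E`, `φ ↦ μ(φ♯)(v)`, where `φ♯` is the
vector with `φ = ⟨·, φ♯⟩`. -/
def muSharp {x : S} (g : SurfaceMetric S) (s : QuadFibre E x) (v : Tan x) :
    Module.Dual ℂ (E x) →ₗ[ℂ] E x where
  toFun φ := KbarE.ev v
    (mu s ((InnerProductSpace.toDual ℂ (E x)).symm (LinearMap.toContinuousLinearMap φ)) :
      KbarE g E x)
  map_add' φ ψ := by simp
  map_smul' c φ := by
    rw [map_smul, LinearIsometryEquiv.map_smulₛₗ, LinearMap.map_smulₛₗ, map_smul]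
    simp

/-- The section `det μ` of `L = K̄^r ⊗ Λ^r E ⊗ Λ^r E` at `x`, given as the map sending a tangent
vector `v` to `Λ^r E* → Λ^r E`, the top exterior power of `E* → E`, `φ ↦ μ(φ♯)(v)`. (It is
homogeneous of degree `r` in `v̄`, whence the factor `K̄^r`.) -/
def detMu {x : S} (r : ℕ) (g : SurfaceMetric S) (s : QuadFibre E x) (v : Tan x) :
    (⋀[ℂ]^r (Module.Dual ℂ (E x))) →ₗ[ℂ] (⋀[ℂ]^r (E x)) :=
  exteriorPower.map r (muSharp g s v)

/-! ### Clifford multiplication -/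

/-- The `(0,1)`-part `½(u + i u∘J)` of the real covector `u = g(w, ·)`. -/
def form01 (g : SurfaceMetric S) {x : S} (w : Tan x) (v : Tan x) : ℂ :=
  ((metricAt g x w v : ℂ) + Complex.I * (metricAt g x w (Complex.I • v) : ℂ)) / 2

theorem metricAt_add (g : SurfaceMetric S) {x : S} (w v v' : Tan x) :
    metricAt g x w (v + v') = metricAt g x w v + metricAt g x w v' :=
  map_add (g.inner x (show TangentSpace 𝓘(ℝ, ℂ) x from w)) _ _

theorem metricAt_smul (g : SurfaceMetric S) {x : S} (w v : Tan x) (c : ℂ) :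
    metricAt g x w (c • v) =
      c.re * metricAt g x w v + c.im * metricAt g x w (Complex.I • v) := by
  have h : (show ℂ from c • v) =
      c.re • (show ℂ from v) + c.im • (show ℂ from (Complex.I • v : Tan x)) := by
    have key : ∀ t : ℂ, c * t = c.re • t + c.im • (Complex.I * t) := fun t => by
      conv_lhs => rw [← Complex.re_add_im c]
      simp only [Complex.real_smul]
      ring
    exact key v
  have h2 := congrArg (fun t : ℂ => g.inner x (show TangentSpace 𝓘(ℝ, ℂ) x from w)
    (show TangentSpace 𝓘(ℝ, ℂ) x from t)) h
  refine h2.trans ?_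
  exact (map_add (g.inner x (show TangentSpace 𝓘(ℝ, ℂ) x from w)) _ _).trans
    (congrArg₂ (· + ·)
      (map_smul (g.inner x (show TangentSpace 𝓘(ℝ, ℂ) x from w)) c.re _)
      (map_smul (g.inner x (show TangentSpace 𝓘(ℝ, ℂ) x from w)) c.im _))

theorem form01_add (g : SurfaceMetric S) {x : S} (w v v' : Tan x) :
    form01 g w (v + v') = form01 g w v + form01 g w v' := by
  simp only [form01, smul_add, metricAt_add]
  push_cast
  ring

theorem form01_smul (g : SurfaceMetric S) {x : S} (w v : Tan x) (c : ℂ) :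
    form01 g w (c • v) = starRingEnd ℂ c * form01 g w v := by
  have h1 := metricAt_smul g w v c
  have h2 := metricAt_smul g w v (Complex.I * c)
  rw [mul_smul] at h2
  simp only [form01, h1, h2]
  apply Complex.ext <;> simp <;> ring

/-- Clifford multiplication `c(u) : E → K̄E` by the real covector `u = g(w, ·)`, namely
`ξ ↦ u^{0,1} ∧ ξ`. -/
def cliffUp (g : SurfaceMetric S) {x : S} (w : Tan x) : E x →ₗ[ℂ] KbarE g E x where
  toFun ξ := KbarE.mk
    { toFun := fun v => form01 g w v • ξ
      map_add' := fun v v' => by rw [form01_add, add_smul]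
      map_smul' := fun c v => by rw [form01_smul, mul_smul] }
  map_add' ξ ζ := LinearMap.ext (σ := starRingEnd ℂ) fun v => smul_add (form01 g w v) ξ ζ
  map_smul' c ξ := LinearMap.ext (σ := starRingEnd ℂ) fun v => smul_comm (form01 g w v) c ξ

/-- Clifford multiplication `c(u) : K̄E → E` by the real covector `u = g(w, ·)`, namely
`η ↦ -ι_u η`, where `ι_u` is the adjoint of `u^{0,1} ∧`. -/
def cliffDown (g : SurfaceMetric S) {x : S} (w : Tan x) : KbarE g E x →ₗ[ℂ] E x :=
  -LinearMap.adjoint (cliffUp g w)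

end Fibres

section Bundles

variable {S : Type*} [TopologicalSpace S] [ChartedSpace ℂ S] [IsManifold 𝓘(ℂ, ℂ) ω S]
  (r : ℕ) {E : S → Type*} [TopologicalSpace (TotalSpace (Fib r) E)]
  [∀ x, NormedAddCommGroup (E x)] [∀ x, InnerProductSpace ℂ (E x)]
  [FiberBundle (Fib r) E] [VectorBundle ℂ (Fib r) E]

/-- The preferred local trivialization of `E` near `p`, on the fibre over `x`. -/
def toFib (E : S → Type*) [TopologicalSpace (TotalSpace (Fib r) E)]
    [∀ x, NormedAddCommGroup (E x)] [∀ x, InnerProductSpace ℂ (E x)]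
    [FiberBundle (Fib r) E] [VectorBundle ℂ (Fib r) E] (p x : S) : E x →L[ℂ] Fib r :=
  (trivializationAt (Fib r) E p).continuousLinearMapAt ℂ x

/-- The inverse of `toFib`. -/
def ofFib (E : S → Type*) [TopologicalSpace (TotalSpace (Fib r) E)]
    [∀ x, NormedAddCommGroup (E x)] [∀ x, InnerProductSpace ℂ (E x)]
    [FiberBundle (Fib r) E] [VectorBundle ℂ (Fib r) E] (p x : S) : Fib r →L[ℂ] E x :=
  (trivializationAt (Fib r) E p).symmL ℂ x

/-- The open set of `ℂ`, in the preferred chart at `p`, over which the preferred trivialization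
of `E` at `p` is defined. -/
def chartDomain (E : S → Type*) [TopologicalSpace (TotalSpace (Fib r) E)]
    [∀ x, NormedAddCommGroup (E x)] [∀ x, InnerProductSpace ℂ (E x)]
    [FiberBundle (Fib r) E] [VectorBundle ℂ (Fib r) E] (p : S) : Set ℂ :=
  (chartAt ℂ p).target ∩ (chartAt ℂ p).symm ⁻¹' (trivializationAt (Fib r) E p).baseSet

/-- The Hermitian metric of `E` is smooth: in the local frames its matrix is smooth. -/
def IsSmoothHermitian (E : S → Type*) [TopologicalSpace (TotalSpace (Fib r) E)]
    [∀ x, NormedAddCommGroup (E x)] [∀ x, InnerProductSpace ℂ (E x)]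
    [FiberBundle (Fib r) E] [VectorBundle ℂ (Fib r) E] : Prop :=
  ∀ (p : S) (a b : Fib r), ContDiffOn ℝ ∞ (fun z : ℂ =>
    (inner ℂ (ofFib r E p ((chartAt ℂ p).symm z) a) (ofFib r E p ((chartAt ℂ p).symm z) b) : ℂ))
    (chartDomain r E p)

/-- The `i`-th covector at `x` of the frame of `E*` dual to the local frame at `p`. -/
def coframe (E : S → Type*) [TopologicalSpace (TotalSpace (Fib r) E)]
    [∀ x, NormedAddCommGroup (E x)] [∀ x, InnerProductSpace ℂ (E x)]
    [FiberBundle (Fib r) E] [VectorBundle ℂ (Fib r) E] (p x : S) (i : Fin r) :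
    Module.Dual ℂ (E x) :=
  ((EuclideanSpace.proj i : Fib r →L[ℂ] ℂ) ∘L toFib r E p x).toLinearMap

/-- The coefficients `s^{ij}` of a section `s = ∑ s^{ij} dz̄ ⊗ e_i ⊗ e_j` of `K̄ ⊗ Sym²E` with
respect to the coordinate and the frame at `p`, as functions of the coordinate. -/
def coeff (s : ∀ x, QuadFibre E x) (p : S) (z : ℂ) : Fin r → Fin r → ℂ := fun i j =>
  TensorProduct.lid ℂ ℂ (TensorProduct.map (coframe r E p ((chartAt ℂ p).symm z) i)
    (coframe r E p ((chartAt ℂ p).symm z) j)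
    (s ((chartAt ℂ p).symm z) (coordVec p ((chartAt ℂ p).symm z)) : _ ⊗[ℂ] _))

/-- Smooth sections of `K̄ ⊗ Sym²E`. -/
def QuadSection (E : S → Type*) [TopologicalSpace (TotalSpace (Fib r) E)]
    [∀ x, NormedAddCommGroup (E x)] [∀ x, InnerProductSpace ℂ (E x)]
    [FiberBundle (Fib r) E] [VectorBundle ℂ (Fib r) E] : Type _ :=
  {s : ∀ x, QuadFibre E x // ∀ p : S, ContDiffOn ℝ ∞ (coeff r s p) (chartDomain r E p)}

/-- The `C^∞` topology on smooth sections: uniform convergence of all derivatives of the local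
coefficients, on compact subsets of the coordinate domains. -/
instance : TopologicalSpace (QuadSection r E) :=
  ⨅ (p : S) (n : ℕ), TopologicalSpace.induced
    (fun s : QuadSection r E =>
      UniformOnFun.ofFun {K : Set ℂ | IsCompact K ∧ K ⊆ chartDomain r E p}
        (iteratedFDeriv ℝ n (coeff r s.1 p)))
    inferInstance

variable {r} [∀ x, FiniteDimensional ℂ (E x)]

/-- The singular set `Z_𝒜 = {x | ker 𝒜(x) ≠ 0}`. -/
def singularSet (g : SurfaceMetric S) (s : QuadSection r E) : Set S :=
  {x | LinearMap.ker (bigA g (s.1 x)) ≠ ⊥}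

/-- The zeros of the section `det μ` of `L`. -/
def detZeros (g : SurfaceMetric S) (s : QuadSection r E) : Set S :=
  {x | ∀ v : Tan x, detMu r g (s.1 x) v = 0}

/-- The coefficient of `det μ` with respect to the frame
`dz̄^r ⊗ (e_1 ∧ … ∧ e_r) ⊗ (e_1 ∧ … ∧ e_r)` of `L` at `p`, as a function of the coordinate. -/
def detCoeff (g : SurfaceMetric S) (s : QuadSection r E) (p : S) (z : ℂ) : ℂ :=
  exteriorPower.alternatingMapLinearEquiv
    ((EuclideanSpace.basisFun (Fin r) ℂ).toBasis.det)
    (exteriorPower.map r (toFib r E p ((chartAt ℂ p).symm z)).toLinearMap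
      (detMu r g (s.1 ((chartAt ℂ p).symm z)) (coordVec p ((chartAt ℂ p).symm z))
        (exteriorPower.ιMulti ℂ r (coframe r E p ((chartAt ℂ p).symm z)))))

/-- The derivative `∇(det μ) : T_pΣ → L_p` at a zero `p` of `det μ`, in the oriented coordinate
and the complex frame of `L` at `p`. -/
def detDeriv (g : SurfaceMetric S) (s : QuadSection r E) (p : S) : ℂ →L[ℝ] ℂ :=
  fderiv ℝ (detCoeff g s p) (chartAt ℂ p p)

/-- All zeros of `det μ` are transverse. -/
def HasTransverseZeros (g : SurfaceMetric S) (s : QuadSection r E) : Prop :=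
  ∀ p ∈ detZeros g s, Function.Bijective (detDeriv g s p)

/-- The derivative of `det μ` at `p` preserves orientation. -/
def IsPositive (g : SurfaceMetric S) (s : QuadSection r E) (p : S) : Prop :=
  0 < LinearMap.det (detDeriv g s p : ℂ →ₗ[ℝ] ℂ)

/-- The derivative of `det μ` at `p` reverses orientation. -/
def IsNegative (g : SurfaceMetric S) (s : QuadSection r E) (p : S) : Prop :=
  LinearMap.det (detDeriv g s p : ℂ →ₗ[ℝ] ℂ) < 0

/-! ### Covariant derivatives of `μ` and `μ*` -/

/-- The local trivialization of `K̄E` at `p`: the coefficient of `dz̄`, in the frame of `E`. -/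
def toFibK (g : SurfaceMetric S) (E : S → Type*) [TopologicalSpace (TotalSpace (Fib r) E)]
    [∀ x, NormedAddCommGroup (E x)] [∀ x, InnerProductSpace ℂ (E x)]
    [FiberBundle (Fib r) E] [VectorBundle ℂ (Fib r) E] (p x : S) : KbarE g E x →ₗ[ℂ] Fib r :=
  (toFib r E p x).toLinearMap ∘ₗ KbarE.ev (coordVec p x)

/-- The inverse of `toFibK`, at the points where the coordinate is defined. -/
def ofFibK (g : SurfaceMetric S) (E : S → Type*) [TopologicalSpace (TotalSpace (Fib r) E)]
    [∀ x, NormedAddCommGroup (E x)] [∀ x, InnerProductSpace ℂ (E x)]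
    [FiberBundle (Fib r) E] [VectorBundle ℂ (Fib r) E] (p x : S) : Fib r →ₗ[ℂ] KbarE g E x where
  toFun a := KbarE.mk
    { toFun := fun v => starRingEnd ℂ ((show ℂ from v) / (show ℂ from coordVec p x)) •
        ofFib r E p x a
      map_add' := fun v w => by
        rw [← add_smul, ← map_add, ← add_div]; rfl
      map_smul' := fun c v => by
        rw [← mul_smul, ← map_mul, ← mul_div_assoc]; rfl }
  map_add' a b := LinearMap.ext (σ := starRingEnd ℂ) fun v => by
    have key : ∀ t : ℂ, t • ofFib r E p x (a + b) =
        t • ofFib r E p x a + t • ofFib r E p x b := fun t => by rw [map_add, smul_add]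
    exact key _
  map_smul' c a := LinearMap.ext (σ := starRingEnd ℂ) fun v => by
    have key : ∀ t : ℂ, t • ofFib r E p x (c • a) = c • (t • ofFib r E p x a) := fun t => by
      rw [map_smul, smul_comm]
    exact key _

/-- `μ` in the local trivializations of `E` and `K̄E` at `p`. -/
def muLocal (g : SurfaceMetric S) (s : QuadSection r E) (p : S) (z : ℂ) : Fib r →L[ℝ] Fib r :=
  LinearMap.toContinuousLinearMap
    ((toFibK g E p ((chartAt ℂ p).symm z)).restrictScalars ℝ ∘ₗ
      muR g (s.1 ((chartAt ℂ p).symm z)) ∘ₗ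
        (ofFib r E p ((chartAt ℂ p).symm z)).toLinearMap.restrictScalars ℝ)

/-- `μ*` in the local trivializations of `K̄E` and `E` at `p`. -/
def muAdjLocal (g : SurfaceMetric S) (s : QuadSection r E) (p : S) (z : ℂ) :
    Fib r →L[ℝ] Fib r :=
  LinearMap.toContinuousLinearMap
    ((toFib r E p ((chartAt ℂ p).symm z)).toLinearMap.restrictScalars ℝ ∘ₗ
      muAdj g (s.1 ((chartAt ℂ p).symm z)) ∘ₗ
        (ofFibK g E p ((chartAt ℂ p).symm z)).restrictScalars ℝ)

/-- Real connections on `E` and on `K̄E` at the point `p`: their connection forms at `p` with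
respect to the local trivializations at `p`, so that `∇ξ = dξ + a ξ` on `E` and `∇η = dη + b η`
on `K̄E`. Every pair of connections is of this form at `p`. -/
structure ConnectionsAt (g : SurfaceMetric S) (E : S → Type*) [∀ x, NormedAddCommGroup (E x)]
    [∀ x, InnerProductSpace ℂ (E x)] (p : S) where
  /-- connection form on `E` -/
  a : Tan p →+ (E p →ₗ[ℝ] E p)
  /-- connection form on `K̄E` -/
  b : Tan p →+ (KbarE g E p →ₗ[ℝ] KbarE g E p)
  a_smul (t : ℝ) (v : Tan p) : a ((t : ℂ) • v) = t • a v
  b_smul (t : ℝ) (v : Tan p) : b ((t : ℂ) • v) = t • b v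

/-- `∇_v μ : E_p → (K̄E)_p`. -/
def nablaMu (g : SurfaceMetric S) (s : QuadSection r E) {p : S} (A : ConnectionsAt g E p)
    (v : Tan p) : E p →ₗ[ℝ] KbarE g E p :=
  ((ofFibK g E p p).restrictScalars ℝ ∘ₗ
      (fderiv ℝ (muLocal g s p) (chartAt ℂ p p) (show ℂ from v)).toLinearMap ∘ₗ
        (toFib r E p p).toLinearMap.restrictScalars ℝ)
    + A.b v ∘ₗ muR g (s.1 p) - muR g (s.1 p) ∘ₗ A.a v

/-- `∇_v μ* : (K̄E)_p → E_p`. -/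
def nablaMuAdj (g : SurfaceMetric S) (s : QuadSection r E) {p : S} (A : ConnectionsAt g E p)
    (v : Tan p) : KbarE g E p →ₗ[ℝ] E p :=
  ((ofFib r E p p).toLinearMap.restrictScalars ℝ ∘ₗ
      (fderiv ℝ (muAdjLocal g s p) (chartAt ℂ p p) (show ℂ from v)).toLinearMap ∘ₗ
        (toFibK g E p p).restrictScalars ℝ)
    + A.a v ∘ₗ muAdj g (s.1 p) - muAdj g (s.1 p) ∘ₗ A.b v

/-- `ker μ_p`, as a real vector space. -/
abbrev kerMu (g : SurfaceMetric S) (s : QuadSection r E) (p : S) : Submodule ℝ (E p) :=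
  LinearMap.ker (muR g (s.1 p))

/-- `ker μ_p*`, as a real vector space. -/
abbrev kerMuAdj (g : SurfaceMetric S) (s : QuadSection r E) (p : S) :
    Submodule ℝ (KbarE g E p) :=
  LinearMap.ker (muAdj g (s.1 p))

/-- `M_α = -c(e^α) ∇_{e_α} μ : ker μ_p → ker μ_p`, where `e^α = g(e_α, ·)` is the dual coframe.
The orthogonal projection onto `ker μ_p` makes the map land in the kernel. -/
def opM (g : SurfaceMetric S) (s : QuadSection r E) {p : S} (A : ConnectionsAt g E p)
    (e : Fin 2 → Tan p) (α : Fin 2) : Module.End ℝ (kerMu g s p) :=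
  (kerMu g s p).orthogonalProjectionOnto.toLinearMap ∘ₗ
    (-((cliffDown g (e α)).restrictScalars ℝ ∘ₗ nablaMu g s A (e α))) ∘ₗ (kerMu g s p).subtype

/-- `M̂_α = -c(e^α) ∇_{e_α} μ* : ker μ_p* → ker μ_p*`. -/
def opMHat (g : SurfaceMetric S) (s : QuadSection r E) {p : S} (A : ConnectionsAt g E p)
    (e : Fin 2 → Tan p) (α : Fin 2) : Module.End ℝ (kerMuAdj g s p) :=
  (kerMuAdj g s p).orthogonalProjectionOnto.toLinearMap ∘ₗ
    (-((cliffUp g (e α)).restrictScalars ℝ ∘ₗ nablaMuAdj g s A (e α))) ∘ₗ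
      (kerMuAdj g s p).subtype

/-- The sum of the eigenspaces of `M` with positive eigenvalues. -/
def positiveSpace {V : Type*} [AddCommGroup V] [Module ℝ V] (M : Module.End ℝ V) :
    Submodule ℝ V :=
  ⨆ t : {t : ℝ // 0 < t}, M.eigenspace t.1

/-- `𝒦_p = ⋂_α K_α⁺ ⊆ ker μ_p`. -/
def calK (g : SurfaceMetric S) (s : QuadSection r E) {p : S} (A : ConnectionsAt g E p)
    (e : Fin 2 → Tan p) : Submodule ℝ (kerMu g s p) :=
  ⨅ α, positiveSpace (opM g s A e α)

/-- `𝒦̂_p ⊆ ker μ_p*`. -/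
def calKHat (g : SurfaceMetric S) (s : QuadSection r E) {p : S} (A : ConnectionsAt g E p)
    (e : Fin 2 → Tan p) : Submodule ℝ (kerMuAdj g s p) :=
  ⨅ α, positiveSpace (opMHat g s A e α)

/-- Each of the two families `{M_α}` and `{M̂_α}` commutes. -/
def IsCommutingFrame (g : SurfaceMetric S) (s : QuadSection r E) {p : S}
    (A : ConnectionsAt g E p) (e : Fin 2 → Tan p) : Prop :=
  (∀ α β, Commute (opM g s A e α) (opM g s A e β)) ∧
    ∀ α β, Commute (opMHat g s A e α) (opMHat g s A e β)

/-- Non-degeneracy of the zero `p`, that is `𝒜*𝒜|_K = r² M + O(r³)` with `M` symmetric and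
positive definite, expressed through the leading coefficient: for `k ∈ ker μ_p` the part of
`(∇_v μ) k` in `ker μ_p*` has square length `|v|² ⟨M k, k⟩`. -/
def IsNondegenerate (g : SurfaceMetric S) (s : QuadSection r E) {p : S}
    (A : ConnectionsAt g E p) : Prop :=
  ∃ M : Module.End ℝ (kerMu g s p), M.IsSymmetric ∧
    (∀ k, k ≠ 0 → 0 < (inner ℝ (M k) k : ℝ)) ∧
    ∀ (v : Tan p) (k : kerMu g s p),
      ‖(kerMuAdj g s p).orthogonalProjectionOnto (nablaMu g s A v k)‖ ^ 2 =
        metricAt g p v v * inner ℝ (M k) k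

end Bundles

end CrrLemma

end

/-!
In a frame, `μ̄` is a symmetric matrix `N` of smooth functions, and at a zero of `det N` the
derivative of the determinant is `v ↦ tr (adj N · ∂_v N)`. If the zero is transverse, then
`adj N ≠ 0`, so the kernel of `N` is a line spanned by some `w`, and symmetry gives
`adj N = c w wᵀ`. Hence the derivative of the determinant is a complex multiple of
`v ↦ wᵀ (∂_v N) w`. For a unit vector `k` of `ker μ_p` and the corresponding unit vector `k̂` of
`ker μ_p*` this is, up to a further factor, the real linear map `L v = ⟨(∇_v μ) k, k̂⟩` of the
plane, which does not depend on the connections; so the sign of the zero is that of `det L`.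

In the complex coordinates on the two kernels, `M_α` and `M̂_α` are the maps `l ↦ c_α l̄` and
`l ↦ ĉ_α l̄`, where for an orthonormal frame `c₁ c̄₂ = (i / 2) L(e₁) conj (L(i e₁))` and
`ĉ₁ conj ĉ₂ = -c₁ c̄₂`. Maps of this form commute exactly when `c₁ c̄₂` is real, and they are then
real multiples of each other, positive if `c₁ c̄₂ > 0` and negative if `c₁ c̄₂ < 0`; the positive
eigenspace of each is a real line. Since `Re (c₁ c̄₂)` is a positive multiple of `det L`, exactly
one of the two intersections is a line, namely the one selected by the sign of the zero.
Rotating the frame by a quarter turn changes the sign of `Re (L(v) conj (L(i v)))`, so this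
quantity vanishes for some frame, and it vanishes for all frames when `L` is conformal.

Transversality is dense by Sard's theorem. A symmetric matrix with a kernel vector `w`, `w_j = 1`,
is determined by `w` and by its entries off the `j`-th row and column. These leave one complex
parameter unused, and letting it be the point `z` of a chart gives a map, between spaces of equal
dimension, whose values are the constant matrices `B` for which `N + B` is singular at `z`. When `B`
is a regular value, the zeros of `det (N + B)` are transverse. Such a `B` can be taken arbitrarily
small and cut off outside a compact subset of the chart; finitely many of these subsets cover the
surface, and transversality over each of them is an open condition on the first derivatives.
-/

noncomputable section

namespace CrrLemma

attribute [local instance] InnerProductSpace.complexToReal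

section RealPlane

theorem bijective_iff_det_ne_zero {K V : Type*} [Field K] [AddCommGroup V] [Module K V]
    [FiniteDimensional K V] (f : V →ₗ[K] V) :
    Function.Bijective f ↔ LinearMap.det f ≠ 0 := by
  rw [← isUnit_iff_ne_zero, ← LinearMap.isUnit_iff_isUnit_det, Module.End.isUnit_iff]

theorem surjective_iff_det_ne_zero {K V : Type*} [Field K] [AddCommGroup V] [Module K V]
    [FiniteDimensional K V] (f : V →ₗ[K] V) :
    Function.Surjective f ↔ LinearMap.det f ≠ 0 := by
  rw [← bijective_iff_det_ne_zero, Function.Bijective, LinearMap.injective_iff_surjective,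
    and_self]

theorem det_eq_im_conj_mul (L : ℂ →ₗ[ℝ] ℂ) :
    LinearMap.det L = (starRingEnd ℂ (L 1) * L Complex.I).im := by
  rw [← LinearMap.det_toMatrix Complex.basisOneI, Matrix.det_fin_two]
  simp only [LinearMap.toMatrix_apply, Complex.coe_basisOneI, Complex.coe_basisOneI_repr,
    Matrix.cons_val_zero, Matrix.cons_val_one, Complex.mul_im, Complex.conj_re, Complex.conj_im]
  ring

theorem det_complex_smul (c : ℂ) (L : ℂ →ₗ[ℝ] ℂ) :
    LinearMap.det (c • L) = ‖c‖ ^ 2 * LinearMap.det L := by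
  rw [det_eq_im_conj_mul, det_eq_im_conj_mul, LinearMap.smul_apply, LinearMap.smul_apply,
    smul_eq_mul, smul_eq_mul, map_mul, ← Complex.normSq_eq_norm_sq, ← Complex.im_ofReal_mul,
    ← Complex.mul_conj]
  ring_nf

end RealPlane

section SingularSymmetricMatrices

open Matrix

variable {ι R : Type*} [Fintype ι]

section CommRing

variable [CommRing R] {N N' : Matrix ι ι R} {k : ι → R} {j : ι}

theorem eq_of_isSymm_of_mulVec_eq_zero (hN : N.IsSymm) (hN' : N'.IsSymm) (hk : k j = 1)
    (hNk : N *ᵥ k = 0) (hNk' : N' *ᵥ k = 0) (h : ∀ a b, a ≠ j → b ≠ j → N a b = N' a b) :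
    N = N' := by
  have hcol (a : ι) (ha : ∀ b ≠ j, N a b = N' a b) : N a j = N' a j := by
    have hdiff : ((N - N') *ᵥ k) a = 0 := by simp only [sub_mulVec, hNk, hNk', sub_self,
      Pi.zero_apply]
    rw [mulVec, dotProduct, Finset.sum_eq_single j
      (fun b _ hb => by rw [Matrix.sub_apply, ha b hb, sub_self, zero_mul])
      (fun hj => absurd (Finset.mem_univ j) hj), hk, mul_one, Matrix.sub_apply] at hdiff
    exact sub_eq_zero.1 hdiff
  have hoff (a : ι) (ha : a ≠ j) (b : ι) : N a b = N' a b := by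
    by_cases hb : b = j
    · exact hb ▸ hcol a fun c hc => h a c ha hc
    · exact h a b ha hb
  have hrow (b : ι) (hb : b ≠ j) : N j b = N' j b := by
    rw [← hN.apply, ← hN'.apply, hoff b hb]
  ext a b
  by_cases ha : a = j
  · subst ha
    by_cases hb : b = a
    · exact hb ▸ hcol a hrow
    · exact hrow b hb
  · exact hoff a ha b

end CommRing

section IsDomain

variable [DecidableEq ι] [CommRing R] [IsDomain R] {N : Matrix ι ι R} {k : ι → R} {j : ι}

theorem adjugate_apply_eq_zero {w : ι → R} (hw : w ≠ 0) (hNw : N *ᵥ w = 0) {a : ι}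
    (hwa : w a = 0) (b : ι) : N.adjugate a b = 0 := by
  rw [adjugate_apply, ← exists_mulVec_eq_zero_iff]
  refine ⟨w, hw, funext fun i => ?_⟩
  rcases eq_or_ne i b with rfl | hi
  · simp only [mulVec, updateRow_self, single_dotProduct, hwa, mul_zero, Pi.zero_apply]
  · simpa only [mulVec, updateRow_ne hi] using congrFun hNw i

theorem eq_smul_of_adjugate_ne_zero (hk : k j = 1) (hNk : N *ᵥ k = 0) (hN : N.adjugate ≠ 0)
    {w : ι → R} (hNw : N *ᵥ w = 0) : w = w j • k := by
  obtain ⟨a, b, hab⟩ : ∃ a b, N.adjugate a b ≠ 0 := by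
    by_contra! h
    exact hN (ext h)
  have hker (u : ι → R) (hu : N *ᵥ u = 0) (hua : u a = 0) : u = 0 := by
    by_contra hu0
    exact hab (adjugate_apply_eq_zero hu0 hu hua b)
  have hka : k a ≠ 0 := fun h => one_ne_zero (hk.symm.trans (congrFun (hker k hNk h) j))
  have hprop : k a • w - w a • k = 0 :=
    hker _ (by rw [mulVec_sub, mulVec_smul, mulVec_smul, hNw, hNk, smul_zero, smul_zero, sub_zero])
      (by simp only [Pi.sub_apply, Pi.smul_apply, smul_eq_mul]; ring)
  have hwa : k a * w j = w a := by
    simpa only [Pi.sub_apply, Pi.smul_apply, smul_eq_mul, hk, mul_one, Pi.zero_apply, sub_eq_zero]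
      using congrFun hprop j
  refine smul_right_injective _ hka ?_
  simp only [smul_smul, hwa]
  exact sub_eq_zero.1 hprop

theorem adjugate_eq_smul_vecMulVec (hN : N.IsSymm) (hk : k j = 1) (hNk : N *ᵥ k = 0) :
    N.adjugate = N.adjugate j j • vecMulVec k k := by
  rcases eq_or_ne N.adjugate 0 with h | h
  · rw [h, Matrix.zero_apply, zero_smul]
  have hdet : N.det = 0 :=
    exists_mulVec_eq_zero_iff.1 ⟨k, fun h0 => by simp [h0] at hk, hNk⟩
  have hcol (a b : ι) : N.adjugate a b = N.adjugate j b * k a :=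
    congrFun (eq_smul_of_adjugate_ne_zero hk hNk h (w := fun i => N.adjugate i b) <|
      funext fun i => by
        simpa only [hdet, zero_smul, mul_apply, mulVec, dotProduct, Matrix.zero_apply,
          Pi.zero_apply] using
          congrFun (congrFun N.mul_adjugate i) b) a
  ext a b
  rw [Matrix.smul_apply, vecMulVec_apply, hcol a b, ← hN.adjugate.apply, hcol b j, smul_eq_mul]
  ring

theorem exists_mulVec_eq_zero_of_adjugate_eq_zero (hN : N.IsSymm) (hk : k j = 1)
    (hNk : N *ᵥ k = 0) (h : N.adjugate j j = 0) :
    ∃ w : ι → R, w ≠ 0 ∧ w j = 0 ∧ N *ᵥ w = 0 := by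
  rw [adjugate_apply, ← exists_mulVec_eq_zero_iff] at h
  obtain ⟨w, hw0, hw⟩ := h
  have hwj : w j = 0 := by
    simpa only [mulVec, updateRow_self, single_dotProduct, one_mul, Pi.zero_apply] using
      congrFun hw j
  have hoff (i : ι) (hi : i ≠ j) : (N *ᵥ w) i = 0 := by
    simpa only [mulVec, updateRow_ne hi, Pi.zero_apply] using congrFun hw i
  refine ⟨w, hw0, hwj, funext fun i => ?_⟩
  rcases eq_or_ne i j with rfl | hi
  · have horth : k ⬝ᵥ N *ᵥ w = 0 := by
      rw [dotProduct_mulVec, ← mulVec_transpose, hN.eq, hNk, zero_dotProduct]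
    rwa [dotProduct, Finset.sum_eq_single i (fun b _ hb => by rw [hoff b hb, mul_zero])
      (fun hi => absurd (Finset.mem_univ i) hi), hk, one_mul] at horth
  · exact hoff i hi

end IsDomain

section Field

variable {K : Type*} [DecidableEq ι] [Field K] {N : Matrix ι ι K} {w : ι → K}

theorem exists_eq_smul_of_adjugate_ne_zero (hw : w ≠ 0) (hNw : N *ᵥ w = 0) (hN : N.adjugate ≠ 0)
    {u : ι → K} (hNu : N *ᵥ u = 0) : ∃ a : K, u = a • w := by
  obtain ⟨j, hj⟩ := Function.ne_iff.1 hw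
  refine ⟨u j * (w j)⁻¹, ?_⟩
  have hscaled : N *ᵥ ((w j)⁻¹ • w) = 0 := by rw [mulVec_smul, hNw, smul_zero]
  rw [mul_smul]
  exact eq_smul_of_adjugate_ne_zero (k := (w j)⁻¹ • w) (inv_mul_cancel₀ hj) hscaled hN hNu

theorem exists_adjugate_eq_smul_vecMulVec (hN : N.IsSymm) (hw : w ≠ 0) (hNw : N *ᵥ w = 0) :
    ∃ c : K, N.adjugate = c • vecMulVec w w := by
  obtain ⟨j, hj⟩ := Function.ne_iff.1 hw
  refine ⟨N.adjugate j j * ((w j)⁻¹ * (w j)⁻¹), ?_⟩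
  rw [mul_smul, mul_smul, ← vecMulVec_smul, ← smul_vecMulVec]
  exact adjugate_eq_smul_vecMulVec hN (inv_mul_cancel₀ hj)
    (by rw [mulVec_smul, hNw, smul_zero])

end Field

end SingularSymmetricMatrices

section DerivativeOfDeterminant

open Matrix

variable {ι 𝕜 : Type*} [Fintype ι] [NontriviallyNormedField 𝕜]

/-- The linear form `X ↦ tr (A X)`, continuous for the topology of entrywise convergence.
For `A = adj N` it is the derivative of the determinant at `N` (Jacobi's formula). -/
def traceMulCLM (A : Matrix ι ι 𝕜) : (ι → ι → 𝕜) →L[𝕜] 𝕜 :=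
  ∑ a, ∑ b, A b a • (ContinuousLinearMap.proj (R := 𝕜) (φ := fun _ => 𝕜) b ∘L
    ContinuousLinearMap.proj (φ := fun _ => ι → 𝕜) a)

theorem traceMulCLM_apply (A : Matrix ι ι 𝕜) (X : ι → ι → 𝕜) :
    traceMulCLM A X = ∑ a, ∑ b, A b a * X a b := by
  simp only [traceMulCLM, _root_.sum_apply, _root_.smul_apply,
    ContinuousLinearMap.comp_apply, ContinuousLinearMap.proj_apply, smul_eq_mul]

theorem traceMulCLM_smul_vecMulVec (c : 𝕜) (k : ι → 𝕜) (X : ι → ι → 𝕜) :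
    traceMulCLM (c • vecMulVec k k) X = c * k ⬝ᵥ of X *ᵥ k := by
  simp only [traceMulCLM_apply, Matrix.smul_apply, vecMulVec_apply, smul_eq_mul, dotProduct, mulVec,
    Finset.mul_sum, of_apply]
  exact Finset.sum_congr rfl fun a _ => Finset.sum_congr rfl fun b _ => by ring

variable [DecidableEq ι]

theorem hasFDerivAt_det (N : ι → ι → 𝕜) :
    HasFDerivAt (fun M : ι → ι → 𝕜 => (of M).det) (traceMulCLM (of N).adjugate) N := by
  let f : ContinuousMultilinearMap 𝕜 (fun _ : ι => ι → 𝕜) 𝕜 :=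
    { (detRowAlternating (n := ι) (R := 𝕜)).toMultilinearMap with
      cont := Continuous.matrix_det (A := fun M : ι → ι → 𝕜 => of M) continuous_id }
  refine (f.hasFDerivAt N).congr_fderiv (ContinuousLinearMap.ext fun X => ?_)
  rw [ContinuousMultilinearMap.linearDeriv_apply, traceMulCLM_apply]
  refine Finset.sum_congr rfl fun a _ => ?_
  change ((of N).updateRow a (X a)).det = _
  rw [← cramer_transpose_apply, cramer_eq_adjugate_mulVec, mulVec, dotProduct]
  simp only [← adjugate_transpose, transpose_apply]

theorem hasFDerivAt_det_comp {𝕂 F : Type*} [NontriviallyNormedField 𝕂] [NormedAlgebra 𝕂 𝕜]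
    [NormedAddCommGroup F] [NormedSpace 𝕂 F] {m : F → ι → ι → 𝕜} {m' : F →L[𝕂] ι → ι → 𝕜}
    {z : F} (hm : HasFDerivAt m m' z) :
    HasFDerivAt (fun z => (of (m z)).det)
      ((traceMulCLM (of (m z)).adjugate).restrictScalars 𝕂 ∘L m') z :=
  ((hasFDerivAt_det (m z)).restrictScalars 𝕂).comp z hm

end DerivativeOfDeterminant

section SymmetricMatrices

open Matrix

variable {ι R : Type*}

/-- The symmetric matrix with entries `x s(a, b)`. Functions on `Sym2 ι` are used as linear
coordinates on the space of symmetric matrices. -/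
def symMat (x : Sym2 ι → R) : Matrix ι ι R := of fun a b => x s(a, b)

theorem symMat_apply (x : Sym2 ι → R) (a b : ι) : symMat x a b = x s(a, b) := rfl

theorem isSymm_symMat (x : Sym2 ι → R) : (symMat x).IsSymm :=
  ext fun _ _ => congrArg x Sym2.eq_swap

theorem symMat_injective : Function.Injective (symMat : (Sym2 ι → R) → Matrix ι ι R) :=
  fun _ _ h => funext <| Sym2.ind fun a b => congrFun (congrFun h a) b

theorem symMat_sub [Sub R] (x y : Sym2 ι → R) : symMat (x - y) = symMat x - symMat y := rfl

/-- The coordinates of a symmetric matrix. -/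
def symCoord (N : Matrix ι ι R) (hN : N.IsSymm) : Sym2 ι → R :=
  Sym2.lift ⟨N, fun a b => hN.apply b a⟩

theorem symCoord_mk {N : Matrix ι ι R} (hN : N.IsSymm) (a b : ι) :
    symCoord N hN s(a, b) = N a b := rfl

theorem symMat_symCoord {N : Matrix ι ι R} (hN : N.IsSymm) : symMat (symCoord N hN) = N := rfl

theorem isSymm_transpose_mul_mul_of_isSymm [Fintype ι] [CommRing R] {N : Matrix ι ι R}
    (P : Matrix ι ι R)
    (hN : N.IsSymm) : (Pᵀ * N * P).IsSymm := by
  rw [IsSymm, transpose_mul, transpose_mul, transpose_transpose, hN.eq, Matrix.mul_assoc]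

end SymmetricMatrices

section SingularParametrization

open Matrix

variable {ι R : Type*} [DecidableEq ι] [CommRing R]

/-- The vector with `j`-th entry `1` whose other entries are read off from the `j`-th column
of `x`. -/
def kerVec (j : ι) (x : Sym2 ι → R) : ι → R := Function.update (fun a => x s(a, j)) j 1

variable {j : ι} {x : Sym2 ι → R}

theorem kerVec_self : kerVec j x j = 1 := Function.update_self ..

theorem kerVec_of_ne {a : ι} (ha : a ≠ j) : kerVec j x a = x s(a, j) :=
  Function.update_of_ne ha ..

variable [Fintype ι]

/-- The projection along `kerVec j x` onto the vectors with vanishing `j`-th entry. -/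
def kerProj (j : ι) (x : Sym2 ι → R) : Matrix ι ι R := 1 - vecMulVec (kerVec j x) (Pi.single j 1)

/-- The coordinates of the symmetric matrix that annihilates `kerVec j x` and agrees with `x` off
the `j`-th row and column. This parametrizes the symmetric matrices with a kernel vector whose
`j`-th entry is `1`; the parameter `x s(j, j)` does not enter. -/
def singularParam (j : ι) (x : Sym2 ι → R) : Sym2 ι → R :=
  symCoord ((kerProj j x)ᵀ * symMat x * kerProj j x)
    (isSymm_transpose_mul_mul_of_isSymm _ (isSymm_symMat x))


theorem kerProj_mulVec (w : ι → R) : kerProj j x *ᵥ w = w - w j • kerVec j x := by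
  rw [kerProj, sub_mulVec, one_mulVec, vecMulVec_mulVec, single_one_dotProduct, op_smul_eq_smul]

theorem kerProj_mulVec_single {b : ι} (hb : b ≠ j) :
    kerProj j x *ᵥ Pi.single b 1 = Pi.single b 1 := by
  rw [kerProj_mulVec, Pi.single_eq_of_ne hb.symm, zero_smul, sub_zero]

theorem symMat_singularParam_mulVec_kerVec :
    symMat (singularParam j x) *ᵥ kerVec j x = 0 := by
  rw [singularParam, symMat_symCoord, ← mulVec_mulVec, kerProj_mulVec, kerVec_self, one_smul,
    sub_self, mulVec_zero]

theorem singularParam_apply_of_ne {a b : ι} (ha : a ≠ j) (hb : b ≠ j) :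
    singularParam j x s(a, b) = x s(a, b) := by
  have hdot (N : Matrix ι ι R) : N a b = Pi.single a 1 ⬝ᵥ N *ᵥ Pi.single b 1 := by
    rw [mulVec_single_one, single_one_dotProduct, col_apply]
  rw [singularParam, symCoord_mk, hdot (_ * _), ← mulVec_mulVec, ← mulVec_mulVec,
    dotProduct_mulVec, vecMul_transpose, kerProj_mulVec_single ha, kerProj_mulVec_single hb,
    ← hdot, symMat_apply]

theorem symMat_singularParam_eq {N : Matrix ι ι R} (hN : N.IsSymm)
    (hNk : N *ᵥ kerVec j x = 0) (h : ∀ a b, a ≠ j → b ≠ j → x s(a, b) = N a b) :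
    symMat (singularParam j x) = N :=
  eq_of_isSymm_of_mulVec_eq_zero (isSymm_symMat _) hN kerVec_self
    symMat_singularParam_mulVec_kerVec hNk fun a b ha hb =>
      (singularParam_apply_of_ne ha hb).trans (h a b ha hb)

theorem exists_symMat_singularParam_eq {N : Matrix ι ι R} (hN : N.IsSymm) {k : ι → R}
    (hk : k j = 1) (hNk : N *ᵥ k = 0) (z : R) :
    ∃ x, x s(j, j) = z ∧ symMat (singularParam j x) = N := by
  let x : Sym2 ι → R := symCoord (of fun a b =>
      if a = j then (if b = j then z else k b) else if b = j then k a else N a b) <|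
    IsSymm.ext fun a b => by
      simp only [of_apply]
      split_ifs <;> first | rfl | exact hN.apply a b
  have hx (a b : ι) : x s(a, b) =
    if a = j then (if b = j then z else k b) else if b = j then k a else N a b := rfl
  have hkx : kerVec j x = k := by
    funext a
    rcases eq_or_ne a j with rfl | ha
    · rw [kerVec_self, hk]
    · rw [kerVec_of_ne ha, hx, if_neg ha, if_pos rfl]
  refine ⟨x, by rw [hx, if_pos rfl, if_pos rfl], symMat_singularParam_eq hN (hkx ▸ hNk) ?_⟩
  intro a b ha hb
  rw [hx, if_neg ha, if_neg hb]

theorem singularParam_add_smul {w : ι → R} (hwj : w j = 0)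
    (hw : symMat (singularParam j x) *ᵥ w = 0) {y : Sym2 ι → R}
    (hyw : ∀ a ≠ j, y s(a, j) = w a) (hy : ∀ a b, a ≠ j → b ≠ j → y s(a, b) = 0) (t : R) :
    singularParam j (x + t • y) = singularParam j x := by
  have hker : kerVec j (x + t • y) = kerVec j x + t • w := by
    funext a
    rcases eq_or_ne a j with rfl | ha
    · simp only [Pi.add_apply, Pi.smul_apply, kerVec_self, hwj, smul_zero, add_zero]
    · simp only [Pi.add_apply, Pi.smul_apply, kerVec_of_ne ha, hyw a ha]
  refine symMat_injective (symMat_singularParam_eq (isSymm_symMat _) ?_ fun a b ha hb => ?_)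
  · rw [hker, mulVec_add, mulVec_smul, hw, smul_zero, add_zero,
      symMat_singularParam_mulVec_kerVec]
  · rw [Pi.add_apply, Pi.smul_apply, hy a b ha hb, smul_zero, add_zero, symMat_apply,
      singularParam_apply_of_ne ha hb]

end SingularParametrization

section GenericSymmetricMatrices

open Matrix

variable {ι : Type*}

theorem differentiable_kerVec [DecidableEq ι] {j : ι} (a : ι) :
    Differentiable ℝ fun x : Sym2 ι → ℂ => kerVec j x a := by
  rcases eq_or_ne a j with rfl | ha
  · simp only [kerVec_self, differentiable_const]
  · simp only [kerVec_of_ne ha]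
    fun_prop

variable [Fintype ι]

theorem dotProduct_fderiv_mulVec_eq_zero {𝕜 R F : Type*} [NontriviallyNormedField 𝕜]
    [NormedCommRing R] [NormedAlgebra 𝕜 R] [NormedAddCommGroup F] [NormedSpace 𝕜 F]
    {N : F → Matrix ι ι R} {k : F → ι → R} {N' : ι → ι → F →L[𝕜] R} {k' : ι → F →L[𝕜] R} {x : F}
    (hN : ∀ a b, HasFDerivAt (fun z => N z a b) (N' a b) x)
    (hk : ∀ a, HasFDerivAt (fun z => k z a) (k' a) x) (hsym : (N x).IsSymm)
    (hNk : ∀ z, N z *ᵥ k z = 0) (y : F) :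
    k x ⬝ᵥ (of fun a b => N' a b y) *ᵥ k x = 0 := by
  have hderiv (a : ι) : ∑ b, (N x a b * k' b y + k x b * N' a b y) = 0 := by
    have hprod := HasFDerivAt.fun_sum (u := Finset.univ) fun b _ => (hN a b).fun_mul (hk b)
    have hzero : (fun z => ∑ b, N z a b * k z b) = fun _ => 0 := funext fun z =>
      congrFun (hNk z) a
    rw [hzero] at hprod
    simpa using congrArg (· y) (hprod.unique (hasFDerivAt_const 0 x))
  have hvec : (of fun a b => N' a b y) *ᵥ k x + N x *ᵥ (fun b => k' b y) = 0 := by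
    funext a
    rw [Pi.zero_apply, ← hderiv a, add_comm, Finset.sum_add_distrib]
    simp only [Pi.add_apply, mulVec, dotProduct, of_apply, mul_comm (k x _)]
  have horth : k x ⬝ᵥ N x *ᵥ (fun b => k' b y) = 0 := by
    rw [dotProduct_mulVec, ← mulVec_transpose, hsym.eq, hNk, zero_dotProduct]
  rw [← dotProduct_zero (k x), ← hvec, dotProduct_add, horth, add_zero]

variable [DecidableEq ι] {j : ι} {x : Sym2 ι → ℂ}

theorem differentiable_singularParam (j : ι) : Differentiable ℝ (singularParam (R := ℂ) j) := by
  have hP (a b : ι) : Differentiable ℝ fun x : Sym2 ι → ℂ => kerProj j x a b := by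
    simp only [kerProj, Matrix.sub_apply, vecMulVec_apply]
    exact ((differentiable_kerVec a).mul_const _).const_sub _
  refine differentiable_pi.2 <| Sym2.ind fun a b => ?_
  simp only [singularParam, symCoord_mk, mul_apply, transpose_apply, symMat_apply]
  fun_prop

theorem kerVec_dotProduct_symMat_fderiv_singularParam (y : Sym2 ι → ℂ) :
    kerVec j x ⬝ᵥ symMat (fderiv ℝ (singularParam j) x y) *ᵥ kerVec j x = 0 :=
  have hN (a b : ι) : HasFDerivAt (fun z => symMat (singularParam j z) a b)
      (ContinuousLinearMap.proj (φ := fun _ : Sym2 ι => ℂ) s(a, b) ∘L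
        fderiv ℝ (singularParam j) x) x :=
    hasFDerivAt_pi'.1 (differentiable_singularParam j x).hasFDerivAt s(a, b)
  dotProduct_fderiv_mulVec_eq_zero hN (fun a => (differentiable_kerVec a x).hasFDerivAt)
    (isSymm_symMat _) (fun _ => symMat_singularParam_mulVec_kerVec) y

theorem exists_fderiv_singularParam_eq_zero
    (h : (symMat (singularParam j x)).adjugate j j = 0) :
    ∃ y ≠ 0, y s(j, j) = 0 ∧ fderiv ℝ (singularParam j) x y = 0 := by
  obtain ⟨w, hw0, hwj, hw⟩ := exists_mulVec_eq_zero_of_adjugate_eq_zero (isSymm_symMat _)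
    kerVec_self symMat_singularParam_mulVec_kerVec h
  let y : Sym2 ι → ℂ := symCoord (vecMulVec w (Pi.single j 1) + vecMulVec (Pi.single j 1) w) <| by
    rw [IsSymm, transpose_add, transpose_vecMulVec, transpose_vecMulVec, add_comm]
  have hy (a b : ι) : y s(a, b) =
    w a * (Pi.single j 1 : ι → ℂ) b + (Pi.single j 1 : ι → ℂ) a * w b := rfl
  have hyw (a : ι) (_ : a ≠ j) : y s(a, j) = w a := by
    rw [hy, Pi.single_eq_same, mul_one, hwj, mul_zero, add_zero]
  have hyoff (a b : ι) (ha : a ≠ j) (hb : b ≠ j) : y s(a, b) = 0 := by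
    rw [hy, Pi.single_eq_of_ne ha, Pi.single_eq_of_ne hb, mul_zero, zero_mul, add_zero]
  refine ⟨y, fun hy0 => hw0 (funext fun a => ?_), ?_, ?_⟩
  · rcases eq_or_ne a j with rfl | ha
    · exact hwj
    · rw [← hyw a ha, hy0, Pi.zero_apply, Pi.zero_apply]
  · rw [hy, hwj, zero_mul, mul_zero, add_zero]
  · have hline := (differentiable_singularParam j x).hasFDerivAt.hasLineDerivAt y
    refine hline.unique ((hasDerivAt_const (0 : ℝ) (singularParam j x)).congr_of_eventuallyEq ?_)
    exact .of_forall fun t => singularParam_add_smul hwj hw hyw hyoff (t : ℂ)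

/-- The map whose values are the constant symmetric matrices `B` for which the perturbed family
`m + B` is singular with a kernel vector whose `j`-th entry is `1`; the critical values among them
are the perturbations for which a zero of the determinant is not transverse. -/
def perturbMap (m : ℂ → Sym2 ι → ℂ) (j : ι) (x : Sym2 ι → ℂ) : Sym2 ι → ℂ :=
  singularParam j x - m (x s(j, j))

variable {m : ℂ → Sym2 ι → ℂ}

theorem hasFDerivAt_perturbMap (hm : DifferentiableAt ℝ m (x s(j, j))) :
    HasFDerivAt (perturbMap m j) (fderiv ℝ (singularParam j) x -
      fderiv ℝ m (x s(j, j)) ∘L ContinuousLinearMap.proj s(j, j)) x :=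
  (differentiable_singularParam j x).hasFDerivAt.sub
    (hm.hasFDerivAt.comp x (hasFDerivAt_apply s(j, j) x))

theorem adjugate_singularParam_ne_zero (hm : DifferentiableAt ℝ m (x s(j, j)))
    (hreg : (fderiv ℝ (perturbMap m j) x).det ≠ 0) :
    (symMat (singularParam j x)).adjugate j j ≠ 0 := by
  intro h
  obtain ⟨y, hy0, hyj, hy⟩ := exists_fderiv_singularParam_eq_zero h
  refine hy0 (((bijective_iff_det_ne_zero _).2 hreg).1 ?_)
  rw [(hasFDerivAt_perturbMap hm).fderiv]
  simp [hy, hyj]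

/-- Pairing a value of the derivative of `perturbMap` with the kernel vector leaves only the
contribution of `m`. -/
theorem surjective_kerVec_dotProduct_symMat_fderiv (hm : DifferentiableAt ℝ m (x s(j, j)))
    (hreg : (fderiv ℝ (perturbMap m j) x).det ≠ 0) :
    Function.Surjective fun z : ℂ =>
      kerVec j x ⬝ᵥ symMat (fderiv ℝ m (x s(j, j)) z) *ᵥ kerVec j x := by
  intro c
  obtain ⟨y, hy⟩ := ((bijective_iff_det_ne_zero _).2 hreg).2 (Pi.single s(j, j) (-c))
  have hkc : kerVec j x ⬝ᵥ symMat (Pi.single s(j, j) (-c)) *ᵥ kerVec j x = -c := by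
    have hsingle : symMat (Pi.single s(j, j) (-c)) = Matrix.single j j (-c) := by
      ext a b
      simp only [symMat_apply, Matrix.single_apply, Pi.single_apply, Sym2.eq_iff]
      exact if_congr (by tauto) rfl rfl
    rw [hsingle, single_mulVec, kerVec_self, mul_one]
    exact (dotProduct_single ..).trans (by rw [kerVec_self, one_mul])
  refine ⟨y s(j, j), ?_⟩
  have hLy : fderiv ℝ (singularParam j) x y - fderiv ℝ m (x s(j, j)) (y s(j, j)) =
      Pi.single s(j, j) (-c) := by
    rw [← hy, (hasFDerivAt_perturbMap hm).fderiv]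
    rfl
  rw [← hLy, symMat_sub, sub_mulVec, dotProduct_sub,
    kerVec_dotProduct_symMat_fderiv_singularParam, zero_sub, neg_inj] at hkc
  exact hkc

theorem det_fderiv_det_ne_zero_of_regular {B : Sym2 ι → ℂ}
    (hm : DifferentiableAt ℝ m (x s(j, j))) (hB : m (x s(j, j)) + B = singularParam j x)
    (hreg : (fderiv ℝ (perturbMap m j) x).det ≠ 0) :
    LinearMap.det (fderiv ℝ (fun z => (symMat (m z + B)).det) (x s(j, j)) : ℂ →ₗ[ℝ] ℂ) ≠ 0 := by
  have hsymMat : HasFDerivAt (fun z a b => symMat (m z + B) a b)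
      (.pi fun a => .pi fun b => .proj (φ := fun _ : Sym2 ι => ℂ) s(a, b) ∘L
        fderiv ℝ m (x s(j, j))) (x s(j, j)) :=
    hasFDerivAt_pi.2 fun a => hasFDerivAt_pi.2 fun b =>
      hasFDerivAt_pi'.1 (hm.hasFDerivAt.add_const B) s(a, b)
  have hdet := (hasFDerivAt_det_comp hsymMat).fderiv
  have hadj : (of (symMat (m (x s(j, j)) + B))).adjugate =
      (symMat (singularParam j x)).adjugate j j • vecMulVec (kerVec j x) (kerVec j x) := by
    rw [hB]
    exact adjugate_eq_smul_vecMulVec (isSymm_symMat (singularParam j x)) kerVec_self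
      symMat_singularParam_mulVec_kerVec
  refine (surjective_iff_det_ne_zero _).1 fun c => ?_
  obtain ⟨z, hz⟩ := surjective_kerVec_dotProduct_symMat_fderiv hm hreg
    (((symMat (singularParam j x)).adjugate j j)⁻¹ * c)
  refine ⟨z, ?_⟩
  change fderiv ℝ (fun z => (of (symMat (m z + B))).det) (x s(j, j)) z = c
  rw [hdet, ContinuousLinearMap.comp_apply, ContinuousLinearMap.coe_restrictScalars', hadj,
    traceMulCLM_smul_vecMulVec]
  exact (congrArg _ hz).trans (mul_inv_cancel_left₀ (adjugate_singularParam_ne_zero hm hreg) c)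

open MeasureTheory in
theorem ae_forall_det_fderiv_det_ne_zero {Ω : Set ℂ} (hm : ∀ z ∈ Ω, DifferentiableAt ℝ m z) :
    ∀ᵐ B : Sym2 ι → ℂ, ∀ z ∈ Ω, (symMat (m z + B)).det = 0 →
      LinearMap.det (fderiv ℝ (fun z => (symMat (m z + B)).det) z : ℂ →ₗ[ℝ] ℂ) ≠ 0 := by
  let crit (j : ι) : Set (Sym2 ι → ℂ) :=
    {x | x s(j, j) ∈ Ω ∧ (fderiv ℝ (perturbMap m j) x).det = 0}
  -- the easy case of Sard's theorem, for a map between spaces of equal dimension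
  have hnull (j : ι) : volume (perturbMap m j '' crit j) = 0 :=
    addHaar_image_eq_zero_of_det_fderivWithin_eq_zero volume
      (fun x hx =>
        (hasFDerivAt_perturbMap (hm _ hx.1)).differentiableAt.hasFDerivAt.hasFDerivWithinAt)
      (fun x hx => hx.2)
  filter_upwards [ae_all_iff.2 fun j => measure_eq_zero_iff_ae_notMem.1 (hnull j)]
    with B hB z hz hdet
  obtain ⟨k, hk0, hk⟩ := exists_mulVec_eq_zero_iff.2 hdet
  obtain ⟨j, hj⟩ := Function.ne_iff.1 hk0
  obtain ⟨x, rfl, hx⟩ := exists_symMat_singularParam_eq (isSymm_symMat (m z + B))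
    (k := (k j)⁻¹ • k) (j := j) (inv_mul_cancel₀ hj) (by rw [mulVec_smul, hk, smul_zero]) z
  have hxB : m (x s(j, j)) + B = singularParam j x := (symMat_injective hx).symm
  refine det_fderiv_det_ne_zero_of_regular (hm _ hz) hxB fun hcrit => hB j ⟨x, ⟨hz, hcrit⟩, ?_⟩
  rw [perturbMap, ← hxB, add_sub_cancel_left]

end GenericSymmetricMatrices

/-! ### Symmetric tensors -/

section SymmetricTensors

variable {V : Type*}

theorem comm_eq_of_mem_symTensors [AddCommGroup V] [Module ℂ V] {t : V ⊗[ℂ] V}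
    (ht : t ∈ symTensors V) : TensorProduct.comm ℂ V V t = t :=
  sub_eq_zero.1 (LinearMap.mem_ker.1 ht)

variable [NormedAddCommGroup V] [InnerProductSpace ℂ V]

theorem contract_tmul (ξ a b : V) : contract ξ (a ⊗ₜ[ℂ] b) = (inner ℂ ξ a : ℂ) • b := rfl

theorem inner_contract_comm (t : V ⊗[ℂ] V) (ξ ζ : V) :
    (inner ℂ ζ (contract ξ (TensorProduct.comm ℂ V V t)) : ℂ) = inner ℂ ξ (contract ζ t) := by
  induction t with
  | zero => simp only [map_zero, inner_zero_right]
  | tmul a b =>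
    rw [TensorProduct.comm_tmul, contract_tmul, contract_tmul, inner_smul_right,
      inner_smul_right, mul_comm]
  | add t u ht hu => simp only [map_add, inner_add_right, ht, hu]

theorem inner_contract_symm {t : V ⊗[ℂ] V} (ht : t ∈ symTensors V) (ξ ζ : V) :
    (inner ℂ ζ (contract ξ t) : ℂ) = inner ℂ ξ (contract ζ t) := by
  rw [← inner_contract_comm, comm_eq_of_mem_symTensors ht]

end SymmetricTensors

theorem exteriorPower_map_eq_zero {K V W : Type*} [Field K] [AddCommGroup V] [Module K V]
    [FiniteDimensional K V] [AddCommGroup W] [Module K W] {f : V →ₗ[K] W}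
    (hf : LinearMap.ker f ≠ ⊥) {n : ℕ} (hn : Module.finrank K V = n) :
    exteriorPower.map n f = 0 := by
  refine exteriorPower.linearMap_ext (AlternatingMap.ext fun φ => ?_)
  change exteriorPower.map n f (exteriorPower.ιMulti K n φ) = 0
  rw [exteriorPower.map_apply_ιMulti]
  refine AlternatingMap.map_linearDependent _ _ fun hli => ?_
  have hrange : n ≤ Module.finrank K (LinearMap.range f) := by
    simpa only [Fintype.card_fin] using (LinearIndependent.of_comp (v := f.rangeRestrict ∘ φ)
      (LinearMap.range f).subtype hli).fintype_card_le_finrank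
  have hker : 0 < Module.finrank K (LinearMap.ker f) :=
    Nat.pos_of_ne_zero fun h => hf (Submodule.finrank_eq_zero.1 h)
  have := f.finrank_range_add_finrank_ker
  lia

/-! ### Local frames -/

section LocalFrame

variable {S : Type*} [TopologicalSpace S] {r : ℕ} {E : S → Type*}
  [TopologicalSpace (TotalSpace (Fib r) E)]
  [∀ x, NormedAddCommGroup (E x)] [∀ x, InnerProductSpace ℂ (E x)]
  [FiberBundle (Fib r) E] [VectorBundle ℂ (Fib r) E]

theorem ofFib_toFib {p x : S} (hx : x ∈ (trivializationAt (Fib r) E p).baseSet) (ξ : E x) :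
    ofFib r E p x (toFib r E p x ξ) = ξ :=
  (trivializationAt (Fib r) E p).symmL_continuousLinearMapAt hx ξ

theorem toFib_ofFib {p x : S} (hx : x ∈ (trivializationAt (Fib r) E p).baseSet) (a : Fib r) :
    toFib r E p x (ofFib r E p x a) = a :=
  (trivializationAt (Fib r) E p).continuousLinearMapAt_symmL hx a

variable (r E) in
/-- The local frame `e_1, …, e_r` of `E` at `p`, dual to `coframe`. -/
def frame (p x : S) (i : Fin r) : E x :=
  ofFib r E p x (EuclideanSpace.single i 1)

theorem coframe_apply (p x : S) (i : Fin r) (ξ : E x) :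
    coframe r E p x i ξ = toFib r E p x ξ i := rfl

theorem coframe_frame {p x : S} (hx : x ∈ (trivializationAt (Fib r) E p).baseSet) (i j : Fin r) :
    coframe r E p x i (frame r E p x j) = if i = j then 1 else 0 := by
  rw [coframe_apply, frame, toFib_ofFib hx, PiLp.single_apply]

theorem ofFib_eq_sum (p x : S) (a : Fib r) : ofFib r E p x a = ∑ i, a i • frame r E p x i := by
  conv_lhs => rw [← (EuclideanSpace.basisFun (Fin r) ℂ).sum_repr a, map_sum]
  simp only [map_smul, EuclideanSpace.basisFun_repr, EuclideanSpace.basisFun_apply, frame]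

theorem sum_coframe_smul_frame {p x : S} (hx : x ∈ (trivializationAt (Fib r) E p).baseSet)
    (ξ : E x) : ∑ i, coframe r E p x i ξ • frame r E p x i = ξ := by
  conv_rhs => rw [← ofFib_toFib hx ξ, ofFib_eq_sum]
  rfl

theorem eq_zero_of_inner_frame {p x : S} (hx : x ∈ (trivializationAt (Fib r) E p).baseSet)
    {ξ : E x} (h : ∀ i, inner ℂ ξ (frame r E p x i) = (0 : ℂ)) : ξ = 0 := by
  rw [← inner_self_eq_zero (𝕜 := ℂ)]
  conv_lhs => rhs; rw [← sum_coframe_smul_frame hx ξ]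
  simp only [inner_sum, inner_smul_right, h, mul_zero, Finset.sum_const_zero]

theorem eq_zero_of_coframe {p x : S} (hx : x ∈ (trivializationAt (Fib r) E p).baseSet)
    {ξ : E x} (h : ∀ i, coframe r E p x i ξ = 0) : ξ = 0 := by
  rw [← sum_coframe_smul_frame hx ξ]
  simp only [h, zero_smul, Finset.sum_const_zero]

theorem exists_inner_frame {p x : S} [FiniteDimensional ℂ (E x)]
    (hx : x ∈ (trivializationAt (Fib r) E p).baseSet) (w : Fin r → ℂ) :
    ∃ ξ : E x, ∀ i, inner ℂ ξ (frame r E p x i) = w i := by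
  let φ : Module.Dual ℂ (E x) := ∑ i, w i • coframe r E p x i
  refine ⟨(InnerProductSpace.toDual ℂ (E x)).symm (LinearMap.toContinuousLinearMap φ), fun i => ?_⟩
  rw [InnerProductSpace.toDual_symm_apply]
  simp [φ, coframe_frame hx]

variable (r) in
include r in
theorem finrank_fibre (x : S) : Module.finrank ℂ (E x) = r := by
  have e := (trivializationAt (Fib r) E x).continuousLinearEquivAt ℂ x
    (mem_baseSet_trivializationAt (Fib r) E x)
  rw [e.toLinearEquiv.finrank_eq, finrank_euclideanSpace_fin]

variable (r) in
/-- The coefficient `t^{ij}` of a tensor `t = ∑ t^{ij} e_i ⊗ e_j` in the local frame at `p`. -/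
def tensorCoeff (p x : S) (i j : Fin r) : E x ⊗[ℂ] E x →ₗ[ℂ] ℂ :=
  (TensorProduct.lid ℂ ℂ).toLinearMap ∘ₗ
    TensorProduct.map (coframe r E p x i) (coframe r E p x j)

theorem tensorCoeff_tmul (p x : S) (a b : E x) (i j : Fin r) :
    tensorCoeff r p x i j (a ⊗ₜ[ℂ] b) = coframe r E p x i a * coframe r E p x j b := rfl

theorem tensorCoeff_symm {p x : S} {t : E x ⊗[ℂ] E x} (ht : t ∈ symTensors (E x)) (i j : Fin r) :
    tensorCoeff r p x i j t = tensorCoeff r p x j i t := by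
  have hcomm : tensorCoeff r p x i j ∘ₗ (TensorProduct.comm ℂ (E x) (E x)).toLinearMap =
      tensorCoeff r p x j i :=
    TensorProduct.ext' fun a b => mul_comm _ _
  rw [← hcomm, LinearMap.comp_apply, LinearEquiv.coe_coe, comm_eq_of_mem_symTensors ht]

theorem sum_tensorCoeff {p x : S} (hx : x ∈ (trivializationAt (Fib r) E p).baseSet)
    (t : E x ⊗[ℂ] E x) :
    ∑ i, ∑ j, tensorCoeff r p x i j t • (frame r E p x i ⊗ₜ[ℂ] frame r E p x j) = t := by
  induction t with
  | zero => simp only [map_zero, zero_smul, Finset.sum_const_zero]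
  | tmul a b =>
    conv_rhs => rw [← sum_coframe_smul_frame hx a, ← sum_coframe_smul_frame hx b]
    simp only [TensorProduct.sum_tmul, TensorProduct.tmul_sum, TensorProduct.smul_tmul_smul,
      tensorCoeff_tmul]
    exact Finset.sum_comm
  | add t u ht hu => simp only [map_add, add_smul, Finset.sum_add_distrib, ht, hu]

theorem coframe_contract {p x : S} (hx : x ∈ (trivializationAt (Fib r) E p).baseSet) (ξ : E x)
    (t : E x ⊗[ℂ] E x) (j : Fin r) :
    coframe r E p x j (contract ξ t) =
      ∑ i, inner ℂ ξ (frame r E p x i) * tensorCoeff r p x i j t := by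
  induction t with
  | zero => simp only [map_zero, mul_zero, Finset.sum_const_zero]
  | tmul a b =>
    rw [contract_tmul, map_smul, smul_eq_mul]
    conv_lhs => rw [← sum_coframe_smul_frame hx a, inner_sum, Finset.sum_mul]
    refine Finset.sum_congr rfl fun i _ => ?_
    rw [tensorCoeff_tmul, inner_smul_right]
    ring
  | add t u ht hu => simp only [map_add, ht, hu, mul_add, Finset.sum_add_distrib]

theorem contract_eq_zero_iff {p x : S} (hx : x ∈ (trivializationAt (Fib r) E p).baseSet)
    {t : E x ⊗[ℂ] E x} (ht : t ∈ symTensors (E x)) (ξ : E x) :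
    contract ξ t = 0 ↔ (Matrix.of fun i j => tensorCoeff r p x i j t).mulVec
      (fun i => inner ℂ ξ (frame r E p x i)) = 0 := by
  have hcoframe : ∀ j, (Matrix.of fun i j => tensorCoeff r p x i j t).mulVec
      (fun i => inner ℂ ξ (frame r E p x i)) j = coframe r E p x j (contract ξ t) := fun j => by
    rw [coframe_contract hx, Matrix.mulVec, dotProduct]
    exact Finset.sum_congr rfl fun i _ => by rw [Matrix.of_apply, tensorCoeff_symm ht, mul_comm]
  refine ⟨fun h => funext fun j => ?_, fun h => eq_zero_of_coframe hx fun j => ?_⟩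
  · rw [hcoframe, h, map_zero, Pi.zero_apply]
  · rw [← hcoframe, h, Pi.zero_apply]

end LocalFrame

section LocalCoordinate

variable {S : Type*} [TopologicalSpace S] [ChartedSpace ℂ S] [IsManifold 𝓘(ℂ, ℂ) ω S]

theorem coordVec_ne_zero {p x : S} (hx : x ∈ (chartAt ℂ p).source) : coordVec p x ≠ 0 := by
  intro h
  have hone := (trivializationAt ℂ (fun y : S => TangentSpace 𝓘(ℂ, ℂ) y)
    p).continuousLinearMapAt_symmL (R := ℂ) (b := x) hx (1 : ℂ)
  change (trivializationAt ℂ (fun y : S => TangentSpace 𝓘(ℂ, ℂ) y)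
    p).continuousLinearMapAt ℂ x (coordVec p x) = 1 at hone
  rw [h, map_zero] at hone
  exact zero_ne_one hone

theorem exists_smul_coordVec {p x : S} (hx : x ∈ (chartAt ℂ p).source) (v : Tan x) :
    ∃ c : ℂ, v = c • coordVec p x :=
  ⟨(show ℂ from v) / (show ℂ from coordVec p x),
    (div_mul_cancel₀ (show ℂ from v) (coordVec_ne_zero hx)).symm⟩

theorem coordVec_self (p : S) : coordVec p p = tanOne p := by
  rw [coordVec, TangentBundle.symmL_trivializationAt_eq_core (mem_chart_source ℂ p)]
  exact (tangentBundleCore 𝓘(ℂ, ℂ) S).coordChange_self _ _ (mem_chart_source ℂ p) _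

end LocalCoordinate

section LocalDomain

variable {S : Type*} [TopologicalSpace S] [ChartedSpace ℂ S] {r : ℕ} {E : S → Type*}
  [TopologicalSpace (TotalSpace (Fib r) E)]
  [∀ x, TopologicalSpace (E x)] [FiberBundle (Fib r) E]

variable (r E) in
/-- The set over which both the coordinate and the local frame at `p` are defined, the
counterpart on the surface of `chartDomain`. -/
def locDomain (p : S) : Set S :=
  (chartAt ℂ p).source ∩ (trivializationAt (Fib r) E p).baseSet

theorem mem_locDomain_self (p : S) : p ∈ locDomain r E p :=
  ⟨mem_chart_source ℂ p, mem_baseSet_trivializationAt (Fib r) E p⟩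

theorem isOpen_locDomain (p : S) : IsOpen (locDomain r E p) :=
  (chartAt ℂ p).open_source.inter (trivializationAt (Fib r) E p).open_baseSet

end LocalDomain

section ChartDomain

variable {S : Type*} [TopologicalSpace S] [ChartedSpace ℂ S] {r : ℕ} {E : S → Type*}
  [TopologicalSpace (TotalSpace (Fib r) E)]
  [∀ x, NormedAddCommGroup (E x)] [∀ x, InnerProductSpace ℂ (E x)]
  [FiberBundle (Fib r) E] [VectorBundle ℂ (Fib r) E]

theorem isOpen_chartDomain (p : S) : IsOpen (chartDomain r E p) :=
  (chartAt ℂ p).isOpen_inter_preimage_symm (trivializationAt (Fib r) E p).open_baseSet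

theorem chart_mem_chartDomain {p x : S} (hx : x ∈ locDomain r E p) :
    chartAt ℂ p x ∈ chartDomain r E p :=
  ⟨(chartAt ℂ p).map_source hx.1, by
    rw [Set.mem_preimage, (chartAt ℂ p).left_inv hx.1]; exact hx.2⟩

theorem chart_symm_mem_locDomain {p : S} {z : ℂ} (hz : z ∈ chartDomain r E p) :
    (chartAt ℂ p).symm z ∈ locDomain r E p :=
  ⟨(chartAt ℂ p).map_target hz.1, hz.2⟩

end ChartDomain

section Singular

variable {S : Type*} [TopologicalSpace S] [ChartedSpace ℂ S] [IsManifold 𝓘(ℂ, ℂ) ω S]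
  {E : S → Type*} [∀ x, NormedAddCommGroup (E x)] [∀ x, InnerProductSpace ℂ (E x)]
  (g : SurfaceMetric S) {x : S} (s : QuadFibre E x)

theorem ev_mu (ξ : E x) (v : Tan x) :
    KbarE.ev v (mu s ξ : KbarE g E x) = contract ξ (s v : E x ⊗[ℂ] E x) := rfl

theorem mu_eq_zero_iff (ξ : E x) {v : Tan x} (hv : ∃ c : ℂ, tanOne x = c • v) :
    (mu s ξ : KbarE g E x) = 0 ↔ contract ξ (s v : E x ⊗[ℂ] E x) = 0 := by
  refine ⟨fun h => by rw [← ev_mu g, h, map_zero], fun h => KbarE.ext_one ?_⟩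
  obtain ⟨c, hc⟩ := hv
  rw [ev_mu, hc, LinearMap.map_smulₛₗ, Submodule.coe_smul, map_smul, h, smul_zero]

theorem inner_kbarE (η ζ : KbarE g E x) :
    (inner ℂ η ζ : ℂ) = ((2 / metricAt g x (tanOne x) (tanOne x) : ℝ) : ℂ) *
      inner ℂ (KbarE.ev (tanOne x) η) (KbarE.ev (tanOne x) ζ) := rfl

variable [∀ x, FiniteDimensional ℂ (E x)]

theorem muAdj_apply (η : KbarE g E x) :
    muAdj g s η = ((2 / metricAt g x (tanOne x) (tanOne x) : ℝ) : ℂ) •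
      contract (KbarE.ev (tanOne x) η) (s (tanOne x) : E x ⊗[ℂ] E x) := by
  refine ext_inner_right ℝ fun ξ => ?_
  rw [muAdj, LinearMap.adjoint_inner_left, real_inner_eq_re_inner ℂ, real_inner_eq_re_inner ℂ,
    inner_smul_left, inner_kbarE, Complex.conj_ofReal, ← inner_conj_symm (contract _ _) ξ]
  change RCLike.re (_ * inner ℂ _ (contract ξ (s (tanOne x) : E x ⊗[ℂ] E x))) = _
  rw [inner_contract_symm (s (tanOne x)).2, RCLike.re_eq_complex_re, Complex.re_ofReal_mul,
    Complex.re_ofReal_mul, Complex.conj_re]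

theorem muAdj_eq_zero_iff (η : KbarE g E x) :
    muAdj g s η = 0 ↔ (mu s (KbarE.ev (tanOne x) η) : KbarE g E x) = 0 := by
  have hpos : ((2 / metricAt g x (tanOne x) (tanOne x) : ℝ) : ℂ) ≠ 0 :=
    Complex.ofReal_ne_zero.2 (div_pos two_pos (metricAt_tanOne_pos g x)).ne'
  rw [muAdj_apply, smul_eq_zero, or_iff_right hpos,
    mu_eq_zero_iff g s _ ⟨1, (one_smul ℂ _).symm⟩]

theorem ker_bigA_ne_bot_iff :
    LinearMap.ker (bigA g s) ≠ ⊥ ↔ ∃ ξ : E x, ξ ≠ 0 ∧ (mu s ξ : KbarE g E x) = 0 := by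
  constructor
  · intro h
    obtain ⟨⟨ξ, η⟩, hker, h0⟩ := Submodule.exists_mem_ne_zero_of_ne_bot h
    have hη : muAdj g s η = 0 := congrArg Prod.fst (LinearMap.mem_ker.1 hker)
    have hξ : muR g s ξ = 0 := congrArg Prod.snd (LinearMap.mem_ker.1 hker)
    by_cases hξ0 : ξ = 0
    · refine ⟨KbarE.ev (tanOne x) η, fun hev => h0 ?_, (muAdj_eq_zero_iff g _ η).1 hη⟩
      rw [hξ0, KbarE.ext_one hev]
      rfl
    · exact ⟨ξ, hξ0, hξ⟩
  · rintro ⟨ξ, hξ, h⟩ hbot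
    have hmem : ((ξ, 0) : E x × KbarE g E x) ∈ LinearMap.ker (bigA g s) :=
      LinearMap.mem_ker.2 (Prod.ext (map_zero (muAdj g s)) h)
    rw [hbot, Submodule.mem_bot] at hmem
    exact hξ (congrArg Prod.fst hmem)

theorem ker_muSharp_ne_bot {ξ : E x} (hξ : ξ ≠ 0) (h : (mu s ξ : KbarE g E x) = 0) (v : Tan x) :
    LinearMap.ker (muSharp g s v) ≠ ⊥ := by
  let ψ : Module.Dual ℂ (E x) := (InnerProductSpace.toDual ℂ (E x) ξ).toLinearMap
  have hψ : ψ ∈ LinearMap.ker (muSharp g s v) := by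
    change KbarE.ev v (mu s ((InnerProductSpace.toDual ℂ (E x)).symm
      (InnerProductSpace.toDual ℂ (E x) ξ)) : KbarE g E x) = 0
    rw [LinearIsometryEquiv.symm_apply_apply, h, map_zero]
  exact (Submodule.ne_bot_iff _).2
    ⟨ψ, hψ, fun h0 => hξ (inner_self_eq_zero.1 (LinearMap.congr_fun h0 ξ))⟩

end Singular

section DetCoeff

variable {S : Type*} [TopologicalSpace S] [ChartedSpace ℂ S] [IsManifold 𝓘(ℂ, ℂ) ω S]
  {r : ℕ} {E : S → Type*} [TopologicalSpace (TotalSpace (Fib r) E)]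
  [∀ x, NormedAddCommGroup (E x)] [∀ x, InnerProductSpace ℂ (E x)]
  [FiberBundle (Fib r) E] [VectorBundle ℂ (Fib r) E]

variable (r) in
/-- The matrix `s^{ij}` of coefficients of `s` in the coordinate and the frame at `p`, as a
function of the point `x` of the surface (`coeff` is the same function of the coordinate). -/
def coeffAt (s : ∀ x, QuadFibre E x) (p x : S) : Matrix (Fin r) (Fin r) ℂ :=
  Matrix.of fun i j => tensorCoeff r p x i j (s x (coordVec p x) : E x ⊗[ℂ] E x)

theorem of_coeff (s : ∀ x, QuadFibre E x) (p : S) (z : ℂ) :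
    Matrix.of (coeff r s p z) = coeffAt r s p ((chartAt ℂ p).symm z) := rfl

theorem isSymm_coeffAt (s : ∀ x, QuadFibre E x) (p x : S) : (coeffAt r s p x).IsSymm :=
  Matrix.ext fun _ _ => tensorCoeff_symm (Subtype.prop _) _ _

variable (g : SurfaceMetric S)

theorem mu_eq_zero_iff_mulVec (s : QuadSection r E) {p x : S} (hx : x ∈ locDomain r E p)
    (ξ : E x) : (mu (s.1 x) ξ : KbarE g E x) = 0 ↔
      (coeffAt r s.1 p x).mulVec (fun i => inner ℂ ξ (frame r E p x i)) = 0 := by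
  rw [mu_eq_zero_iff g (s.1 x) ξ (exists_smul_coordVec hx.1 _),
    contract_eq_zero_iff hx.2 (s.1 x (coordVec p x)).2]
  rfl

variable [∀ x, FiniteDimensional ℂ (E x)]

theorem coframe_muSharp {x : S} (s : QuadFibre E x) (p : S) (v : Tan x) (i j : Fin r) :
    coframe r E p x j (muSharp g s v (coframe r E p x i)) =
      tensorCoeff r p x i j (s v : E x ⊗[ℂ] E x) := by
  change coframe r E p x j (contract _ (s v : E x ⊗[ℂ] E x)) = _
  generalize (s v : E x ⊗[ℂ] E x) = t
  induction t with
  | zero => simp only [map_zero]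
  | tmul a b =>
    rw [contract_tmul, InnerProductSpace.toDual_symm_apply, map_smul, tensorCoeff_tmul]
    rfl
  | add t u ht hu => simp only [map_add, ht, hu]

theorem detCoeff_eq_det_coeff (s : QuadSection r E) (p : S) (z : ℂ) :
    detCoeff g s p z = (Matrix.of (coeff r s.1 p z)).det := by
  rw [detCoeff, detMu, exteriorPower.map_apply_ιMulti, exteriorPower.map_apply_ιMulti,
    exteriorPower.alternatingMapLinearEquiv_apply_ιMulti, Module.Basis.det_apply,
    ← Matrix.det_transpose]
  congr 1
  ext i j
  refine Eq.trans ?_ (coframe_muSharp g _ p _ i j)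
  simp [Module.Basis.toMatrix_apply, coframe_apply]

theorem detCoeff_chart (s : QuadSection r E) {p x : S} (hx : x ∈ (chartAt ℂ p).source) :
    detCoeff g s p (chartAt ℂ p x) = (coeffAt r s.1 p x).det := by
  rw [detCoeff_eq_det_coeff, of_coeff, (chartAt ℂ p).left_inv hx]

theorem exists_mu_eq_zero_iff_det (s : QuadSection r E) {p x : S} (hx : x ∈ locDomain r E p) :
    (∃ ξ : E x, ξ ≠ 0 ∧ (mu (s.1 x) ξ : KbarE g E x) = 0) ↔ (coeffAt r s.1 p x).det = 0 := by
  rw [← Matrix.exists_mulVec_eq_zero_iff]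
  constructor
  · rintro ⟨ξ, hξ, h⟩
    exact ⟨_, fun h0 => hξ (eq_zero_of_inner_frame hx.2 (congrFun h0)),
      (mu_eq_zero_iff_mulVec g s hx ξ).1 h⟩
  · rintro ⟨w, hw, h⟩
    obtain ⟨ξ, hξ⟩ := exists_inner_frame hx.2 w
    obtain rfl : (fun i => inner ℂ ξ (frame r E p x i)) = w := funext hξ
    refine ⟨ξ, ?_, (mu_eq_zero_iff_mulVec g s hx ξ).2 h⟩
    rintro rfl
    exact hw (funext fun i => inner_zero_left _)

theorem mem_detZeros_iff_exists_mu_eq_zero (s : QuadSection r E) {x : S} :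
    x ∈ detZeros g s ↔ ∃ ξ : E x, ξ ≠ 0 ∧ (mu (s.1 x) ξ : KbarE g E x) = 0 := by
  constructor
  · intro h
    rw [exists_mu_eq_zero_iff_det g s (mem_locDomain_self x),
      ← detCoeff_chart g s (mem_chart_source ℂ x), detCoeff,
      (chartAt ℂ x).left_inv (mem_chart_source ℂ x), h]
    simp only [LinearMap.zero_apply, map_zero]
  · rintro ⟨ξ, hξ, h⟩ v
    exact exteriorPower_map_eq_zero (ker_muSharp_ne_bot g _ hξ h v)
      (Subspace.dual_finrank_eq.trans (finrank_fibre r x))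

theorem mem_detZeros_iff_det (s : QuadSection r E) {p x : S} (hx : x ∈ locDomain r E p) :
    x ∈ detZeros g s ↔ (coeffAt r s.1 p x).det = 0 :=
  (mem_detZeros_iff_exists_mu_eq_zero g s).trans (exists_mu_eq_zero_iff_det g s hx)

theorem singularSet_eq_detZeros (s : QuadSection r E) : singularSet g s = detZeros g s :=
  Set.ext fun _ => (ker_bigA_ne_bot_iff g _).trans (mem_detZeros_iff_exists_mu_eq_zero g s).symm

end DetCoeff

/-! ### Change of coordinate and frame -/

section Calculus

theorem det_fderiv_ne_zero_of_comp_eventuallyEq_id {F : Type*} [NormedAddCommGroup F]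
    [NormedSpace ℝ F] {σ τ : F → F} {b : F} (hσ : DifferentiableAt ℝ σ b)
    (hτ : DifferentiableAt ℝ τ (σ b)) (h : τ ∘ σ =ᶠ[nhds b] id) :
    LinearMap.det (fderiv ℝ τ (σ b) : F →ₗ[ℝ] F) ≠ 0 := by
  have hid : fderiv ℝ τ (σ b) ∘L fderiv ℝ σ b = ContinuousLinearMap.id ℝ F :=
    (hτ.hasFDerivAt.comp b hσ.hasFDerivAt).unique ((hasFDerivAt_id b).congr_of_eventuallyEq h)
  have hdet := congrArg (fun L : F →L[ℝ] F => LinearMap.det (L : F →ₗ[ℝ] F)) hid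
  simp only [ContinuousLinearMap.toLinearMap_comp, LinearMap.det_comp,
    ContinuousLinearMap.coe_id, LinearMap.det_id] at hdet
  exact left_ne_zero_of_mul_eq_one hdet

theorem fderiv_mul_comp_of_eq_zero {J f τ : ℂ → ℂ} {a : ℂ} (hJ : DifferentiableAt ℝ J a)
    (hf : DifferentiableAt ℝ f (τ a)) (hτ : DifferentiableAt ℝ τ a) (h0 : f (τ a) = 0) :
    fderiv ℝ (fun z => J z * f (τ z)) a = J a • (fderiv ℝ f (τ a) ∘L fderiv ℝ τ a) := by
  refine (hJ.hasFDerivAt.mul (hf.hasFDerivAt.comp a hτ.hasFDerivAt)).fderiv.trans ?_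
  rw [Function.comp_apply, h0, zero_smul, add_zero]

variable {S : Type*} [TopologicalSpace S] [ChartedSpace ℂ S] [IsManifold 𝓘(ℂ, ℂ) ω S]

theorem contDiffOn_chart_symm_comp {F : Type*} [NormedAddCommGroup F] [NormedSpace ℂ F]
    [NormedSpace ℝ F] [IsScalarTower ℝ ℂ F] {f : S → F} {U : Set S} {q : S}
    (hf : ContMDiffOn 𝓘(ℂ, ℂ) 𝓘(ℂ, F) ω f U) :
    ContDiffOn ℝ ∞ (f ∘ (chartAt ℂ q).symm) ((chartAt ℂ q).target ∩ (chartAt ℂ q).symm ⁻¹' U) := by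
  have hsymm : ContMDiffOn 𝓘(ℂ, ℂ) 𝓘(ℂ, ℂ) ω (chartAt ℂ q).symm (chartAt ℂ q).target :=
    contMDiffOn_chart_symm
  have hcomp := hf.comp (hsymm.mono Set.inter_subset_left) (fun z hz => hz.2)
  exact ((contMDiffOn_iff_contDiffOn.1 hcomp).restrict_scalars ℝ).of_le le_top

end Calculus

section TangentTransition

variable {S : Type*} [TopologicalSpace S] [ChartedSpace ℂ S] [IsManifold 𝓘(ℂ, ℂ) ω S]

/-- The factor `c` in `∂/∂z_q = c ∂/∂z_p`, for the coordinates `z_p` and `z_q` at `p` and `q`. -/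
def transTan (p q x : S) : ℂ :=
  (trivializationAt ℂ (fun y : S => TangentSpace 𝓘(ℂ, ℂ) y) p).continuousLinearMapAt ℂ x
    (coordVec q x)

theorem coordVec_eq_transTan_smul {p x : S} (hx : x ∈ (chartAt ℂ p).source) (q : S) :
    coordVec q x = transTan p q x • coordVec p x := by
  have hsymm : (trivializationAt ℂ (fun y : S => TangentSpace 𝓘(ℂ, ℂ) y) p).symmL ℂ x
      (transTan p q x) = coordVec q x :=
    (trivializationAt ℂ (fun y : S => TangentSpace 𝓘(ℂ, ℂ) y)
      p).symmL_continuousLinearMapAt (R := ℂ) (b := x) hx (coordVec q x)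
  rw [show transTan p q x = transTan p q x • (1 : ℂ) from (mul_one _).symm, map_smul] at hsymm
  exact hsymm.symm

theorem transTan_ne_zero {p q x : S} (hp : x ∈ (chartAt ℂ p).source)
    (hq : x ∈ (chartAt ℂ q).source) : transTan p q x ≠ 0 := fun h =>
  coordVec_ne_zero hq (by rw [coordVec_eq_transTan_smul hp q, h, zero_smul])

end TangentTransition

section FrameTransition

variable {S : Type*} [TopologicalSpace S] {r : ℕ} {E : S → Type*}
  [TopologicalSpace (TotalSpace (Fib r) E)]
  [∀ x, NormedAddCommGroup (E x)] [∀ x, InnerProductSpace ℂ (E x)]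
  [FiberBundle (Fib r) E] [VectorBundle ℂ (Fib r) E]

variable (r E) in
/-- The matrix of the change from the local frame at `p` to the local frame at `q`. -/
def transMat (p q x : S) : Matrix (Fin r) (Fin r) ℂ :=
  Matrix.of fun i a => coframe r E q x i (frame r E p x a)

theorem transMat_mul {p q x : S} (hp : x ∈ (trivializationAt (Fib r) E p).baseSet)
    (hq : x ∈ (trivializationAt (Fib r) E q).baseSet) :
    transMat r E p q x * transMat r E q p x = 1 := by
  ext i j
  rw [Matrix.mul_apply, Matrix.one_apply, ← coframe_frame hq]
  conv_rhs => rw [← sum_coframe_smul_frame hp (frame r E q x j), map_sum]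
  refine Finset.sum_congr rfl fun a _ => ?_
  rw [map_smul, smul_eq_mul, mul_comm]
  rfl

theorem det_transMat_ne_zero {p q x : S} (hp : x ∈ (trivializationAt (Fib r) E p).baseSet)
    (hq : x ∈ (trivializationAt (Fib r) E q).baseSet) : (transMat r E p q x).det ≠ 0 :=
  (Matrix.isUnit_det_of_right_inverse (transMat_mul hp hq)).ne_zero

theorem tensorCoeff_trans {p x : S} (hp : x ∈ (trivializationAt (Fib r) E p).baseSet) (q : S)
    (t : E x ⊗[ℂ] E x) :
    (Matrix.of fun i j => tensorCoeff r q x i j t) =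
      transMat r E p q x * (Matrix.of fun i j => tensorCoeff r p x i j t) *
        (transMat r E p q x).transpose := by
  ext i j
  have hsum : tensorCoeff r q x i j t =
      ∑ a, ∑ b, tensorCoeff r p x a b t * (transMat r E p q x i a * transMat r E p q x j b) := by
    conv_lhs => rw [← sum_tensorCoeff hp t]
    simp only [map_sum, map_smul, smul_eq_mul]
    rfl
  rw [Matrix.of_apply, hsum, Finset.sum_comm]
  simp only [Matrix.mul_apply, Matrix.transpose_apply, Finset.sum_mul, Matrix.of_apply]
  exact Finset.sum_congr rfl fun b _ => Finset.sum_congr rfl fun a _ => by ring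

end FrameTransition

section DetTransition

variable {S : Type*} [TopologicalSpace S] [ChartedSpace ℂ S]
  {r : ℕ} {E : S → Type*} [TopologicalSpace (TotalSpace (Fib r) E)]
  [∀ x, NormedAddCommGroup (E x)] [∀ x, InnerProductSpace ℂ (E x)]
  [FiberBundle (Fib r) E] [VectorBundle ℂ (Fib r) E]

variable (r E) in
/-- The points of the chart domain at `q` that lie over the local domain at `p`. -/
def overlap (p q : S) : Set ℂ :=
  chartDomain r E q ∩ (chartAt ℂ q).symm ⁻¹' locDomain r E p

theorem isOpen_overlap (p q : S) : IsOpen (overlap r E p q) := by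
  have heq : overlap r E p q =
      (chartAt ℂ q).target ∩ (chartAt ℂ q).symm ⁻¹' (locDomain r E q ∩ locDomain r E p) :=
    Set.ext fun z => ⟨fun hz => ⟨hz.1.1, chart_symm_mem_locDomain hz.1, hz.2⟩,
      fun hz => ⟨⟨hz.1, hz.2.1.2⟩, hz.2.2⟩⟩
  rw [heq]
  exact (chartAt ℂ q).isOpen_inter_preimage_symm ((isOpen_locDomain q).inter (isOpen_locDomain p))

theorem chart_mem_overlap {p q x : S} (hp : x ∈ locDomain r E p) (hq : x ∈ locDomain r E q) :
    chartAt ℂ q x ∈ overlap r E p q :=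
  ⟨chart_mem_chartDomain hq, by rw [Set.mem_preimage, (chartAt ℂ q).left_inv hq.1]; exact hp⟩

variable [IsManifold 𝓘(ℂ, ℂ) ω S]

variable (r E) in
/-- The transition function of the line bundle `L = K̄^r ⊗ Λ^r E ⊗ Λ^r E`, from the frame at `p`
to the frame at `q`. -/
def transDet (p q x : S) : ℂ :=
  starRingEnd ℂ (transTan p q x) ^ r * (transMat r E p q x).det ^ 2

theorem transDet_ne_zero {p q x : S} (hp : x ∈ locDomain r E p) (hq : x ∈ locDomain r E q) :
    transDet r E p q x ≠ 0 :=
  mul_ne_zero (pow_ne_zero _ ((map_ne_zero _).2 (transTan_ne_zero hp.1 hq.1)))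
    (pow_ne_zero _ (det_transMat_ne_zero hp.2 hq.2))

theorem coeffAt_trans (s : ∀ x, QuadFibre E x) {p x : S} (hp : x ∈ locDomain r E p) (q : S) :
    coeffAt r s q x = starRingEnd ℂ (transTan p q x) •
      (transMat r E p q x * coeffAt r s p x * (transMat r E p q x).transpose) := by
  have hs : (s x (coordVec q x) : E x ⊗[ℂ] E x) =
      starRingEnd ℂ (transTan p q x) • (s x (coordVec p x) : E x ⊗[ℂ] E x) := by
    rw [coordVec_eq_transTan_smul hp.1 q, LinearMap.map_smulₛₗ, Submodule.coe_smul]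
  refine Eq.trans ?_ (congrArg (starRingEnd ℂ (transTan p q x) • ·)
    (tensorCoeff_trans (r := r) hp.2 q (s x (coordVec p x) : E x ⊗[ℂ] E x)))
  ext i j
  simp only [coeffAt, hs, Matrix.of_apply, Matrix.smul_apply, map_smul]

theorem det_coeffAt_trans (s : ∀ x, QuadFibre E x) {p x : S} (hp : x ∈ locDomain r E p) (q : S) :
    (coeffAt r s q x).det = transDet r E p q x * (coeffAt r s p x).det := by
  rw [coeffAt_trans s hp q, Matrix.det_smul, Matrix.det_mul, Matrix.det_mul,
    Matrix.det_transpose, Fintype.card_fin, transDet]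
  ring

theorem contDiffOn_coordChange (p q : S) :
    ContDiffOn ℝ ∞ (chartAt ℂ p ∘ (chartAt ℂ q).symm) (overlap r E p q) := by
  have hchart : ContMDiffOn 𝓘(ℂ, ℂ) 𝓘(ℂ, ℂ) ω (chartAt ℂ p) (chartAt ℂ p).source :=
    contMDiffOn_chart
  exact (contDiffOn_chart_symm_comp hchart).mono fun z hz => ⟨hz.1.1, hz.2.1⟩

theorem contDiffOn_transTan (p q : S) :
    ContDiffOn ℝ ∞ (fun z => transTan p q ((chartAt ℂ q).symm z)) (overlap r E p q) := by
  have hchange := (contDiffOn_chart_symm_comp (q := q) (contMDiffOn_coordChangeL (n := ω)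
    (IB := 𝓘(ℂ, ℂ)) (trivializationAt ℂ (fun y : S => TangentSpace 𝓘(ℂ, ℂ) y) q)
    (trivializationAt ℂ (fun y : S => TangentSpace 𝓘(ℂ, ℂ) y) p))).mono
      fun z (hz : z ∈ overlap r E p q) => ⟨hz.1.1, (chart_symm_mem_locDomain hz.1).1, hz.2.1⟩
  let ev : (ℂ →L[ℂ] ℂ) →L[ℝ] ℂ := (ContinuousLinearMap.apply ℂ ℂ (1 : ℂ)).restrictScalars ℝ
  refine (ev.contDiff.comp_contDiffOn hchange).congr fun z hz => ?_
  change _ = (trivializationAt ℂ (fun y : S => TangentSpace 𝓘(ℂ, ℂ) y) q).coordChangeL ℂ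
    (trivializationAt ℂ (fun y : S => TangentSpace 𝓘(ℂ, ℂ) y) p) ((chartAt ℂ q).symm z) 1
  rw [Trivialization.coordChangeL_apply _ _ ⟨(chart_symm_mem_locDomain hz.1).1, hz.2.1⟩, transTan,
    Trivialization.continuousLinearMapAt_apply_of_mem ℂ _ hz.2.1, coordVec,
    Trivialization.symmL_apply _ (chart_symm_mem_locDomain hz.1).1]

theorem det_fderiv_coordChange_ne_zero {p q x : S} (hp : x ∈ locDomain r E p)
    (hq : x ∈ locDomain r E q) :
    LinearMap.det (fderiv ℝ (chartAt ℂ p ∘ (chartAt ℂ q).symm) (chartAt ℂ q x) : ℂ →ₗ[ℝ] ℂ)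
      ≠ 0 := by
  have hpq : DifferentiableAt ℝ (chartAt ℂ p ∘ (chartAt ℂ q).symm) (chartAt ℂ q x) :=
    ((contDiffOn_coordChange p q).contDiffAt
      ((isOpen_overlap p q).mem_nhds (chart_mem_overlap hp hq))).differentiableAt (by simp)
  have hqp : DifferentiableAt ℝ (chartAt ℂ q ∘ (chartAt ℂ p).symm) (chartAt ℂ p x) :=
    ((contDiffOn_coordChange q p).contDiffAt
      ((isOpen_overlap q p).mem_nhds (chart_mem_overlap hq hp))).differentiableAt (by simp)
  have hx : (chartAt ℂ q ∘ (chartAt ℂ p).symm) (chartAt ℂ p x) = chartAt ℂ q x := by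
    rw [Function.comp_apply, (chartAt ℂ p).left_inv hp.1]
  rw [← hx] at hpq ⊢
  refine det_fderiv_ne_zero_of_comp_eventuallyEq_id hqp hpq ?_
  filter_upwards [(isOpen_overlap q p).mem_nhds (chart_mem_overlap hq hp)] with z hz
  rw [Function.comp_apply, Function.comp_apply, Function.comp_apply, (chartAt ℂ q).left_inv hz.2.1,
    (chartAt ℂ p).right_inv hz.1.1, id]

variable [ContMDiffVectorBundle ω (Fib r) E 𝓘(ℂ, ℂ)]

theorem contDiffOn_transMat (p q : S) (i a : Fin r) :
    ContDiffOn ℝ ∞ (fun z => transMat r E p q ((chartAt ℂ q).symm z) i a) (overlap r E p q) := by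
  have hchange := (contDiffOn_chart_symm_comp (q := q) (contMDiffOn_coordChangeL (n := ω)
    (IB := 𝓘(ℂ, ℂ)) (trivializationAt (Fib r) E p) (trivializationAt (Fib r) E q))).mono
      fun z (hz : z ∈ overlap r E p q) => ⟨hz.1.1, hz.2.2, hz.1.2⟩
  let ev : (Fib r →L[ℂ] Fib r) →L[ℝ] ℂ :=
    ((EuclideanSpace.proj i : Fib r →L[ℂ] ℂ) ∘L
      ContinuousLinearMap.apply ℂ (Fib r) (EuclideanSpace.single a (1 : ℂ))).restrictScalars ℝ
  refine (ev.contDiff.comp_contDiffOn hchange).congr fun z hz => ?_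
  simp only [transMat, Matrix.of_apply, coframe_apply, Function.comp_apply]
  change _ = ((trivializationAt (Fib r) E p).coordChangeL ℂ (trivializationAt (Fib r) E q)
    ((chartAt ℂ q).symm z) (EuclideanSpace.single a (1 : ℂ))) i
  rw [(trivializationAt (Fib r) E p).coordChangeL_apply _ ⟨hz.2.2, hz.1.2⟩, toFib,
    Trivialization.continuousLinearMapAt_apply_of_mem ℂ _ hz.1.2, frame, ofFib,
    Trivialization.symmL_apply _ hz.2.2]

theorem differentiableAt_transDet {p q : S} {z : ℂ} (hz : z ∈ overlap r E p q) :
    DifferentiableAt ℝ (fun z => transDet r E p q ((chartAt ℂ q).symm z)) z := by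
  have hnhds := (isOpen_overlap p q).mem_nhds hz
  have htan : DifferentiableAt ℝ (fun z => transTan p q ((chartAt ℂ q).symm z)) z :=
    ((contDiffOn_transTan p q).contDiffAt hnhds).differentiableAt (by simp)
  have hmat : DifferentiableAt ℝ
      (fun z => fun i a => transMat r E p q ((chartAt ℂ q).symm z) i a) z :=
    differentiableAt_pi.2 fun i => differentiableAt_pi.2 fun a =>
      ((contDiffOn_transMat p q i a).contDiffAt hnhds).differentiableAt (by simp)
  exact (((Complex.conjCLE : ℂ →L[ℝ] ℂ).differentiableAt.comp z htan).pow r).mul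
    ((hasFDerivAt_det_comp hmat.hasFDerivAt).differentiableAt.pow 2)

end DetTransition

section Transversality

variable {S : Type*} [TopologicalSpace S] [ChartedSpace ℂ S] [IsManifold 𝓘(ℂ, ℂ) ω S]
  {r : ℕ} {E : S → Type*} [TopologicalSpace (TotalSpace (Fib r) E)]
  [∀ x, NormedAddCommGroup (E x)] [∀ x, InnerProductSpace ℂ (E x)]
  [FiberBundle (Fib r) E] [VectorBundle ℂ (Fib r) E]

theorem contDiffAt_coeff (s : QuadSection r E) {p : S} {z : ℂ} (hz : z ∈ chartDomain r E p) :
    ContDiffAt ℝ ∞ (coeff r s.1 p) z :=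
  (s.2 p).contDiffAt ((isOpen_chartDomain p).mem_nhds hz)

variable [∀ x, FiniteDimensional ℂ (E x)] (g : SurfaceMetric S) (s : QuadSection r E)

theorem detCoeff_trans {p q : S} {z : ℂ} (hz : z ∈ overlap r E p q) :
    detCoeff g s q z = transDet r E p q ((chartAt ℂ q).symm z) *
      detCoeff g s p ((chartAt ℂ p ∘ (chartAt ℂ q).symm) z) := by
  rw [detCoeff_eq_det_coeff, of_coeff, det_coeffAt_trans s.1 hz.2, Function.comp_apply,
    detCoeff_chart g s hz.2.1]

theorem contDiffAt_detCoeff {p : S} {z : ℂ} (hz : z ∈ chartDomain r E p) :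
    ContDiffAt ℝ ∞ (detCoeff g s p) z := by
  rw [show detCoeff g s p = _ from funext (detCoeff_eq_det_coeff g s p)]
  simp only [Matrix.det_apply, Matrix.of_apply]
  refine ContDiffAt.sum fun σ _ => ContDiffAt.const_smul _ (contDiffAt_prod fun i _ => ?_)
  exact contDiffAt_pi.1 (contDiffAt_pi.1 (contDiffAt_coeff s hz) _) _

theorem det_fderiv_detCoeff_ne_zero_trans [ContMDiffVectorBundle ω (Fib r) E 𝓘(ℂ, ℂ)]
    {p q x : S} (hp : x ∈ locDomain r E p) (hq : x ∈ locDomain r E q) (hx : x ∈ detZeros g s)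
    (h : LinearMap.det (fderiv ℝ (detCoeff g s p) (chartAt ℂ p x) : ℂ →ₗ[ℝ] ℂ) ≠ 0) :
    LinearMap.det (fderiv ℝ (detCoeff g s q) (chartAt ℂ q x) : ℂ →ₗ[ℝ] ℂ) ≠ 0 := by
  have hmem := chart_mem_overlap hp hq
  have hnhds := (isOpen_overlap p q).mem_nhds hmem
  have hτ : (chartAt ℂ p ∘ (chartAt ℂ q).symm) (chartAt ℂ q x) = chartAt ℂ p x := by
    rw [Function.comp_apply, (chartAt ℂ q).left_inv hq.1]
  have hzero : detCoeff g s p (chartAt ℂ p x) = 0 :=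
    (detCoeff_chart g s hp.1).trans ((mem_detZeros_iff_det g s hp).1 hx)
  have hdiff : DifferentiableAt ℝ (detCoeff g s p) (chartAt ℂ p x) :=
    (contDiffAt_detCoeff g s (chart_mem_chartDomain hp)).differentiableAt (by simp)
  have htrans : detCoeff g s q =ᶠ[nhds (chartAt ℂ q x)] fun z =>
      transDet r E p q ((chartAt ℂ q).symm z) *
        detCoeff g s p ((chartAt ℂ p ∘ (chartAt ℂ q).symm) z) :=
    Filter.mem_of_superset hnhds fun z hz => detCoeff_trans g s hz
  rw [htrans.fderiv_eq, fderiv_mul_comp_of_eq_zero (differentiableAt_transDet hmem)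
    (by rwa [hτ]) (((contDiffOn_coordChange p q).contDiffAt hnhds).differentiableAt (by simp))
    (by rwa [hτ]), ContinuousLinearMap.toLinearMap_smul, det_complex_smul,
    hτ, (chartAt ℂ q).left_inv hq.1, ContinuousLinearMap.toLinearMap_comp, LinearMap.det_comp]
  exact mul_ne_zero (pow_ne_zero _ (norm_ne_zero_iff.2 (transDet_ne_zero hp hq)))
    (mul_ne_zero h (det_fderiv_coordChange_ne_zero hp hq))

end Transversality

/-! ### The smooth topology -/

section Calculus

variable {𝕜 V W : Type*} [NontriviallyNormedField 𝕜] [NormedAddCommGroup V] [NormedSpace 𝕜 V]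
  [NormedAddCommGroup W] [NormedSpace 𝕜 W]

theorem dist_iteratedFDeriv_zero (f h : V → W) (x : V) :
    dist (iteratedFDeriv 𝕜 0 f x) (iteratedFDeriv 𝕜 0 h x) = dist (f x) (h x) := by
  rw [iteratedFDeriv_zero_eq_comp, iteratedFDeriv_zero_eq_comp]
  exact (continuousMultilinearCurryFin0 𝕜 V W).symm.dist_map _ _

theorem dist_iteratedFDeriv_one (f h : V → W) (x : V) :
    dist (iteratedFDeriv 𝕜 1 f x) (iteratedFDeriv 𝕜 1 h x) =
      dist (fderiv 𝕜 f x) (fderiv 𝕜 h x) := by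
  have hcurry : ∀ f : V → W,
      continuousMultilinearCurryFin1 𝕜 V W (iteratedFDeriv 𝕜 1 f x) = fderiv 𝕜 f x :=
    fun f => ContinuousLinearMap.ext fun v => iteratedFDeriv_one_apply _
  rw [← (continuousMultilinearCurryFin1 𝕜 V W).dist_map, hcurry, hcurry]

theorem iteratedFDeriv_add_sum_smul {ι R : Type*} [NormedField R] [NormedSpace R W]
    [SMulCommClass 𝕜 R W] {s : Finset ι} {n : ℕ} {x : V} {f : V → W} {h : ι → V → W}
    (hf : ContDiffAt 𝕜 n f x) (hh : ∀ e ∈ s, ContDiffAt 𝕜 n (h e) x) (b : ι → R) :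
    iteratedFDeriv 𝕜 n (f + ∑ e ∈ s, b e • h e) x =
      iteratedFDeriv 𝕜 n f x + ∑ e ∈ s, b e • iteratedFDeriv 𝕜 n (h e) x := by
  have hsmul : ∀ e ∈ s, ContDiffAt 𝕜 n (b e • h e) x := fun e he => (hh e he).const_smul (b e)
  have hsum : ContDiffAt 𝕜 n (∑ e ∈ s, b e • h e) x := by
    simpa only [← Finset.sum_apply] using! ContDiffAt.sum hsmul
  rw [iteratedFDeriv_add_apply hf hsum, iteratedFDeriv_sum_apply hsmul]
  exact congrArg _ (Finset.sum_congr rfl fun e he => iteratedFDeriv_const_smul_apply (hh e he))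

theorem tendstoUniformlyOn_add_sum_smul {X ι R G : Type*} [Fintype ι] [NormedField R]
    [NormedAddCommGroup G] [NormedSpace R G] {K : Set X} (f : X → G) {h : ι → X → G}
    (hh : ∀ e, ∃ M, ∀ x ∈ K, ‖h e x‖ ≤ M) (b₀ : ι → R) :
    TendstoUniformlyOn (fun (b : ι → R) x => f x + ∑ e, b e • h e x)
      (fun x => f x + ∑ e, b₀ e • h e x) (nhds b₀) K := by
  choose M hM using hh
  have hlim : Filter.Tendsto (fun b : ι → R => ∑ e, ‖b₀ e - b e‖ * M e) (nhds b₀) (nhds 0) := by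
    have hcont : Continuous fun b : ι → R => ∑ e, ‖b₀ e - b e‖ * M e := by fun_prop
    simpa only [sub_self, norm_zero, zero_mul, Finset.sum_const_zero] using hcont.tendsto b₀
  refine Metric.tendstoUniformlyOn_iff.2 fun ε hε => ?_
  filter_upwards [hlim (Iio_mem_nhds hε)] with b hb x hx
  refine lt_of_le_of_lt ?_ hb
  rw [dist_add_left, dist_eq_norm, ← Finset.sum_sub_distrib]
  refine norm_sum_le_of_le _ fun e _ => ?_
  rw [← sub_smul]
  exact (norm_smul_le _ _).trans (mul_le_mul_of_nonneg_left (hM e x hx) (norm_nonneg _))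

theorem isOpen_setOf_jet_det_transverse (ι : Type*) [Fintype ι] [DecidableEq ι] :
    IsOpen {y : (ι → ι → ℂ) × (ℂ →L[ℝ] ι → ι → ℂ) | (Matrix.of y.1).det = 0 →
      LinearMap.det ((traceMulCLM (Matrix.of y.1).adjugate).restrictScalars ℝ ∘L y.2 :
        ℂ →ₗ[ℝ] ℂ) ≠ 0} := by
  have hmat : Continuous fun y : (ι → ι → ℂ) × (ℂ →L[ℝ] ι → ι → ℂ) => Matrix.of y.1 :=
    continuous_fst
  have hderiv : ∀ v : ℂ, Continuous fun y : (ι → ι → ℂ) × (ℂ →L[ℝ] ι → ι → ℂ) =>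
      traceMulCLM (Matrix.of y.1).adjugate (y.2 v) := fun v => by
    have hv : Continuous fun y : (ι → ι → ℂ) × (ℂ →L[ℝ] ι → ι → ℂ) => y.2 v :=
      continuous_snd.clm_apply continuous_const
    simp only [traceMulCLM_apply]
    exact continuous_finsetSum _ fun a _ => continuous_finsetSum _ fun b _ =>
      (hmat.matrix_adjugate.matrix_elem b a).mul
        ((continuous_apply b).comp ((continuous_apply a).comp hv))
  have hdet : Continuous fun y : (ι → ι → ℂ) × (ℂ →L[ℝ] ι → ι → ℂ) => LinearMap.det
      ((traceMulCLM (Matrix.of y.1).adjugate).restrictScalars ℝ ∘L y.2 : ℂ →ₗ[ℝ] ℂ) := by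
    simp only [det_eq_im_conj_mul]
    exact Complex.continuous_im.comp
      ((Complex.continuous_conj.comp (hderiv 1)).mul (hderiv Complex.I))
  simp only [imp_iff_not_or]
  exact (isOpen_ne_fun hmat.matrix_det continuous_const).union (isOpen_ne_fun hdet continuous_const)

end Calculus

section Topology

variable {S : Type*} [TopologicalSpace S] [ChartedSpace ℂ S] [IsManifold 𝓘(ℂ, ℂ) ω S]
  {r : ℕ} {E : S → Type*} [TopologicalSpace (TotalSpace (Fib r) E)]
  [∀ x, NormedAddCommGroup (E x)] [∀ x, InnerProductSpace ℂ (E x)]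
  [FiberBundle (Fib r) E] [VectorBundle ℂ (Fib r) E]

theorem eventually_dist_iteratedFDeriv_lt (s₀ : QuadSection r E) {p : S} {K : Set ℂ}
    (hK : IsCompact K) (hKp : K ⊆ chartDomain r E p) (n : ℕ) {ε : ℝ} (hε : 0 < ε) :
    ∀ᶠ s : QuadSection r E in nhds s₀, ∀ z ∈ K,
      dist (iteratedFDeriv ℝ n (coeff r s₀.1 p) z) (iteratedFDeriv ℝ n (coeff r s.1 p) z) < ε := by
  have hcont : Continuous (fun s : QuadSection r E =>
      UniformOnFun.ofFun {K : Set ℂ | IsCompact K ∧ K ⊆ chartDomain r E p}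
        (iteratedFDeriv ℝ n (coeff r s.1 p))) :=
    continuous_iInf_dom (i := p) (continuous_iInf_dom (i := n) continuous_induced_dom)
  exact Metric.tendstoUniformlyOn_iff.1
    (UniformOnFun.tendsto_iff_tendstoUniformlyOn.1 (hcont.tendsto s₀) K ⟨hK, hKp⟩) ε hε

theorem eventually_forall_jet_mem {p : S} {K : Set ℂ} (hK : IsCompact K)
    (hKp : K ⊆ chartDomain r E p) {O : Set ((Fin r → Fin r → ℂ) × (ℂ →L[ℝ] Fin r → Fin r → ℂ))}
    (hO : IsOpen O) {s₀ : QuadSection r E}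
    (hs₀ : ∀ z ∈ K, (coeff r s₀.1 p z, fderiv ℝ (coeff r s₀.1 p) z) ∈ O) :
    ∀ᶠ s : QuadSection r E in nhds s₀,
      ∀ z ∈ K, (coeff r s.1 p z, fderiv ℝ (coeff r s.1 p) z) ∈ O := by
  have hcont : ContinuousOn (fun z => (coeff r s₀.1 p z, fderiv ℝ (coeff r s₀.1 p) z)) K :=
    fun z hz => ((contDiffAt_coeff s₀ (hKp hz)).continuousAt.prodMk
      ((contDiffAt_coeff s₀ (hKp hz)).continuousAt_fderiv (by simp))).continuousWithinAt
  obtain ⟨δ, hδ, hsub⟩ := (hK.image_of_continuousOn hcont).exists_thickening_subset_open hO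
    (Set.image_subset_iff.2 hs₀)
  filter_upwards [eventually_dist_iteratedFDeriv_lt s₀ hK hKp 0 hδ,
    eventually_dist_iteratedFDeriv_lt s₀ hK hKp 1 hδ] with s hvalue hderiv z hz
  refine hsub (Metric.mem_thickening_iff.2 ⟨_, Set.mem_image_of_mem _ hz, ?_⟩)
  rw [dist_comm, Prod.dist_eq]
  exact max_lt (by simpa only [dist_iteratedFDeriv_zero] using hvalue z hz)
    (by simpa only [dist_iteratedFDeriv_one] using hderiv z hz)

theorem continuous_of_coeff_eq_add_sum_smul {ι : Type*} [Fintype ι] {s₀ : QuadSection r E}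
    {σ : ι → QuadSection r E} {F : (ι → ℂ) → QuadSection r E}
    (hF : ∀ B p, coeff r (F B).1 p = coeff r s₀.1 p + ∑ e, B e • coeff r (σ e).1 p) :
    Continuous F := by
  refine continuous_iInf_rng.2 fun p => continuous_iInf_rng.2 fun n => continuous_induced_rng.2 ?_
  refine continuous_iff_continuousAt.2 fun B₀ => ?_
  refine UniformOnFun.tendsto_iff_tendstoUniformlyOn.2 fun K hK => ?_
  have hn : (n : WithTop ℕ∞) ≤ ∞ := by exact_mod_cast le_top
  have hbound : ∀ e, ∃ M, ∀ z ∈ K, ‖iteratedFDeriv ℝ n (coeff r (σ e).1 p) z‖ ≤ M := fun e =>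
    hK.1.exists_bound_of_continuousOn fun z hz =>
      ((contDiffAt_coeff (σ e) (hK.2 hz)).continuousAt_iteratedFDeriv hn).continuousWithinAt
  have hexpand : ∀ B, ∀ z ∈ K, iteratedFDeriv ℝ n (coeff r s₀.1 p) z +
      ∑ e, B e • iteratedFDeriv ℝ n (coeff r (σ e).1 p) z =
        iteratedFDeriv ℝ n (coeff r (F B).1 p) z := fun B z hz => by
    rw [hF, iteratedFDeriv_add_sum_smul ((contDiffAt_coeff s₀ (hK.2 hz)).of_le hn)
      (fun e _ => (contDiffAt_coeff (σ e) (hK.2 hz)).of_le hn)]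
  exact ((tendstoUniformlyOn_add_sum_smul _ hbound B₀).congr
    (Filter.Eventually.of_forall hexpand)).congr_right (hexpand B₀)

variable [∀ x, FiniteDimensional ℂ (E x)] (g : SurfaceMetric S)

/-- The sections for which `det μ` has transverse zeros over the subset `K` of the coordinate
domain at `p`. -/
def transverseOn (p : S) (K : Set ℂ) : Set (QuadSection r E) :=
  {s | ∀ z ∈ K, detCoeff g s p z = 0 →
    LinearMap.det (fderiv ℝ (detCoeff g s p) z : ℂ →ₗ[ℝ] ℂ) ≠ 0}

theorem isOpen_transverseOn {p : S} {K : Set ℂ} (hK : IsCompact K)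
    (hKp : K ⊆ chartDomain r E p) : IsOpen (transverseOn g p K : Set (QuadSection r E)) := by
  have hjet : ∀ s : QuadSection r E, ∀ z ∈ K, fderiv ℝ (detCoeff g s p) z =
      (traceMulCLM (Matrix.of (coeff r s.1 p z)).adjugate).restrictScalars ℝ ∘L
        fderiv ℝ (coeff r s.1 p) z := fun s z hz => by
    have hd : DifferentiableAt ℝ (coeff r s.1 p) z :=
      (contDiffAt_coeff s (hKp hz)).differentiableAt (by simp)
    rw [show detCoeff g s p = _ from funext (detCoeff_eq_det_coeff g s p)]
    exact (hasFDerivAt_det_comp hd.hasFDerivAt).fderiv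
  refine isOpen_iff_mem_nhds.2 fun s₀ hs₀ => ?_
  filter_upwards [eventually_forall_jet_mem hK hKp (isOpen_setOf_jet_det_transverse (Fin r))
    fun z hz => by
      simpa only [Set.mem_ofPred_eq, detCoeff_eq_det_coeff, hjet s₀ z hz] using hs₀ z hz]
    with s hs z hz
  simpa only [Set.mem_ofPred_eq, detCoeff_eq_det_coeff, hjet s z hz] using hs z hz

theorem hasTransverseZeros_iff (s : QuadSection r E) :
    HasTransverseZeros g s ↔ ∀ p ∈ detZeros g s,
      LinearMap.det (fderiv ℝ (detCoeff g s p) (chartAt ℂ p p) : ℂ →ₗ[ℝ] ℂ) ≠ 0 :=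
  forall₂_congr fun p _ => bijective_iff_det_ne_zero (detDeriv g s p : ℂ →ₗ[ℝ] ℂ)

variable {g} {s : QuadSection r E}

theorem HasTransverseZeros.exists_nhds_inter_detZeros_subset (hs : HasTransverseZeros g s) (p : S) :
    ∃ U ∈ nhds p, U ∩ detZeros g s ⊆ {p} := by
  have hp := mem_locDomain_self (r := r) (E := E) p
  have hsmooth := contDiffAt_detCoeff g s (chart_mem_chartDomain hp)
  have hne : ∀ᶠ z in nhdsWithin (chartAt ℂ p p) {chartAt ℂ p p}ᶜ, detCoeff g s p z ≠ 0 := by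
    by_cases h0 : detCoeff g s p (chartAt ℂ p p) = 0
    · have hzero : p ∈ detZeros g s :=
        (mem_detZeros_iff_det g s hp).2 ((detCoeff_chart g s hp.1).symm.trans h0)
      obtain ⟨C, -, hC⟩ := (detDeriv g s p : ℂ →ₗ[ℝ] ℂ).exists_antilipschitzWith
        (LinearMap.ker_eq_bot.2 (hs p hzero).1)
      exact (hsmooth.differentiableAt (by simp)).hasFDerivAt.eventually_ne ⟨C, hC⟩
    · exact (hsmooth.continuousAt.eventually_ne h0).filter_mono nhdsWithin_le_nhds
  refine ⟨_, Filter.inter_mem ((isOpen_locDomain p).mem_nhds hp)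
    ((chartAt ℂ p).continuousAt hp.1 (eventually_nhdsWithin_iff.1 hne)), ?_⟩
  rintro x ⟨⟨hx, hxne⟩, hxzero⟩
  by_contra hxp
  refine hxne (fun h => hxp ((chartAt ℂ p).injOn hx.1 hp.1 h)) ?_
  exact (detCoeff_chart g s hx.1).trans ((mem_detZeros_iff_det g s hx).1 hxzero)

theorem HasTransverseZeros.finite_detZeros [CompactSpace S] (hs : HasTransverseZeros g s) :
    (detZeros g s).Finite := by
  choose U hU hUsub using hs.exists_nhds_inter_detZeros_subset
  obtain ⟨t, ht⟩ := CompactSpace.elim_nhds_subcover U hU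
  refine t.finite_toSet.subset fun x hx => ?_
  obtain ⟨p, hpt, hxp⟩ := Set.mem_iUnion₂.1 (ht ▸ Set.mem_univ x : x ∈ ⋃ p ∈ t, U p)
  rw [hUsub p ⟨hxp, hx⟩]
  exact hpt

end Topology

/-! ### Density of transversality -/

section FrameTensor

variable {S : Type*} [TopologicalSpace S] {r : ℕ} {E : S → Type*}
  [TopologicalSpace (TotalSpace (Fib r) E)]
  [∀ x, NormedAddCommGroup (E x)] [∀ x, InnerProductSpace ℂ (E x)]
  [FiberBundle (Fib r) E] [VectorBundle ℂ (Fib r) E]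

variable (r E) in
/-- The symmetric tensor `∑ B^{ij} e_i ⊗ e_j` in the local frame at `p`. -/
def frameTensor (p x : S) : (Sym2 (Fin r) → ℂ) →ₗ[ℂ] symTensors (E x) :=
  LinearMap.codRestrict (symTensors (E x))
    (∑ i, ∑ j, (LinearMap.proj (φ := fun _ => ℂ) s(i, j)).smulRight
      (frame r E p x i ⊗ₜ[ℂ] frame r E p x j)) fun B => by
    rw [symTensors, LinearMap.mem_ker, LinearMap.sub_apply, sub_eq_zero]
    simp only [LinearEquiv.coe_coe, LinearMap.sum_apply, LinearMap.smulRight_apply,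
      LinearMap.proj_apply, map_sum, map_smul, TensorProduct.comm_tmul, LinearMap.id_apply]
    rw [Finset.sum_comm]
    exact Finset.sum_congr rfl fun i _ => Finset.sum_congr rfl fun j _ => by rw [Sym2.eq_swap]

theorem tensorCoeff_frameTensor {p x : S} (hx : x ∈ (trivializationAt (Fib r) E p).baseSet)
    (B : Sym2 (Fin r) → ℂ) (i j : Fin r) :
    tensorCoeff r p x i j (frameTensor r E p x B : E x ⊗[ℂ] E x) = B s(i, j) := by
  simp only [frameTensor, LinearMap.codRestrict_apply, LinearMap.sum_apply,
    LinearMap.smulRight_apply, LinearMap.proj_apply, map_sum, map_smul, tensorCoeff_tmul,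
    coframe_frame hx, smul_eq_mul, mul_ite, mul_one, mul_zero, Finset.sum_ite_eq,
    Finset.mem_univ, if_true]

end FrameTensor

section Perturbation

variable {S : Type*} [TopologicalSpace S] [ChartedSpace ℂ S]

theorem exists_smoothBump [T2Space S] {p : S} {U : Set S} (hU : U ∈ nhds p) :
    ∃ χ : S → ℝ, ContDiffOn ℝ ∞ (χ ∘ (chartAt ℂ p).symm) (chartAt ℂ p).target ∧
      tsupport χ ⊆ U ∧ χ =ᶠ[nhds p] 1 := by
  obtain ⟨f, -, hf⟩ :=
    ((SmoothBumpFunction.nhds_basis_tsupport (I := 𝓘(ℝ, ℂ)) p).mem_iff).1 hU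
  refine ⟨f, f.toContDiffBump.contDiff.contDiffOn.congr fun z hz => ?_, hf, f.eventuallyEq_one⟩
  refine (f.eqOn_source ((chartAt ℂ p).map_target hz)).trans ?_
  exact congrArg f.toContDiffBump ((chartAt ℂ p).right_inv hz)

variable [IsManifold 𝓘(ℂ, ℂ) ω S]

theorem transTan_self {p x : S} (hx : x ∈ (chartAt ℂ p).source) : transTan p p x = 1 :=
  (trivializationAt ℂ (fun y : S => TangentSpace 𝓘(ℂ, ℂ) y)
    p).continuousLinearMapAt_symmL (R := ℂ) (b := x) hx (1 : ℂ)

variable {r : ℕ} {E : S → Type*} [TopologicalSpace (TotalSpace (Fib r) E)]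
  [∀ x, NormedAddCommGroup (E x)] [∀ x, InnerProductSpace ℂ (E x)]
  [FiberBundle (Fib r) E] [VectorBundle ℂ (Fib r) E]

variable (r E) in
/-- The local section `∑ B^{ij} dz̄ ⊗ e_i ⊗ e_j` in the coordinate and frame at `p`. -/
def frameSection (p x : S) : (Sym2 (Fin r) → ℂ) →ₗ[ℂ] QuadFibre E x where
  toFun B :=
    { toFun v := starRingEnd ℂ ((trivializationAt ℂ (fun y : S => TangentSpace 𝓘(ℂ, ℂ) y)
        p).continuousLinearMapAt ℂ x v) • frameTensor r E p x B
      map_add' v w := by rw [map_add, map_add, add_smul]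
      map_smul' c v := by rw [map_smul, smul_eq_mul, map_mul, mul_smul] }
  map_add' B C := LinearMap.ext fun v => by
    simp only [LinearMap.coe_mk, AddHom.coe_mk, LinearMap.add_apply, map_add, smul_add]
  map_smul' c B := LinearMap.ext fun v => by
    simp only [LinearMap.coe_mk, AddHom.coe_mk, LinearMap.smul_apply, map_smul, RingHom.id_apply,
      smul_comm c]

theorem coeffAt_frameSection {p x : S} (hx : x ∈ locDomain r E p) (B : Sym2 (Fin r) → ℂ) :
    coeffAt r (fun x => frameSection r E p x B) p x = symMat B := by
  ext i j
  have hone : frameSection r E p x B (coordVec p x) = frameTensor r E p x B := by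
    change starRingEnd ℂ (transTan p p x) • frameTensor r E p x B = _
    rw [transTan_self hx.1, map_one, one_smul]
  rw [coeffAt, Matrix.of_apply, hone, tensorCoeff_frameTensor hx.2, symMat_apply]

theorem coeffAt_frameSection_eq_sum (p : S) (B : Sym2 (Fin r) → ℂ) (q x : S) :
    coeffAt r (fun x => frameSection r E p x B) q x =
      ∑ e, B e • coeffAt r (fun x => frameSection r E p x (Pi.single e 1)) q x := by
  ext i j
  have hB : B = ∑ e, B e • Pi.single e (1 : ℂ) := pi_eq_sum_univ' B
  conv_lhs => rw [hB]
  simp only [coeffAt, map_sum, map_smul, Matrix.of_apply, Matrix.sum_apply, Matrix.smul_apply,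
    LinearMap.sum_apply, LinearMap.smul_apply, Submodule.coe_sum, Submodule.coe_smul]

theorem contDiffAt_coeff_frameSection [ContMDiffVectorBundle ω (Fib r) E 𝓘(ℂ, ℂ)] {p q : S} {z : ℂ}
    (hz : z ∈ overlap r E p q) (B : Sym2 (Fin r) → ℂ) :
    ContDiffAt ℝ ∞ (coeff r (fun x => frameSection r E p x B) q) z := by
  have hnhds := (isOpen_overlap p q).mem_nhds hz
  have htan : ContDiffAt ℝ ∞ (fun z => starRingEnd ℂ (transTan p q ((chartAt ℂ q).symm z))) z :=
    (Complex.conjCLE : ℂ →L[ℝ] ℂ).contDiff.contDiffAt.comp z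
      ((contDiffOn_transTan p q).contDiffAt hnhds)
  have hmat : ∀ i a, ContDiffAt ℝ ∞
      (fun z => transMat r E p q ((chartAt ℂ q).symm z) i a) z := fun i a =>
    (contDiffOn_transMat p q i a).contDiffAt hnhds
  refine contDiffAt_pi.2 fun i => contDiffAt_pi.2 fun j => ?_
  have hsmooth : ContDiffAt ℝ ∞ (fun z => starRingEnd ℂ (transTan p q ((chartAt ℂ q).symm z)) *
      ∑ c, (∑ a, transMat r E p q ((chartAt ℂ q).symm z) i a * B s(a, c)) *
        transMat r E p q ((chartAt ℂ q).symm z) j c) z :=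
    htan.mul (ContDiffAt.sum fun c _ => (ContDiffAt.sum fun a _ =>
      (hmat i a).mul contDiffAt_const).mul (hmat j c))
  refine hsmooth.congr_of_eventuallyEq ?_
  filter_upwards [hnhds] with y hy
  change coeffAt r (fun x => frameSection r E p x B) q ((chartAt ℂ q).symm y) i j = _
  rw [coeffAt_trans _ hy.2 q, coeffAt_frameSection hy.2]
  simp only [Matrix.smul_apply, Matrix.mul_apply, Matrix.transpose_apply, smul_eq_mul, symMat_apply]

variable [ContMDiffVectorBundle ω (Fib r) E 𝓘(ℂ, ℂ)] {p : S} {χ : S → ℝ}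

section Cutoff

variable (hχ : ContDiffOn ℝ ∞ (χ ∘ (chartAt ℂ p).symm) (chartAt ℂ p).target)
  (hsupp : tsupport χ ⊆ locDomain r E p)

include hχ hsupp in
theorem contDiffOn_smul_coeff_frameSection (B : Sym2 (Fin r) → ℂ) (q : S) :
    ContDiffOn ℝ ∞ (fun z => (χ ((chartAt ℂ q).symm z) : ℂ) •
      coeff r (fun x => frameSection r E p x B) q z) (chartDomain r E q) := by
  refine fun z hz => ContDiffAt.contDiffWithinAt ?_
  by_cases hx : (chartAt ℂ q).symm z ∈ locDomain r E p
  · have hnhds := (isOpen_overlap p q).mem_nhds ⟨hz, hx⟩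
    have hχp : ContDiffAt ℝ ∞ (χ ∘ (chartAt ℂ p).symm)
        ((chartAt ℂ p ∘ (chartAt ℂ q).symm) z) :=
      hχ.contDiffAt ((chartAt ℂ p).open_target.mem_nhds ((chartAt ℂ p).map_source hx.1))
    have hχq : ContDiffAt ℝ ∞ (fun z => χ ((chartAt ℂ q).symm z)) z := by
      refine (hχp.comp z ((contDiffOn_coordChange p q).contDiffAt hnhds)).congr_of_eventuallyEq ?_
      filter_upwards [hnhds] with y hy
      simp only [Function.comp_apply, (chartAt ℂ p).left_inv hy.2.1]
    exact (Complex.ofRealCLM.contDiff.contDiffAt.comp z hχq).smul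
      (contDiffAt_coeff_frameSection ⟨hz, hx⟩ B)
  · have hzero : ∀ᶠ y in nhds z, χ ((chartAt ℂ q).symm y) = 0 :=
      ((chartAt ℂ q).continuousAt_symm hz.1).eventually
        (notMem_tsupport_iff_eventuallyEq.1 fun h => hx (hsupp h))
    refine (contDiffAt_const (c := (0 : Fin r → Fin r → ℂ))).congr_of_eventuallyEq ?_
    filter_upwards [hzero] with y hy
    rw [hy, Complex.ofReal_zero, zero_smul]

/-- The local section with constant coefficients `B`, cut off by `χ`. -/
def cutoffSection (B : Sym2 (Fin r) → ℂ) : QuadSection r E :=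
  ⟨fun x => (χ x : ℂ) • frameSection r E p x B, fun q =>
    (contDiffOn_smul_coeff_frameSection hχ hsupp B q).congr fun z _ => by
      funext i j
      simp only [coeff, LinearMap.smul_apply, Submodule.coe_smul, map_smul, Pi.smul_apply]⟩

theorem coeffAt_cutoffSection (B : Sym2 (Fin r) → ℂ) (q x : S) :
    coeffAt r (cutoffSection hχ hsupp B).1 q x =
      (χ x : ℂ) • coeffAt r (fun x => frameSection r E p x B) q x := by
  ext i j
  simp only [coeffAt, cutoffSection, Matrix.of_apply, Matrix.smul_apply, LinearMap.smul_apply,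
    Submodule.coe_smul, map_smul]

/-- The perturbation of `s` by the cut-off local section with coefficients `B`. -/
def perturb (s : QuadSection r E) (B : Sym2 (Fin r) → ℂ) : QuadSection r E :=
  ⟨fun x => s.1 x + (cutoffSection hχ hsupp B).1 x, fun q =>
    ((s.2 q).add ((cutoffSection hχ hsupp B).2 q)).congr fun z _ => by
      funext i j
      simp only [coeff, LinearMap.add_apply, Submodule.coe_add, map_add, Pi.add_apply]⟩

theorem perturb_zero (s : QuadSection r E) : perturb hχ hsupp s 0 = s :=
  Subtype.ext <| funext fun x => by
    simp only [perturb, cutoffSection, map_zero, smul_zero, add_zero]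

theorem coeffAt_perturb (s : QuadSection r E) (B : Sym2 (Fin r) → ℂ) (q x : S) :
    coeffAt r (perturb hχ hsupp s B).1 q x =
      coeffAt r s.1 q x + coeffAt r (cutoffSection hχ hsupp B).1 q x := by
  ext i j
  simp only [coeffAt, perturb, Matrix.of_apply, Matrix.add_apply, LinearMap.add_apply,
    Submodule.coe_add, map_add]

theorem continuous_perturb (s : QuadSection r E) : Continuous (perturb hχ hsupp s) := by
  refine continuous_of_coeff_eq_add_sum_smul (s₀ := s)
    (σ := fun e => cutoffSection hχ hsupp (Pi.single e 1)) fun B q => ?_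
  have hcoeff (x : S) : coeffAt r (perturb hχ hsupp s B).1 q x = coeffAt r s.1 q x +
      ∑ e, B e • coeffAt r (cutoffSection hχ hsupp (Pi.single e 1)).1 q x := by
    simp only [coeffAt_perturb, coeffAt_cutoffSection, coeffAt_frameSection_eq_sum p B,
      Finset.smul_sum, smul_comm (B _)]
  funext z
  refine (hcoeff ((chartAt ℂ q).symm z)).trans ?_
  simp only [Pi.add_apply, Finset.sum_apply, Pi.smul_apply]
  rfl

variable [∀ x, FiniteDimensional ℂ (E x)] (g : SurfaceMetric S)

theorem detCoeff_perturb (s : QuadSection r E) (B : Sym2 (Fin r) → ℂ) {z : ℂ}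
    (hz : z ∈ chartDomain r E p) (hone : χ ((chartAt ℂ p).symm z) = 1) :
    detCoeff g (perturb hχ hsupp s B) p z =
      (coeffAt r s.1 p ((chartAt ℂ p).symm z) + symMat B).det := by
  rw [detCoeff_eq_det_coeff, of_coeff, coeffAt_perturb, coeffAt_cutoffSection,
    coeffAt_frameSection (chart_symm_mem_locDomain hz), hone, Complex.ofReal_one, one_smul]

include hχ hsupp in
theorem dense_transverseOn {Ω : Set ℂ} (hΩ : IsOpen Ω) (hΩp : Ω ⊆ chartDomain r E p)
    (hone : ∀ z ∈ Ω, χ ((chartAt ℂ p).symm z) = 1) :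
    Dense (transverseOn g p Ω : Set (QuadSection r E)) := by
  intro s
  let m (z : ℂ) : Sym2 (Fin r) → ℂ :=
    symCoord (coeffAt r s.1 p ((chartAt ℂ p).symm z)) (isSymm_coeffAt s.1 p _)
  have hm : ∀ z ∈ Ω, DifferentiableAt ℝ m z := fun z hz => by
    have hcoeff := (contDiffAt_coeff s (hΩp hz)).differentiableAt (by simp)
    exact differentiableAt_pi.2 (Sym2.ind fun i j =>
      differentiableAt_pi.1 (differentiableAt_pi.1 hcoeff i) j)
  have hdet (B : Sym2 (Fin r) → ℂ) : ∀ z ∈ Ω,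
      detCoeff g (perturb hχ hsupp s B) p z = (symMat (m z + B)).det := fun z hz =>
    detCoeff_perturb hχ hsupp g s B (hΩp hz) (hone z hz)
  have hdense := MeasureTheory.Measure.dense_of_ae (ae_forall_det_fderiv_det_ne_zero hm)
  have hclosure := image_closure_subset_closure_image (continuous_perturb hχ hsupp s)
    (Set.mem_image_of_mem _ (hdense 0))
  rw [perturb_zero] at hclosure
  refine closure_mono ?_ hclosure
  rintro _ ⟨B, hB, rfl⟩ z hz
  have heq : detCoeff g (perturb hχ hsupp s B) p =ᶠ[nhds z]
      fun y => (symMat (m y + B)).det :=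
    Filter.eventually_of_mem (hΩ.mem_nhds hz) (hdet B)
  rw [heq.fderiv_eq, hdet B z hz]
  exact hB z hz

end Cutoff

variable [∀ x, FiniteDimensional ℂ (E x)] (g : SurfaceMetric S)

theorem exists_isCompact_dense_transverseOn [T2Space S] (p : S) :
    ∃ K ∈ nhds (chartAt ℂ p p), IsCompact K ∧ K ⊆ chartDomain r E p ∧
      Dense (transverseOn g p K : Set (QuadSection r E)) := by
  obtain ⟨χ, hχ, hsupp, hone⟩ :=
    exists_smoothBump ((isOpen_locDomain (r := r) (E := E) p).mem_nhds (mem_locDomain_self p))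
  have hmem : chartAt ℂ p p ∈ chartDomain r E p := chart_mem_chartDomain (mem_locDomain_self p)
  have hone' : ∀ᶠ z in nhds (chartAt ℂ p p), χ ((chartAt ℂ p).symm z) = 1 := by
    refine ((chartAt ℂ p).continuousAt_symm hmem.1).eventually (p := fun x => χ x = 1) ?_
    rwa [(chartAt ℂ p).left_inv (mem_chart_source ℂ p)]
  obtain ⟨Ω, hΩ, hΩo, hpΩ⟩ := mem_nhds_iff.1
    (Filter.inter_mem ((isOpen_chartDomain p).mem_nhds hmem) hone')
  obtain ⟨K, hK, hKΩ, hKc⟩ := local_compact_nhds (hΩo.mem_nhds hpΩ)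
  refine ⟨K, hK, hKc, fun z hz => (hΩ (hKΩ hz)).1, ?_⟩
  exact (dense_transverseOn hχ hsupp g hΩo (fun z hz => (hΩ hz).1) fun z hz => (hΩ hz).2).mono
    fun _ (hs : ∀ z ∈ Ω, _) z hz => hs z (hKΩ hz)

theorem setOf_hasTransverseZeros_eq_biInter {K : S → Set ℂ} (hK : ∀ p, K p ⊆ chartDomain r E p)
    {t : Set S} (ht : ∀ x, ∃ p ∈ t, x ∈ locDomain r E p ∧ chartAt ℂ p x ∈ K p) :
    {s : QuadSection r E | HasTransverseZeros g s} = ⋂ p ∈ t, transverseOn g p (K p) := by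
  ext s
  rw [Set.mem_iInter₂, Set.mem_ofPred_eq, hasTransverseZeros_iff]
  constructor
  · intro h p _ z hz h0
    have hx := chart_symm_mem_locDomain (hK p hz)
    have hpx : chartAt ℂ p ((chartAt ℂ p).symm z) = z := (chartAt ℂ p).right_inv (hK p hz).1
    have hmem : (chartAt ℂ p).symm z ∈ detZeros g s := by
      rw [mem_detZeros_iff_det g s hx, ← detCoeff_chart g s hx.1, hpx, h0]
    rw [← hpx]
    exact det_fderiv_detCoeff_ne_zero_trans g s (mem_locDomain_self _) hx hmem (h _ hmem)
  · intro h x hx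
    obtain ⟨p, hpt, hxp, hxK⟩ := ht x
    refine det_fderiv_detCoeff_ne_zero_trans g s hxp (mem_locDomain_self x) hx (h p hpt _ hxK ?_)
    rw [detCoeff_chart g s hxp.1]
    exact (mem_detZeros_iff_det g s hxp).1 hx

theorem isOpen_and_dense_hasTransverseZeros [CompactSpace S] [T2Space S] :
    IsOpen {s : QuadSection r E | HasTransverseZeros g s} ∧
      Dense {s : QuadSection r E | HasTransverseZeros g s} := by
  choose K hKnhds hKc hKp hKdense using exists_isCompact_dense_transverseOn (r := r) (E := E) g
  obtain ⟨t, ht⟩ := CompactSpace.elim_nhds_subcover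
    (fun p => locDomain r E p ∩ chartAt ℂ p ⁻¹' K p) fun p => Filter.inter_mem
      ((isOpen_locDomain p).mem_nhds (mem_locDomain_self p))
      ((chartAt ℂ p).continuousAt (mem_chart_source ℂ p) (hKnhds p))
  have hcover (x : S) : ∃ p ∈ t, x ∈ locDomain r E p ∧ chartAt ℂ p x ∈ K p := by
    simpa only [Set.mem_iUnion, exists_prop, Set.mem_inter_iff, Set.mem_preimage] using
      ht.ge (Set.mem_univ x)
  have hopen (p : S) : IsOpen (transverseOn g p (K p) : Set (QuadSection r E)) :=
    isOpen_transverseOn g (hKc p) (hKp p)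
  have hdense (u : Finset S) :
      Dense (⋂ p ∈ u, transverseOn g p (K p) : Set (QuadSection r E)) := by
    classical
    induction u using Finset.induction_on with
    | empty => simp
    | insert p u _ ih =>
      rw [Finset.set_biInter_insert]
      exact (hKdense p).inter_of_isOpen_left ih (hopen p)
  rw [setOf_hasTransverseZeros_eq_biInter g hKp (t := t) hcover]
  exact ⟨isOpen_biInter_finset fun p _ => hopen p, hdense t⟩

end Perturbation

/-! ### Compatible metrics -/

section Metric

variable {S : Type*} [TopologicalSpace S] [ChartedSpace ℂ S] [IsManifold 𝓘(ℂ, ℂ) ω S]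

theorem metricAt_symm (g : SurfaceMetric S) {x : S} (v w : Tan x) :
    metricAt g x v w = metricAt g x w v := g.symm x _ _

theorem metricAt_I_smul_self {g : SurfaceMetric S} (hg : IsCompatible g) {x : S} (v : Tan x) :
    metricAt g x v (Complex.I • v) = 0 := by
  have hrot := hg x v (Complex.I • v)
  rw [smul_smul, Complex.I_mul_I, metricAt_smul, metricAt_symm g (Complex.I • v) v,
    Complex.neg_re, Complex.neg_im, Complex.one_re, Complex.one_im] at hrot
  linarith

theorem metricAt_smul_smul {g : SurfaceMetric S} (hg : IsCompatible g) {x : S} (v : Tan x)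
    (c : ℂ) : metricAt g x (c • v) (c • v) = ‖c‖ ^ 2 * metricAt g x v v := by
  have horth := metricAt_I_smul_self hg v
  rw [metricAt_smul g (c • v) v c, metricAt_symm g (c • v) v, metricAt_smul g v v c,
    metricAt_symm g (c • v) (Complex.I • v), metricAt_smul g (Complex.I • v) v c, hg,
    metricAt_symm g (Complex.I • v) v, horth, ← Complex.normSq_eq_norm_sq, Complex.normSq_apply]
  ring

theorem form01_tanOne {g : SurfaceMetric S} (hg : IsCompatible g) {x : S} (c : ℂ) :
    form01 g (c • tanOne x) (tanOne x) =
      ((metricAt g x (tanOne x) (tanOne x) / 2 : ℝ) : ℂ) * c := by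
  have horth := metricAt_I_smul_self hg (tanOne x)
  rw [form01, metricAt_symm g (c • tanOne x), metricAt_symm g (c • tanOne x),
    metricAt_smul g (tanOne x) (tanOne x) c, metricAt_smul g (Complex.I • tanOne x) (tanOne x) c,
    hg, metricAt_symm g (Complex.I • tanOne x), horth]
  apply Complex.ext <;> simp <;> ring

theorem IsOrthonormalFrame.exists_sign {g : SurfaceMetric S} (hg : IsCompatible g) {x : S}
    {e : Fin 2 → Tan x} (he : IsOrthonormalFrame g x e) :
    ∃ ε : ℝ, ε ^ 2 = 1 ∧ e 1 = ((ε : ℂ) * Complex.I) • e 0 := by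
  have h00 : metricAt g x (e 0) (e 0) = 1 := by simpa using he 0 0
  have h11 : metricAt g x (e 1) (e 1) = 1 := by simpa using he 1 1
  have h01 : metricAt g x (e 0) (e 1) = 0 := by simpa using he 0 1
  have hne : (show ℂ from e 0) ≠ 0 := fun h => by
    have h' : e 0 = (0 : ℂ) • e 0 := by rw [zero_smul]; exact h
    rw [h', metricAt_smul_smul hg, norm_zero, zero_pow two_ne_zero, zero_mul] at h00
    exact zero_ne_one h00
  obtain ⟨c, hc⟩ : ∃ c : ℂ, e 1 = c • e 0 :=
    ⟨(show ℂ from e 1) / (show ℂ from e 0), (div_mul_cancel₀ (show ℂ from e 1) hne).symm⟩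
  rw [hc, metricAt_smul, h00, metricAt_I_smul_self hg] at h01
  have hre : c.re = 0 := by linarith
  rw [hc, metricAt_smul_smul hg, h00, ← Complex.normSq_eq_norm_sq, Complex.normSq_apply, hre] at h11
  refine ⟨c.im, by linarith, ?_⟩
  rw [hc]
  congr 1
  apply Complex.ext <;> simp [hre]

theorem isOrthonormalFrame_pair {g : SurfaceMetric S} (hg : IsCompatible g) {x : S} {v : Tan x}
    (hv : metricAt g x v v = 1) : IsOrthonormalFrame g x ![v, Complex.I • v] := by
  have horth := metricAt_I_smul_self hg v
  intro i j
  fin_cases i <;> fin_cases j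
  · simpa using hv
  · simpa using horth
  · simpa [metricAt_symm g _ v] using horth
  · simpa [hg x v v] using hv

theorem trivializationAt_real_eq {p x : S} (hx : x ∈ (chartAt ℂ p).source) (v : ℂ) :
    (trivializationAt ℂ (fun y : S => TangentSpace 𝓘(ℝ, ℂ) y) p ⟨x, v⟩).2 =
      (trivializationAt ℂ (fun y : S => TangentSpace 𝓘(ℂ, ℂ) y) p ⟨x, v⟩).2 := by
  rw [TangentBundle.trivializationAt_apply, TangentBundle.trivializationAt_apply]
  have h := hasFDerivWithinAt_tangentCoordChange (I := 𝓘(ℂ, ℂ)) (x := x) (y := p) (z := x)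
    ⟨mem_extChartAt_source x, by simpa using hx⟩
  have hunique : UniqueDiffWithinAt ℝ (Set.range 𝓘(ℂ, ℂ)) (extChartAt 𝓘(ℂ, ℂ) x x) := by
    simp [uniqueDiffWithinAt_univ]
  have hreal := (h.restrictScalars ℝ).fderivWithin hunique
  exact congrArg (fun L : ℂ →L[ℝ] ℂ => L v) hreal

theorem contMDiffAt_coordVec (p : S) :
    ContMDiffAt 𝓘(ℝ, ℂ) (𝓘(ℝ, ℂ).prod 𝓘(ℝ, ℂ)) ∞
      (fun x => TotalSpace.mk' ℂ (E := fun y : S => TangentSpace 𝓘(ℝ, ℂ) y) x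
        (show TangentSpace 𝓘(ℝ, ℂ) x from coordVec p x)) p := by
  rw [contMDiffAt_section]
  refine (contMDiffAt_const (c := (1 : ℂ))).congr_of_eventuallyEq ?_
  filter_upwards [(chartAt ℂ p).open_source.mem_nhds (mem_chart_source ℂ p)] with x hx
  refine (trivializationAt_real_eq hx (coordVec p x)).trans ?_
  have hinv := (trivializationAt ℂ (fun y : S => TangentSpace 𝓘(ℂ, ℂ) y)
    p).continuousLinearMapAt_symmL (R := ℂ) (b := x) hx (1 : ℂ)
  rw [Trivialization.continuousLinearMapAt_apply_of_mem ℂ _ hx] at hinv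
  exact hinv

theorem differentiableAt_metricAt_coordVec (g : SurfaceMetric S) (p : S) :
    DifferentiableAt ℝ (fun z : ℂ => metricAt g ((chartAt ℂ p).symm z)
      (coordVec p ((chartAt ℂ p).symm z)) (coordVec p ((chartAt ℂ p).symm z)))
      (chartAt ℂ p p) := by
  have h : ContMDiffAt 𝓘(ℝ, ℂ) (𝓘(ℝ, ℂ).prod 𝓘(ℝ)) ∞
      (fun x => TotalSpace.mk' ℝ (E := Bundle.Trivial S ℝ) x
        (metricAt g x (coordVec p x) (coordVec p x))) p :=
    ContMDiffAt.clm_bundle_apply₂ (F₁ := ℂ) (F₂ := ℂ) (b := fun x : S => x)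
      (E₁ := fun y : S => TangentSpace 𝓘(ℝ, ℂ) y) (E₂ := fun y : S => TangentSpace 𝓘(ℝ, ℂ) y)
      g.contMDiff.contMDiffAt (contMDiffAt_coordVec p) (contMDiffAt_coordVec p)
  rw [contMDiffAt_section] at h
  have hmetric : ContMDiffAt 𝓘(ℝ, ℂ) 𝓘(ℝ) ∞
      (fun x => metricAt g x (coordVec p x) (coordVec p x)) p := h
  have hsymm : ContMDiffAt 𝓘(ℝ, ℂ) 𝓘(ℝ, ℂ) ∞ (chartAt ℂ p).symm (chartAt ℂ p p) :=
    (contMDiffOn_chart_symm (I := 𝓘(ℝ, ℂ)) (n := ∞) (x := p)).contMDiffAt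
      ((chartAt ℂ p).open_target.mem_nhds (mem_chart_target ℂ p))
  have hcomp := ContMDiffAt.comp (chartAt ℂ p p)
    (g := fun x => metricAt g x (coordVec p x) (coordVec p x))
    (by rw [(chartAt ℂ p).left_inv (mem_chart_source ℂ p)]; exact hmetric) hsymm
  exact (contMDiffAt_iff_contDiffAt.1 hcomp).differentiableAt (by simp)

end Metric

/-! ### Conjugate-linear maps of complex lines -/

section ConjugateLinearModel

open ComplexConjugate

variable {V : Type*} [AddCommGroup V] [Module ℝ V]

theorem eigenspace_smul_mul {t : ℝ} (ht : t ≠ 0) (T : Module.End ℝ V) (a : ℝ) :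
    (t • T).eigenspace (t * a) = T.eigenspace a := by
  ext v
  rw [Module.End.mem_eigenspace_iff, Module.End.mem_eigenspace_iff, LinearMap.smul_apply,
    mul_smul, smul_right_inj ht]

theorem positiveSpace_le_positiveSpace_smul {t : ℝ} (ht : 0 < t) (T : Module.End ℝ V) :
    positiveSpace T ≤ positiveSpace (t • T) := by
  refine iSup_le fun a => ?_
  rw [← eigenspace_smul_mul ht.ne']
  exact le_iSup (fun a : {a : ℝ // 0 < a} => (t • T).eigenspace a.1) ⟨t * a, mul_pos ht a.2⟩

theorem positiveSpace_smul_of_pos {t : ℝ} (ht : 0 < t) (T : Module.End ℝ V) :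
    positiveSpace (t • T) = positiveSpace T := by
  refine le_antisymm ?_ (positiveSpace_le_positiveSpace_smul ht T)
  simpa only [inv_smul_smul₀ ht.ne'] using
    positiveSpace_le_positiveSpace_smul (inv_pos.2 ht) (t • T)

theorem disjoint_positiveSpace_smul_of_neg {t : ℝ} (ht : t < 0) (T : Module.End ℝ V) :
    Disjoint (positiveSpace T) (positiveSpace (t • T)) := by
  have hdisj : Disjoint (⨆ a ∈ Set.Ioi (0 : ℝ), T.eigenspace a)
      (⨆ a ∈ Set.Iio (0 : ℝ), T.eigenspace a) :=
    T.eigenspaces_iSupIndep.disjoint_biSup_biSup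
      (Set.disjoint_left.2 fun _ ha hb => lt_asymm (Set.mem_Ioi.1 ha) (Set.mem_Iio.1 hb))
  refine hdisj.mono (iSup_le fun a => le_biSup T.eigenspace a.2) (iSup_le fun a => ?_)
  rw [← mul_div_cancel₀ a.1 ht.ne, eigenspace_smul_mul ht.ne]
  exact le_biSup T.eigenspace (Set.mem_Iio.2 (div_neg_of_pos_of_neg a.2 ht))

variable (ψ : ℂ ≃ₗ[ℝ] V)

section Single

variable {T : Module.End ℝ V} {c : ℂ}

theorem positiveSpace_eq_eigenspace (hc : c ≠ 0) (hT : ∀ l, T (ψ l) = ψ (c * conj l)) :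
    positiveSpace T = T.eigenspace ‖c‖ := by
  refine le_antisymm (iSup_le fun t v hv => ?_)
    (le_iSup (fun t : {t : ℝ // 0 < t} => T.eigenspace t.1) ⟨‖c‖, norm_pos_iff.2 hc⟩)
  obtain ⟨l, rfl⟩ := ψ.surjective v
  by_cases hl : l = 0
  · rw [hl, map_zero]
    exact Submodule.zero_mem _
  have heig := Module.End.mem_eigenspace_iff.1 hv
  rw [hT, ← map_smul] at heig
  have hnorm := congrArg norm (ψ.injective heig)
  rw [norm_mul, RCLike.norm_conj, norm_smul, Real.norm_of_nonneg t.2.le] at hnorm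
  rw [mul_right_cancel₀ (norm_ne_zero_iff.2 hl) hnorm]
  exact hv

theorem positiveSpace_eq_span_singleton {u : ℂ} (hu : u ≠ 0)
    (hT : ∀ l, T (ψ l) = ψ (u ^ 2 * conj l)) :
    positiveSpace T = Submodule.span ℝ {ψ u} := by
  have hTu : ∀ q : ℂ, T (ψ (q * u)) = ψ (‖u ^ 2‖ • (conj q * u)) := fun q => by
    rw [hT, map_mul (starRingEnd ℂ), Complex.real_smul, norm_pow, Complex.ofReal_pow,
      ← Complex.mul_conj']
    congr 1
    ring
  ext v
  obtain ⟨l, rfl⟩ := ψ.surjective v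
  obtain ⟨q, rfl⟩ : ∃ q, l = q * u := ⟨l / u, (div_mul_cancel₀ l hu).symm⟩
  rw [positiveSpace_eq_eigenspace ψ (pow_ne_zero 2 hu) hT, Module.End.mem_eigenspace_iff, hTu,
    ← map_smul, ψ.injective.eq_iff, smul_right_inj (norm_ne_zero_iff.2 (pow_ne_zero 2 hu)),
    mul_left_inj' hu, Complex.conj_eq_iff_real, Submodule.mem_span_singleton]
  refine exists_congr fun a => ?_
  rw [← map_smul, ψ.injective.eq_iff, Complex.real_smul, mul_left_inj' hu, eq_comm]

theorem nonempty_positiveSpace_equiv (hc : c ≠ 0) (hT : ∀ l, T (ψ l) = ψ (c * conj l)) :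
    Nonempty (positiveSpace T ≃ₗ[ℝ] ℝ) := by
  obtain ⟨u, rfl⟩ := IsAlgClosed.exists_pow_nat_eq c (n := 2) two_pos
  have hu : u ≠ 0 := fun h => hc (by rw [h, zero_pow two_ne_zero])
  rw [positiveSpace_eq_span_singleton ψ hu hT]
  exact ⟨(LinearEquiv.toSpanNonzeroSingleton ℝ V (ψ u) (ψ.map_ne_zero_iff.2 hu)).symm⟩

end Single

variable {T : Fin 2 → Module.End ℝ V} {c : Fin 2 → ℂ}

theorem commute_iff_im_eq_zero (hT : ∀ α l, T α (ψ l) = ψ (c α * conj l)) :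
    (∀ α β, Commute (T α) (T β)) ↔ (c 0 * conj (c 1)).im = 0 := by
  have hcomp : ∀ α β l, (T α * T β) (ψ l) = ψ (c α * conj (c β) * l) := fun α β l => by
    rw [Module.End.mul_apply, hT, hT, map_mul (starRingEnd ℂ), Complex.conj_conj, mul_assoc]
  have hflip : c 1 * conj (c 0) = conj (c 0 * conj (c 1)) := by
    rw [map_mul, Complex.conj_conj, mul_comm]
  constructor
  · intro h
    have hone : (T 0 * T 1) (ψ 1) = (T 1 * T 0) (ψ 1) := by rw [(h 0 1).eq]
    rw [hcomp, hcomp, mul_one, mul_one, hflip] at hone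
    exact Complex.conj_eq_iff_im.1 (ψ.injective hone).symm
  · intro h
    have h01 : Commute (T 0) (T 1) := by
      refine LinearMap.ext fun v => ?_
      obtain ⟨l, rfl⟩ := ψ.surjective v
      rw [hcomp, hcomp, hflip, Complex.conj_eq_iff_im.2 h]
    intro α β
    fin_cases α <;> fin_cases β
    · exact Commute.refl _
    · exact h01
    · exact h01.symm
    · exact Commute.refl _

theorem eq_smul_of_im_eq_zero (hT : ∀ α l, T α (ψ l) = ψ (c α * conj l)) (hc : c 0 ≠ 0)
    (him : (c 0 * conj (c 1)).im = 0) :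
    T 1 = ((c 0 * conj (c 1)).re / ‖c 0‖ ^ 2) • T 0 := by
  have hreal : conj (c 0) * c 1 = ((c 0 * conj (c 1)).re : ℂ) := by
    rw [Complex.conj_eq_iff_re.1 (Complex.conj_eq_iff_im.2 him), ← Complex.conj_eq_iff_im.2 him,
      map_mul, Complex.conj_conj]
  have hc1 : c 1 = ((c 0 * conj (c 1)).re / ‖c 0‖ ^ 2 : ℝ) * c 0 := by
    rw [Complex.ofReal_div, ← hreal, Complex.ofReal_pow, ← Complex.conj_mul']
    field [(map_ne_zero (starRingEnd ℂ)).2 hc]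
  ext v
  obtain ⟨l, rfl⟩ := ψ.surjective v
  rw [LinearMap.smul_apply, hT, hT, ← map_smul, Complex.real_smul, ← mul_assoc, ← hc1]

theorem nonempty_iInf_positiveSpace_equiv (hT : ∀ α l, T α (ψ l) = ψ (c α * conj l))
    (him : (c 0 * conj (c 1)).im = 0) (hre : 0 < (c 0 * conj (c 1)).re) :
    Nonempty ((⨅ α, positiveSpace (T α) : Submodule ℝ V) ≃ₗ[ℝ] ℝ) := by
  have hc : c 0 ≠ 0 := fun h => by simp [h] at hre
  have h10 : positiveSpace (T 1) = positiveSpace (T 0) := by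
    rw [eq_smul_of_im_eq_zero ψ hT hc him, positiveSpace_smul_of_pos (by positivity)]
  have hconst : ∀ α, positiveSpace (T α) = positiveSpace (T 0) := Fin.forall_fin_two.2 ⟨rfl, h10⟩
  rw [iInf_congr hconst, iInf_const]
  exact nonempty_positiveSpace_equiv ψ hc (hT 0)

theorem iInf_positiveSpace_eq_bot (hT : ∀ α l, T α (ψ l) = ψ (c α * conj l))
    (him : (c 0 * conj (c 1)).im = 0) (hre : (c 0 * conj (c 1)).re < 0) :
    (⨅ α, positiveSpace (T α) : Submodule ℝ V) = ⊥ := by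
  have hc : c 0 ≠ 0 := fun h => by simp [h] at hre
  have hdisj : Disjoint (positiveSpace (T 0)) (positiveSpace (T 1)) := by
    rw [eq_smul_of_im_eq_zero ψ hT hc him]
    exact disjoint_positiveSpace_smul_of_neg (div_neg_of_neg_of_pos hre (by positivity)) _
  exact eq_bot_iff.2 ((le_inf (iInf_le _ 0) (iInf_le _ 1)).trans hdisj.le_bot)

end ConjugateLinearModel

section ComplexLine

variable {V : Type*} [NormedAddCommGroup V] [InnerProductSpace ℂ V] {K : Submodule ℝ V} {k : V}

/-- The coordinate on a complex line `K` spanned by a unit vector `k`. The line is given as a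
real subspace, which is how the kernels of `μ` and `μ*` arise. -/
def lineEquiv (hk : ‖k‖ = 1) (hK : ∀ v, v ∈ K ↔ ∃ l : ℂ, v = l • k) : ℂ ≃ₗ[ℝ] K where
  toFun l := ⟨l • k, (hK _).2 ⟨l, rfl⟩⟩
  map_add' l m := Subtype.ext (add_smul l m k)
  map_smul' t l := Subtype.ext (smul_assoc t l k)
  invFun v := inner ℂ k (v : V)
  left_inv l := by
    change inner ℂ k (l • k) = l
    rw [inner_smul_right, inner_self_eq_norm_sq_to_K, hk]
    simp
  right_inv v := by
    obtain ⟨l, hl⟩ := (hK _).1 v.2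
    refine Subtype.ext ?_
    change (inner ℂ k (v : V) : ℂ) • k = v
    rw [hl, inner_smul_right, inner_self_eq_norm_sq_to_K, hk]
    simp

theorem coe_lineEquiv (hk : ‖k‖ = 1) (hK : ∀ v, v ∈ K ↔ ∃ l : ℂ, v = l • k) (l : ℂ) :
    (lineEquiv hk hK l : V) = l • k := rfl

theorem orthogonalProjectionOnto_eq_lineEquiv [K.HasOrthogonalProjection] (hk : ‖k‖ = 1)
    (hK : ∀ v, v ∈ K ↔ ∃ l : ℂ, v = l • k) (y : V) :
    K.orthogonalProjectionOnto y = lineEquiv hk hK (inner ℂ k y) := by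
  refine Subtype.ext ?_
  refine Submodule.eq_starProjection_of_mem_of_inner_eq_zero (Subtype.prop _) fun w hw => ?_
  obtain ⟨l, rfl⟩ := (hK _).1 hw
  rw [coe_lineEquiv, real_inner_eq_re_inner ℂ, inner_smul_right, ← inner_conj_symm,
    inner_sub_right, inner_smul_right, inner_self_eq_norm_sq_to_K, hk]
  simp

end ComplexLine

section PlaneMaps

open ComplexConjugate

variable (L : ℂ →ₗ[ℝ] ℂ)

theorem im_mul_conj_rotate (z : ℂ) :
    (L z * conj (L (Complex.I * z))).im = -(‖z‖ ^ 2 * LinearMap.det L) := by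
  have h := det_eq_im_conj_mul (L ∘ₗ Algebra.lmul ℝ ℂ z)
  rw [LinearMap.det_comp, ← Algebra.norm_apply, Algebra.norm_complex_apply,
    Complex.normSq_eq_norm_sq] at h
  change _ = (conj (L (z * 1)) * L (z * Complex.I)).im at h
  rw [mul_comm (‖z‖ ^ 2), h, ← Complex.conj_im, map_mul (starRingEnd ℂ), Complex.conj_conj,
    mul_one, mul_comm Complex.I]

theorem exists_re_mul_conj_rotate_eq_zero :
    ∃ z : ℂ, z ≠ 0 ∧ (L z * conj (L (Complex.I * z))).re = 0 := by
  set φ : ℝ → ℝ := fun θ =>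
    (L (Complex.exp (θ * Complex.I)) * conj (L (Complex.I * Complex.exp (θ * Complex.I)))).re
  have hL : Continuous L := L.continuous_of_finiteDimensional
  have hφ : Continuous φ := by fun_prop
  have hturn : φ (Real.pi / 2) = -φ 0 := by
    have hI : Complex.exp ((Real.pi / 2 : ℝ) * Complex.I) = Complex.I := by
      rw [Complex.ofReal_div, Complex.ofReal_ofNat, Complex.exp_pi_div_two_mul_I]
    simp only [φ, hI, Complex.I_mul_I, Complex.ofReal_zero, zero_mul, Complex.exp_zero, mul_one,
      map_neg, mul_neg, Complex.neg_re]
    rw [← Complex.conj_re, map_mul, Complex.conj_conj, mul_comm]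
  obtain ⟨θ, -, hθ⟩ : (0 : ℝ) ∈ φ '' Set.uIcc 0 (Real.pi / 2) := by
    refine intermediate_value_uIcc hφ.continuousOn ?_
    rw [hturn, Set.mem_uIcc]
    grind
  exact ⟨_, Complex.exp_ne_zero _, hθ⟩

theorem re_mul_conj_rotate_eq_zero_of_conformal {m : ℝ} (h : ∀ z, ‖L z‖ ^ 2 = ‖z‖ ^ 2 * m)
    (z : ℂ) : (L z * conj (L (Complex.I * z))).re = 0 := by
  have hsum := h (z + Complex.I * z)
  have hnorm : ‖z + Complex.I * z‖ ^ 2 = 2 * ‖z‖ ^ 2 := by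
    rw [← one_add_mul Complex.I z, norm_mul, mul_pow, ← Complex.normSq_eq_norm_sq,
      Complex.normSq_apply]
    norm_num
  rw [map_add, hnorm, ← Complex.normSq_eq_norm_sq, Complex.normSq_add, Complex.normSq_eq_norm_sq,
    Complex.normSq_eq_norm_sq, h z, h (Complex.I * z), norm_mul, Complex.norm_I, one_mul] at hsum
  linarith

end PlaneMaps

/-! ### The derivative of `μ` on its kernel -/

open Matrix in
theorem fderiv_dotProduct_mulVec_of_mulVec_eq_zero {ι V : Type*} [Fintype ι]
    [NormedAddCommGroup V] [NormedSpace ℝ V] {h : V → ι → ℂ} {m : V → ι → ι → ℂ} {w : ι → ℂ}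
    {z : V} (hh : DifferentiableAt ℝ h z) (hm : DifferentiableAt ℝ m z)
    (hw : of (m z) *ᵥ w = 0) (v : V) :
    fderiv ℝ (fun y => h y ⬝ᵥ of (m y) *ᵥ w) z v = h z ⬝ᵥ of (fderiv ℝ m z v) *ᵥ w := by
  have hhi : ∀ i, HasFDerivAt (fun y => h y i) _ z := hasFDerivAt_pi'.1 hh.hasFDerivAt
  have hmij : ∀ i j, HasFDerivAt (fun y => m y i j) _ z := fun i =>
    hasFDerivAt_pi'.1 (hasFDerivAt_pi'.1 hm.hasFDerivAt i)
  have hmw : ∀ i, HasFDerivAt (fun y => ∑ j, m y i j * w j) _ z := fun i =>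
    HasFDerivAt.fun_sum fun j _ => (hmij i j).mul_const (w j)
  have hzero : ∀ i, ∑ j, m z i j * w j = 0 := congrFun hw
  have hsum : HasFDerivAt (fun y => h y ⬝ᵥ of (m y) *ᵥ w) _ z :=
    HasFDerivAt.fun_sum fun i _ => (hhi i).mul (hmw i)
  rw [hsum.fderiv]
  simp [hzero, dotProduct, mulVec, mul_comm]

section LocalDerivative

open ComplexConjugate Matrix

variable {S : Type*} [TopologicalSpace S] [ChartedSpace ℂ S] {r : ℕ} {E : S → Type*}
  [TopologicalSpace (TotalSpace (Fib r) E)]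
  [∀ x, NormedAddCommGroup (E x)] [∀ x, InnerProductSpace ℂ (E x)]
  [FiberBundle (Fib r) E] [VectorBundle ℂ (Fib r) E]

theorem contDiffOn_inner_frame (hE : IsSmoothHermitian r E) (p : S) (b : Fib r) (i : Fin r) :
    ContDiffOn ℝ ∞ (fun z => (inner ℂ (ofFib r E p ((chartAt ℂ p).symm z) b)
      (frame r E p ((chartAt ℂ p).symm z) i) : ℂ)) (chartDomain r E p) :=
  hE p b (EuclideanSpace.single i 1)

variable [IsManifold 𝓘(ℂ, ℂ) ω S]

theorem coeff_mulVec_inner_frame_eq_zero (g : SurfaceMetric S) (s : QuadSection r E) {p : S}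
    {k : E p} (hk : (mu (s.1 p) k : KbarE g E p) = 0) :
    of (coeff r s.1 p (chartAt ℂ p p)) *ᵥ (fun j => inner ℂ k (frame r E p p j)) = 0 := by
  rw [of_coeff, (chartAt ℂ p).left_inv (mem_chart_source ℂ p)]
  exact (mu_eq_zero_iff_mulVec g s (mem_locDomain_self p) k).1 hk

theorem ev_ofFibK (g : SurfaceMetric S) {p x : S} {v : Tan x} {c : ℂ}
    (hx : x ∈ (chartAt ℂ p).source) (hv : v = c • coordVec p x) (b : Fib r) :
    KbarE.ev v (ofFibK g E p x b) = conj c • ofFib r E p x b := by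
  have h : (show ℂ from v) / (show ℂ from coordVec p x) = c := by
    subst hv
    exact mul_div_cancel_right₀ c (coordVec_ne_zero hx)
  exact congrArg (fun t : ℂ => conj t • ofFib r E p x b) h

theorem muLocal_apply (g : SurfaceMetric S) (s : QuadSection r E) {p : S} {z : ℂ}
    (hz : z ∈ chartDomain r E p) (b : Fib r) (j : Fin r) :
    muLocal g s p z b j = ∑ i, inner ℂ (ofFib r E p ((chartAt ℂ p).symm z) b)
      (frame r E p ((chartAt ℂ p).symm z) i) * coeff r s.1 p z i j :=
  coframe_contract hz.2 _ _ j

theorem contDiffOn_muLocal (hE : IsSmoothHermitian r E) (g : SurfaceMetric S)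
    (s : QuadSection r E) (p : S) : ContDiffOn ℝ ∞ (muLocal g s p) (chartDomain r E p) := by
  rw [contDiffOn_clm_apply]
  intro b
  rw [contDiffOn_piLp]
  intro j
  have h : ContDiffOn ℝ ∞ (fun z => ∑ i, (inner ℂ (ofFib r E p ((chartAt ℂ p).symm z) b)
      (frame r E p ((chartAt ℂ p).symm z) i) : ℂ) * coeff r s.1 p z i j) (chartDomain r E p) :=
    ContDiffOn.sum fun i _ => (contDiffOn_inner_frame hE p b i).mul
      (contDiffOn_pi.1 (contDiffOn_pi.1 (s.2 p) i) j)
  exact h.congr fun z hz => muLocal_apply g s hz b j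

theorem differentiableAt_muLocal (hE : IsSmoothHermitian r E) (g : SurfaceMetric S)
    (s : QuadSection r E) (p : S) : DifferentiableAt ℝ (muLocal g s p) (chartAt ℂ p p) :=
  ((contDiffOn_muLocal hE g s p).contDiffAt ((isOpen_chartDomain p).mem_nhds
    (chart_mem_chartDomain (mem_locDomain_self p)))).differentiableAt (by simp)

theorem muLocal_toFib_eq_zero (g : SurfaceMetric S) (s : QuadSection r E) {p : S} {k : E p}
    (hk : (mu (s.1 p) k : KbarE g E p) = 0) :
    muLocal g s p (chartAt ℂ p p) (toFib r E p p k) = 0 := by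
  change toFibK g E p ((chartAt ℂ p).symm (chartAt ℂ p p))
    (mu (s.1 ((chartAt ℂ p).symm (chartAt ℂ p p)))
      (ofFib r E p ((chartAt ℂ p).symm (chartAt ℂ p p)) (toFib r E p p k))) = 0
  rw [(chartAt ℂ p).left_inv (mem_chart_source ℂ p),
    ofFib_toFib (mem_baseSet_trivializationAt (Fib r) E p), hk, map_zero]

theorem inner_ofFib_muLocal (g : SurfaceMetric S) (s : QuadSection r E) {p : S} (k : E p) {z : ℂ}
    (hz : z ∈ chartDomain r E p) (b : Fib r) :
    (inner ℂ k (ofFib r E p p (muLocal g s p z b)) : ℂ) =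
      (fun i => inner ℂ (ofFib r E p ((chartAt ℂ p).symm z) b)
        (frame r E p ((chartAt ℂ p).symm z) i)) ⬝ᵥ
      of (coeff r s.1 p z) *ᵥ fun j => inner ℂ k (frame r E p p j) := by
  simp only [ofFib_eq_sum p p, inner_sum, inner_smul_right, muLocal_apply g s hz, dotProduct_mulVec]
  rfl

theorem inner_fderiv_muLocal (hE : IsSmoothHermitian r E) (g : SurfaceMetric S)
    (s : QuadSection r E) {p : S} {k : E p} (hk : (mu (s.1 p) k : KbarE g E p) = 0) (v l : ℂ) :
    (inner ℂ k (ofFib r E p p (fderiv ℝ (muLocal g s p) (chartAt ℂ p p) v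
      (toFib r E p p (l • k)))) : ℂ) =
      conj l * (fun i => inner ℂ k (frame r E p p i)) ⬝ᵥ
        of (fderiv ℝ (coeff r s.1 p) (chartAt ℂ p p) v) *ᵥ
          fun i => inner ℂ k (frame r E p p i) := by
  set b := toFib r E p p (l • k) with hb
  have hdom : chartAt ℂ p p ∈ chartDomain r E p := chart_mem_chartDomain (mem_locDomain_self p)
  have hnhds := (isOpen_chartDomain p).mem_nhds hdom
  have hframe : DifferentiableAt ℝ (fun z i => (inner ℂ (ofFib r E p ((chartAt ℂ p).symm z) b)
      (frame r E p ((chartAt ℂ p).symm z) i) : ℂ)) (chartAt ℂ p p) :=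
    differentiableAt_pi.2 fun i =>
      ((contDiffOn_inner_frame hE p b i).contDiffAt hnhds).differentiableAt (by simp)
  have hcoeff : DifferentiableAt ℝ (coeff r s.1 p) (chartAt ℂ p p) :=
    (contDiffAt_coeff s hdom).differentiableAt (by simp)
  let pairing : (Fib r →L[ℝ] Fib r) →L[ℝ] ℂ :=
    ((innerSL ℂ k ∘L ofFib r E p p).restrictScalars ℝ) ∘L ContinuousLinearMap.apply ℝ (Fib r) b
  have hpair : (inner ℂ k (ofFib r E p p (fderiv ℝ (muLocal g s p) (chartAt ℂ p p) v b)) : ℂ) =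
      fderiv ℝ (pairing ∘ muLocal g s p) (chartAt ℂ p p) v := by
    rw [(pairing.hasFDerivAt.comp _ (differentiableAt_muLocal hE g s p).hasFDerivAt).fderiv]
    rfl
  have hlocal : pairing ∘ muLocal g s p =ᶠ[nhds (chartAt ℂ p p)] _ :=
    Filter.mem_of_superset hnhds fun z hz => inner_ofFib_muLocal g s k hz b
  rw [hpair, hlocal.fderiv_eq, fderiv_dotProduct_mulVec_of_mulVec_eq_zero hframe hcoeff
    (coeff_mulVec_inner_frame_eq_zero g s hk), (chartAt ℂ p).left_inv (mem_chart_source ℂ p), hb,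
    ofFib_toFib (mem_baseSet_trivializationAt (Fib r) E p), ← smul_eq_mul, ← smul_dotProduct]
  simp only [inner_smul_left]
  rfl

variable [∀ x, FiniteDimensional ℂ (E x)]

theorem muAdjLocal_eq {g : SurfaceMetric S} (hg : IsCompatible g) (s : QuadSection r E) {p : S}
    {z : ℂ} (hz : z ∈ chartDomain r E p) :
    muAdjLocal g s p z = (2 / metricAt g ((chartAt ℂ p).symm z)
      (coordVec p ((chartAt ℂ p).symm z)) (coordVec p ((chartAt ℂ p).symm z))) •
        muLocal g s p z := by
  refine ContinuousLinearMap.ext fun b => ?_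
  have hx := (chart_symm_mem_locDomain hz).1
  change toFib r E p ((chartAt ℂ p).symm z) (muAdj g (s.1 ((chartAt ℂ p).symm z))
    (ofFibK g E p ((chartAt ℂ p).symm z) b)) = (2 / metricAt g ((chartAt ℂ p).symm z)
      (coordVec p ((chartAt ℂ p).symm z)) (coordVec p ((chartAt ℂ p).symm z))) •
    toFib r E p ((chartAt ℂ p).symm z) (contract (ofFib r E p ((chartAt ℂ p).symm z) b)
      (s.1 ((chartAt ℂ p).symm z) (coordVec p ((chartAt ℂ p).symm z)) : _ ⊗[ℂ] _))
  generalize (chartAt ℂ p).symm z = x at hx ⊢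
  obtain ⟨c, hc⟩ := exists_smul_coordVec hx (tanOne x)
  have hc0 : c ≠ 0 := by
    rintro rfl
    rw [zero_smul] at hc
    exact one_ne_zero (α := ℂ) hc
  have hn : (‖c‖ : ℂ) ≠ 0 := Complex.ofReal_ne_zero.2 (norm_ne_zero_iff.2 hc0)
  rw [muAdj_apply, ev_ofFibK g hx hc, hc, metricAt_smul_smul hg, LinearMap.map_smulₛₗ (s.1 x),
    Submodule.coe_smul, LinearMap.map_smulₛₗ contract, LinearMap.smul_apply, map_smul (contract _),
    smul_smul, smul_smul, map_smul, RCLike.real_smul_eq_coe_smul (K := ℂ)]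
  congr 1
  rw [Complex.conj_conj, mul_assoc, Complex.mul_conj']
  push_cast
  rw [div_mul_eq_mul_div, mul_comm ((‖c‖ : ℂ) ^ 2), mul_div_mul_right _ _ (pow_ne_zero 2 hn)]
  rfl

theorem fderiv_muAdjLocal_apply (hE : IsSmoothHermitian r E) {g : SurfaceMetric S}
    (hg : IsCompatible g) (s : QuadSection r E) {p : S} {b : Fib r}
    (hb : muLocal g s p (chartAt ℂ p p) b = 0) (v : ℂ) :
    fderiv ℝ (muAdjLocal g s p) (chartAt ℂ p p) v b =
      (2 / metricAt g p (tanOne p) (tanOne p)) •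
        fderiv ℝ (muLocal g s p) (chartAt ℂ p p) v b := by
  have hcenter : (chartAt ℂ p).symm (chartAt ℂ p p) = p :=
    (chartAt ℂ p).left_inv (mem_chart_source ℂ p)
  have hscale : DifferentiableAt ℝ (fun z => 2 / metricAt g ((chartAt ℂ p).symm z)
      (coordVec p ((chartAt ℂ p).symm z)) (coordVec p ((chartAt ℂ p).symm z)))
      (chartAt ℂ p p) := by
    simp only [div_eq_mul_inv]
    refine ((differentiableAt_metricAt_coordVec g p).fun_inv ?_).const_mul 2
    rw [hcenter, coordVec_self]
    exact (metricAt_tanOne_pos g p).ne'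
  have hderiv : HasFDerivAt (muAdjLocal g s p) _ (chartAt ℂ p p) :=
    (hscale.hasFDerivAt.smul (differentiableAt_muLocal hE g s p).hasFDerivAt).congr_of_eventuallyEq
      (Filter.mem_of_superset ((isOpen_chartDomain p).mem_nhds
        (chart_mem_chartDomain (mem_locDomain_self p))) fun z hz => muAdjLocal_eq hg s hz)
  rw [hderiv.fderiv, hcenter, coordVec_self]
  simp [hb]

end LocalDerivative

section UnitForm

open ComplexConjugate

variable {S : Type*} [TopologicalSpace S] [ChartedSpace ℂ S]

/-- The coordinate of a tangent vector in the preferred chart. -/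
def tanCoord {x : S} (v : Tan x) : ℂ := v

theorem tanCoord_smul {x : S} (c : ℂ) (v : Tan x) : tanCoord (c • v) = c * tanCoord v := rfl

theorem tanCoord_tanOne (x : S) : tanCoord (tanOne x) = 1 := rfl

theorem tanCoord_smul_tanOne {x : S} (v : Tan x) : tanCoord v • tanOne x = v :=
  mul_one (tanCoord v)

variable [IsManifold 𝓘(ℂ, ℂ) ω S]

/-- The factor `1 / |dz̄|`, which turns `dz̄` into a unit covector. -/
def formScale (g : SurfaceMetric S) (p : S) : ℝ := √(metricAt g p (tanOne p) (tanOne p) / 2)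

theorem formScale_sq (g : SurfaceMetric S) (p : S) :
    formScale g p ^ 2 = metricAt g p (tanOne p) (tanOne p) / 2 :=
  Real.sq_sqrt (half_pos (metricAt_tanOne_pos g p)).le

theorem two_div_metricAt (g : SurfaceMetric S) (p : S) :
    2 / metricAt g p (tanOne p) (tanOne p) = (formScale g p)⁻¹ * (formScale g p)⁻¹ := by
  rw [← mul_inv, ← sq, formScale_sq, inv_div]

theorem formScale_ne_zero (g : SurfaceMetric S) (p : S) : (formScale g p : ℂ) ≠ 0 :=
  Complex.ofReal_ne_zero.2 (Real.sqrt_pos.2 (half_pos (metricAt_tanOne_pos g p))).ne'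

theorem metricAt_self {g : SurfaceMetric S} (hg : IsCompatible g) {p : S} (v : Tan p) :
    metricAt g p v v = 2 * formScale g p ^ 2 * ‖tanCoord v‖ ^ 2 := by
  conv_lhs => rw [← tanCoord_smul_tanOne v, metricAt_smul_smul hg]
  rw [formScale_sq]
  ring

theorem IsOrthonormalFrame.formScale_sq_mul_norm_sq {g : SurfaceMetric S} (hg : IsCompatible g)
    {p : S} {e : Fin 2 → Tan p} (he : IsOrthonormalFrame g p e) (α : Fin 2) :
    formScale g p ^ 2 * ‖tanCoord (e α)‖ ^ 2 = 1 / 2 := by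
  have hunit := he α α
  rw [if_pos rfl, metricAt_self hg] at hunit
  linarith

variable {E : S → Type*} [∀ x, NormedAddCommGroup (E x)] [∀ x, InnerProductSpace ℂ (E x)]

theorem ev_cliffUp {g : SurfaceMetric S} (hg : IsCompatible g) {p : S} (v : Tan p) (ξ : E p) :
    KbarE.ev (tanOne p) (cliffUp g v ξ) =
      ((formScale g p : ℂ) * formScale g p * tanCoord v) • ξ := by
  change form01 g v (tanOne p) • ξ = _
  conv_lhs => rw [← tanCoord_smul_tanOne v, form01_tanOne hg, ← formScale_sq]
  rw [sq, Complex.ofReal_mul]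

/-- The form `dz̄ ⊗ ξ / |dz̄|` in `K̄E`, which has the same length as `ξ`. -/
def unitForm (g : SurfaceMetric S) {p : S} (ξ : E p) : KbarE g E p :=
  ((formScale g p : ℂ)⁻¹) • cliffUp g (tanOne p) ξ

theorem ev_unitForm {g : SurfaceMetric S} (hg : IsCompatible g) {p : S} (ξ : E p) :
    KbarE.ev (tanOne p) (unitForm g ξ) = (formScale g p : ℂ) • ξ := by
  rw [unitForm, map_smul, ev_cliffUp hg, smul_smul, tanCoord_tanOne, mul_one,
    inv_mul_cancel_left₀ (formScale_ne_zero g p)]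

theorem eq_of_ev_eq {g : SurfaceMetric S} {p : S} {η ζ : KbarE g E p}
    (h : KbarE.ev (tanOne p) η = KbarE.ev (tanOne p) ζ) : η = ζ := by
  rw [← sub_eq_zero]
  exact KbarE.ext_one (by rw [map_sub, h, sub_self])

theorem cliffUp_eq_smul_unitForm {g : SurfaceMetric S} (hg : IsCompatible g) {p : S} (v : Tan p)
    (ξ : E p) : cliffUp g v ξ = ((formScale g p : ℂ) * tanCoord v) • unitForm g ξ :=
  eq_of_ev_eq (by
    rw [ev_cliffUp hg, map_smul, ev_unitForm hg, smul_smul]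
    congr 1
    ring)

theorem inner_unitForm {g : SurfaceMetric S} (hg : IsCompatible g) {p : S} (ξ : E p)
    (η : KbarE g E p) : (inner ℂ (unitForm g ξ) η : ℂ) =
      (formScale g p : ℂ)⁻¹ * inner ℂ ξ (KbarE.ev (tanOne p) η) := by
  have hscale := formScale_ne_zero g p
  rw [inner_kbarE, ev_unitForm hg, inner_smul_left, two_div_metricAt, Complex.conj_ofReal]
  push_cast
  field_simp

theorem norm_unitForm {g : SurfaceMetric S} (hg : IsCompatible g) {p : S} (ξ : E p) :
    ‖unitForm g ξ‖ = ‖ξ‖ := by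
  have hinner : (inner ℂ (unitForm g ξ) (unitForm g ξ) : ℂ) = inner ℂ ξ ξ := by
    rw [inner_unitForm hg, ev_unitForm hg, inner_smul_right,
      inv_mul_cancel_left₀ (formScale_ne_zero g p)]
  rw [norm_eq_sqrt_re_inner (𝕜 := ℂ), norm_eq_sqrt_re_inner (𝕜 := ℂ), hinner]

theorem inner_contract_eq_zero (g : SurfaceMetric S) {p : S} {s : QuadFibre E p} {k : E p}
    (hk : (mu s k : KbarE g E p) = 0) (ξ : E p) :
    inner ℂ k (contract ξ (s (tanOne p) : E p ⊗[ℂ] E p)) = (0 : ℂ) := by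
  rw [inner_contract_symm (s (tanOne p)).2, ← ev_mu g, hk, map_zero, inner_zero_right]

end UnitForm

section KernelDerivative

open ComplexConjugate Matrix

variable {S : Type*} [TopologicalSpace S]
  {r : ℕ} {E : S → Type*} [TopologicalSpace (TotalSpace (Fib r) E)]
  [∀ x, NormedAddCommGroup (E x)] [∀ x, InnerProductSpace ℂ (E x)]
  [FiberBundle (Fib r) E] [VectorBundle ℂ (Fib r) E]

theorem inner_frame_ne_zero {p : S} {k : E p} (hk : k ≠ 0) :
    (fun i => inner ℂ k (frame r E p p i)) ≠ (0 : Fin r → ℂ) := fun h =>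
  hk (eq_zero_of_inner_frame (mem_baseSet_trivializationAt (Fib r) E p) (congrFun h))

variable [ChartedSpace ℂ S] [IsManifold 𝓘(ℂ, ℂ) ω S]

/-- The map `v ↦ ⟨(∇_v μ) k, k̂⟩` for `k` in the kernel of `μ_p`, where `k̂` is the element
`unitForm g k` of the kernel of `μ_p*`. It does not depend on the connections and is given here
by the derivative of the local coefficients of `μ`. -/
def kernelDeriv (g : SurfaceMetric S) (s : QuadSection r E) {p : S} (k : E p) : ℂ →ₗ[ℝ] ℂ :=
  (formScale g p : ℂ)⁻¹ •
    ((traceMulCLM (vecMulVec (fun i => inner ℂ k (frame r E p p i))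
      fun i => inner ℂ k (frame r E p p i))).restrictScalars ℝ ∘L
        fderiv ℝ (coeff r s.1 p) (chartAt ℂ p p)).toLinearMap

theorem kernelDeriv_apply (g : SurfaceMetric S) (s : QuadSection r E) {p : S} (k : E p) (v : ℂ) :
    kernelDeriv g s k v = (formScale g p : ℂ)⁻¹ * (fun i => inner ℂ k (frame r E p p i)) ⬝ᵥ
      of (fderiv ℝ (coeff r s.1 p) (chartAt ℂ p p) v) *ᵥ
        fun i => inner ℂ k (frame r E p p i) := by
  rw [← one_mul (_ ⬝ᵥ _), ← traceMulCLM_smul_vecMulVec, one_smul]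
  rfl

theorem inner_nablaMu (hE : IsSmoothHermitian r E) {g : SurfaceMetric S} (hg : IsCompatible g)
    (s : QuadSection r E) {p : S} (A : ConnectionsAt g E p) {k : E p}
    (hk : (mu (s.1 p) k : KbarE g E p) = 0) (v : Tan p) (l : ℂ) :
    inner ℂ (unitForm g k) (nablaMu g s A v (l • k)) =
      kernelDeriv g s k (tanCoord v) * conj l := by
  have hlk : muR g (s.1 p) (l • k) = 0 := by
    change mu (s.1 p) (l • k) = 0
    rw [LinearMap.map_smulₛₗ, hk, smul_zero]
  have hnabla : nablaMu g s A v (l • k) = ofFibK g E p p (fderiv ℝ (muLocal g s p) (chartAt ℂ p p)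
      (tanCoord v) (toFib r E p p (l • k))) + A.b v (muR g (s.1 p) (l • k)) -
      mu (s.1 p) (A.a v (l • k)) := rfl
  rw [hnabla, hlk, map_zero, add_zero, inner_unitForm hg, map_sub, inner_sub_right, ev_mu,
    inner_contract_eq_zero g hk, sub_zero, ev_ofFibK g (mem_chart_source ℂ p) (c := 1)
      (by rw [one_smul, coordVec_self]), map_one, one_smul, inner_fderiv_muLocal hE g s hk,
    kernelDeriv_apply]
  ring

variable [∀ x, FiniteDimensional ℂ (E x)]

theorem inner_nablaMuAdj (hE : IsSmoothHermitian r E) {g : SurfaceMetric S} (hg : IsCompatible g)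
    (s : QuadSection r E) {p : S} (A : ConnectionsAt g E p) {k : E p}
    (hk : (mu (s.1 p) k : KbarE g E p) = 0) (v : Tan p) (l : ℂ) :
    inner ℂ k (nablaMuAdj g s A v (l • unitForm g k)) =
      kernelDeriv g s k (tanCoord v) * conj l := by
  have hscale := formScale_ne_zero g p
  have hev : KbarE.ev (tanOne p) (l • unitForm g k) = (l * formScale g p) • k := by
    rw [map_smul, ev_unitForm hg, smul_smul]
  have hmu : (mu (s.1 p) ((l * formScale g p) • k) : KbarE g E p) = 0 := by
    rw [LinearMap.map_smulₛₗ, hk, smul_zero]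
  have hadj : muAdj g (s.1 p) (l • unitForm g k) = 0 := by
    rw [muAdj_eq_zero_iff, hev, hmu]
  have htoFib : toFibK g E p p (l • unitForm g k) =
      toFib r E p p ((l * formScale g p) • k) := by
    change toFib r E p p (KbarE.ev (coordVec p p) (l • unitForm g k)) = _
    rw [coordVec_self, hev]
  have hnabla : nablaMuAdj g s A v (l • unitForm g k) = ofFib r E p p
      (fderiv ℝ (muAdjLocal g s p) (chartAt ℂ p p) (tanCoord v)
        (toFibK g E p p (l • unitForm g k))) + A.a v (muAdj g (s.1 p) (l • unitForm g k)) -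
      muAdj g (s.1 p) (A.b v (l • unitForm g k)) := rfl
  rw [hnabla, hadj, map_zero, add_zero, htoFib,
    fderiv_muAdjLocal_apply hE hg s (muLocal_toFib_eq_zero g s hmu), inner_sub_right, muAdj_apply,
    inner_smul_right, inner_contract_eq_zero g hk, mul_zero, sub_zero,
    RCLike.real_smul_eq_coe_smul (K := ℂ), map_smul, inner_smul_right,
    inner_fderiv_muLocal hE g s hk, two_div_metricAt, kernelDeriv_apply, map_mul,
    Complex.conj_ofReal]
  simp only [RCLike.ofReal_eq_complex_ofReal, Complex.ofReal_mul, Complex.ofReal_inv]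
  field_simp

theorem mem_kerMuAdj_iff {g : SurfaceMetric S} (hg : IsCompatible g) {s : QuadSection r E} {p : S}
    {k : E p} (hK : ∀ ξ, ξ ∈ kerMu g s p ↔ ∃ l : ℂ, ξ = l • k) (η : KbarE g E p) :
    η ∈ kerMuAdj g s p ↔ ∃ l : ℂ, η = l • unitForm g k := by
  have hscale := formScale_ne_zero g p
  rw [LinearMap.mem_ker, muAdj_eq_zero_iff]
  refine (hK (KbarE.ev (tanOne p) η)).trans ⟨?_, ?_⟩
  · rintro ⟨l, hl⟩
    refine ⟨l * (formScale g p : ℂ)⁻¹, eq_of_ev_eq ?_⟩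
    rw [hl, map_smul, ev_unitForm hg, smul_smul, inv_mul_cancel_right₀ hscale]
  · rintro ⟨l, rfl⟩
    exact ⟨l * formScale g p, by rw [map_smul, ev_unitForm hg, smul_smul]⟩

theorem detDeriv_eq_traceMulCLM_comp (g : SurfaceMetric S) (s : QuadSection r E) (p : S) :
    detDeriv g s p = (traceMulCLM (of (coeff r s.1 p (chartAt ℂ p p))).adjugate).restrictScalars ℝ
      ∘L fderiv ℝ (coeff r s.1 p) (chartAt ℂ p p) := by
  have hcoeff := (contDiffAt_coeff s (chart_mem_chartDomain
    (mem_locDomain_self p))).differentiableAt (by simp)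
  rw [detDeriv, funext (detCoeff_eq_det_coeff g s p)]
  exact (hasFDerivAt_det_comp hcoeff.hasFDerivAt).fderiv

theorem exists_detDeriv_eq_smul_kernelDeriv (g : SurfaceMetric S) (s : QuadSection r E) {p : S}
    {k : E p} (hk0 : k ≠ 0) (hk : (mu (s.1 p) k : KbarE g E p) = 0) :
    ∃ c : ℂ, (detDeriv g s p : ℂ →ₗ[ℝ] ℂ) = c • kernelDeriv g s k := by
  obtain ⟨c, hc⟩ := exists_adjugate_eq_smul_vecMulVec (isSymm_coeffAt s.1 p _)
    (inner_frame_ne_zero hk0) (coeff_mulVec_inner_frame_eq_zero g s hk)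
  refine ⟨c * formScale g p, LinearMap.ext fun v => ?_⟩
  change detDeriv g s p v = c * formScale g p * kernelDeriv g s k v
  rw [kernelDeriv_apply, mul_assoc, mul_inv_cancel_left₀ (formScale_ne_zero g p),
    ← traceMulCLM_smul_vecMulVec, ← hc, detDeriv_eq_traceMulCLM_comp]
  rfl

theorem mem_kerMu_iff_of_bijective_detDeriv {g : SurfaceMetric S} {s : QuadSection r E} {p : S}
    (ht : Function.Bijective (detDeriv g s p)) {k : E p} (hk0 : k ≠ 0)
    (hk : (mu (s.1 p) k : KbarE g E p) = 0) (ξ : E p) :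
    ξ ∈ kerMu g s p ↔ ∃ l : ℂ, ξ = l • k := by
  constructor
  · intro hξ
    have hadj : (of (coeff r s.1 p (chartAt ℂ p p))).adjugate ≠ 0 := fun h =>
      one_ne_zero (α := ℂ) (ht.1 (by
        simp only [detDeriv_eq_traceMulCLM_comp, ContinuousLinearMap.comp_apply,
          ContinuousLinearMap.coe_restrictScalars', traceMulCLM_apply, h, Matrix.zero_apply,
          zero_mul, Finset.sum_const_zero]))
    obtain ⟨a, ha⟩ := exists_eq_smul_of_adjugate_ne_zero (inner_frame_ne_zero hk0)
      (coeff_mulVec_inner_frame_eq_zero g s hk) hadj (coeff_mulVec_inner_frame_eq_zero g s hξ)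
    refine ⟨conj a, sub_eq_zero.1 (eq_zero_of_inner_frame
      (mem_baseSet_trivializationAt (Fib r) E p) fun i => ?_)⟩
    rw [inner_sub_left, inner_smul_left, Complex.conj_conj, sub_eq_zero]
    exact congrFun ha i
  · rintro ⟨l, rfl⟩
    change (mu (s.1 p) _ : KbarE g E p) = 0
    rw [LinearMap.map_smulₛₗ, hk, smul_zero]

theorem exists_unit_mu_eq_zero {g : SurfaceMetric S} {s : QuadSection r E} {p : S}
    (hp : p ∈ detZeros g s) : ∃ k : E p, ‖k‖ = 1 ∧ (mu (s.1 p) k : KbarE g E p) = 0 := by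
  obtain ⟨ξ, hξ, hmu⟩ := (mem_detZeros_iff_exists_mu_eq_zero g s).1 hp
  exact ⟨((‖ξ‖ : ℂ)⁻¹) • ξ, norm_smul_inv_norm hξ, by rw [LinearMap.map_smulₛₗ, hmu, smul_zero]⟩

end KernelDerivative

section FrameProduct

open ComplexConjugate

theorem mul_conj_mul_eq_of_rotate (L : ℂ →ₗ[ℝ] ℂ) {τ a : Fin 2 → ℂ} {ε : ℝ} {j : ℂ}
    (hε : ε ^ 2 = 1) (hτ : τ 1 = ((ε : ℂ) * Complex.I) * τ 0) (ha : a 1 = ε * j * a 0) :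
    (a 0 * L (τ 0)) * conj (a 1 * L (τ 1)) =
      ((‖a 0‖ ^ 2 : ℝ) : ℂ) * (conj j * (L (τ 0) * conj (L (Complex.I * τ 0)))) := by
  have hL : L (τ 1) = ε * L (Complex.I * τ 0) := by
    rw [hτ, mul_assoc, ← Complex.real_smul, map_smul, Complex.real_smul]
  have hε' : (ε : ℂ) ^ 2 = 1 := by exact_mod_cast hε
  rw [hL, ha, Complex.ofReal_pow, ← Complex.mul_conj']
  simp only [map_mul, Complex.conj_ofReal]
  linear_combination
    (a 0 * conj (a 0) * conj j * L (τ 0) * conj (L (Complex.I * τ 0))) * hε'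

end FrameProduct

section CommutingFrames

open ComplexConjugate

variable {S : Type*} [TopologicalSpace S] [ChartedSpace ℂ S] [IsManifold 𝓘(ℂ, ℂ) ω S]
  {r : ℕ} {E : S → Type*} [TopologicalSpace (TotalSpace (Fib r) E)]
  [∀ x, NormedAddCommGroup (E x)] [∀ x, InnerProductSpace ℂ (E x)]
  [FiberBundle (Fib r) E] [VectorBundle ℂ (Fib r) E]

/-- The number `c` for which `M_α` is `l ↦ c l̄` in the coordinate on the kernel of `μ_p` given
by `k`. -/
def coefM (g : SurfaceMetric S) (s : QuadSection r E) {p : S} (k : E p) (e : Fin 2 → Tan p)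
    (α : Fin 2) : ℂ :=
  conj ((formScale g p : ℂ) * tanCoord (e α)) * kernelDeriv g s k (tanCoord (e α))

/-- The number `c` for which `M̂_α` is `l ↦ c l̄` in the coordinate on the kernel of `μ_p*` given
by `unitForm g k`. -/
def coefMHat (g : SurfaceMetric S) (s : QuadSection r E) {p : S} (k : E p) (e : Fin 2 → Tan p)
    (α : Fin 2) : ℂ :=
  -((formScale g p : ℂ) * tanCoord (e α)) * kernelDeriv g s k (tanCoord (e α))

section Product

variable {g : SurfaceMetric S} (hg : IsCompatible g) (s : QuadSection r E) {p : S} (k : E p)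
  {e : Fin 2 → Tan p} (he : IsOrthonormalFrame g p e)

include hg he

theorem coefM_mul_conj_coefM : coefM g s k e 0 * conj (coefM g s k e 1) =
    ((1 / 2 : ℝ) : ℂ) * (Complex.I * (kernelDeriv g s k (tanCoord (e 0)) *
      conj (kernelDeriv g s k (Complex.I * tanCoord (e 0))))) := by
  obtain ⟨ε, hε, h⟩ := he.exists_sign hg
  have hτ : tanCoord (e 1) = ((ε : ℂ) * Complex.I) * tanCoord (e 0) := congrArg tanCoord h
  rw [← he.formScale_sq_mul_norm_sq hg 0]
  refine (mul_conj_mul_eq_of_rotate (kernelDeriv g s k) (τ := fun α => tanCoord (e α))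
    (a := fun α => conj ((formScale g p : ℂ) * tanCoord (e α))) (j := -Complex.I) hε hτ ?_).trans ?_
  · simp only [hτ, map_mul, Complex.conj_ofReal, Complex.conj_I]
    ring
  · rw [RCLike.norm_conj, norm_mul, Complex.norm_real, mul_pow, Real.norm_eq_abs, sq_abs, map_neg,
      Complex.conj_I, neg_neg]

theorem coefMHat_mul_conj_coefMHat : coefMHat g s k e 0 * conj (coefMHat g s k e 1) =
    -(coefM g s k e 0 * conj (coefM g s k e 1)) := by
  obtain ⟨ε, hε, h⟩ := he.exists_sign hg
  have hτ : tanCoord (e 1) = ((ε : ℂ) * Complex.I) * tanCoord (e 0) := congrArg tanCoord h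
  rw [coefM_mul_conj_coefM hg s k he, ← he.formScale_sq_mul_norm_sq hg 0]
  refine (mul_conj_mul_eq_of_rotate (kernelDeriv g s k) (τ := fun α => tanCoord (e α))
    (a := fun α => -((formScale g p : ℂ) * tanCoord (e α))) (j := Complex.I) hε hτ ?_).trans ?_
  · simp only [hτ]
    ring
  · rw [norm_neg, norm_mul, Complex.norm_real, mul_pow, Real.norm_eq_abs, sq_abs, Complex.conj_I,
      neg_mul, mul_neg]

theorem im_coefM_mul_conj_coefM : (coefM g s k e 0 * conj (coefM g s k e 1)).im =
    1 / 2 * (kernelDeriv g s k (tanCoord (e 0)) *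
      conj (kernelDeriv g s k (Complex.I * tanCoord (e 0)))).re := by
  rw [coefM_mul_conj_coefM hg s k he, Complex.im_ofReal_mul, Complex.I_mul_im]

theorem re_coefM_mul_conj_coefM : (coefM g s k e 0 * conj (coefM g s k e 1)).re =
    1 / 2 * ‖tanCoord (e 0)‖ ^ 2 * LinearMap.det (kernelDeriv g s k) := by
  rw [coefM_mul_conj_coefM hg s k he, Complex.re_ofReal_mul, Complex.I_mul_re, im_mul_conj_rotate,
    neg_neg, mul_assoc]

theorem re_coefM_mul_conj_coefM_pos (hdet : 0 < LinearMap.det (kernelDeriv g s k)) :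
    0 < (coefM g s k e 0 * conj (coefM g s k e 1)).re := by
  rw [re_coefM_mul_conj_coefM hg s k he]
  have hnorm : tanCoord (e 0) ≠ 0 := fun h => by
    simpa [h] using he.formScale_sq_mul_norm_sq hg 0
  positivity

theorem re_coefM_mul_conj_coefM_neg (hdet : LinearMap.det (kernelDeriv g s k) < 0) :
    (coefM g s k e 0 * conj (coefM g s k e 1)).re < 0 := by
  rw [re_coefM_mul_conj_coefM hg s k he]
  have hnorm : tanCoord (e 0) ≠ 0 := fun h => by
    simpa [h] using he.formScale_sq_mul_norm_sq hg 0
  exact mul_neg_of_pos_of_neg (by positivity) hdet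

end Product

variable [∀ x, FiniteDimensional ℂ (E x)] (hE : IsSmoothHermitian r E) {g : SurfaceMetric S}
  (hg : IsCompatible g) (s : QuadSection r E) {p : S} (A : ConnectionsAt g E p) {k : E p}
  (hk : ‖k‖ = 1) (hK : ∀ ξ, ξ ∈ kerMu g s p ↔ ∃ l : ℂ, ξ = l • k)

/-- The coordinate on the kernel of `μ_p*` given by the unit vector `unitForm g k`. -/
def kerMuAdjEquiv : ℂ ≃ₗ[ℝ] kerMuAdj g s p :=
  lineEquiv ((norm_unitForm hg k).trans hk) (mem_kerMuAdj_iff hg hK)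

include hE hg

theorem opM_lineEquiv (e : Fin 2 → Tan p) (α : Fin 2) (l : ℂ) :
    opM g s A e α (lineEquiv hk hK l) = lineEquiv hk hK (coefM g s k e α * conj l) := by
  have hmu : (mu (s.1 p) k : KbarE g E p) = 0 := (hK k).2 ⟨1, (one_smul ℂ k).symm⟩
  have hopM : opM g s A e α (lineEquiv hk hK l) = (kerMu g s p).orthogonalProjectionOnto
      (-(-(LinearMap.adjoint (cliffUp g (e α)) (nablaMu g s A (e α) (l • k))))) := rfl
  rw [hopM, neg_neg, orthogonalProjectionOnto_eq_lineEquiv hk hK, LinearMap.adjoint_inner_right,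
    cliffUp_eq_smul_unitForm hg, inner_smul_left, inner_nablaMu hE hg s A hmu, ← mul_assoc]
  rfl

theorem opMHat_kerMuAdjEquiv (e : Fin 2 → Tan p) (α : Fin 2) (l : ℂ) :
    opMHat g s A e α (kerMuAdjEquiv hg s hk hK l) =
      kerMuAdjEquiv hg s hk hK (coefMHat g s k e α * conj l) := by
  have hmu : (mu (s.1 p) k : KbarE g E p) = 0 := (hK k).2 ⟨1, (one_smul ℂ k).symm⟩
  have hopMHat : opMHat g s A e α (kerMuAdjEquiv hg s hk hK l) =
      (kerMuAdj g s p).orthogonalProjectionOnto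
        (-(cliffUp g (e α) (nablaMuAdj g s A (e α) (l • unitForm g k)))) := rfl
  have hscale := formScale_ne_zero g p
  rw [hopMHat, orthogonalProjectionOnto_eq_lineEquiv ((norm_unitForm hg k).trans hk)
    (mem_kerMuAdj_iff hg hK), inner_neg_right, inner_unitForm hg, ev_cliffUp hg, inner_smul_right,
    inner_nablaMuAdj hE hg s A hmu, coefMHat, kerMuAdjEquiv]
  congr 1
  field_simp

include hk hK

theorem isCommutingFrame_iff {e : Fin 2 → Tan p} (he : IsOrthonormalFrame g p e) :
    IsCommutingFrame g s A e ↔ (kernelDeriv g s k (tanCoord (e 0)) *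
      conj (kernelDeriv g s k (Complex.I * tanCoord (e 0)))).re = 0 := by
  rw [IsCommutingFrame, commute_iff_im_eq_zero _ (opM_lineEquiv hE hg s A hk hK e),
    commute_iff_im_eq_zero _ (opMHat_kerMuAdjEquiv hE hg s A hk hK e),
    coefMHat_mul_conj_coefMHat hg s k he, Complex.neg_im, neg_eq_zero, and_self,
    im_coefM_mul_conj_coefM hg s k he, mul_eq_zero, or_iff_right (by norm_num)]

theorem exists_isCommutingFrame : ∃ e, IsOrthonormalFrame g p e ∧ IsCommutingFrame g s A e := by
  obtain ⟨z, hz, hre⟩ := exists_re_mul_conj_rotate_eq_zero (kernelDeriv g s k)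
  set n : ℝ := metricAt g p (z • tanOne p) (z • tanOne p) with hn
  have hnpos : 0 < n := by
    rw [hn, metricAt_smul_smul hg]
    exact mul_pos (pow_pos (norm_pos_iff.2 hz) 2) (metricAt_tanOne_pos g p)
  set t : ℝ := (√n)⁻¹ with ht
  have hunit : metricAt g p ((t : ℂ) • z • tanOne p) ((t : ℂ) • z • tanOne p) = 1 := by
    rw [metricAt_smul_smul hg, ← hn, Complex.norm_real, Real.norm_eq_abs, sq_abs, ht, inv_pow,
      Real.sq_sqrt hnpos.le, inv_mul_cancel₀ hnpos.ne']
  have hcoord : tanCoord ((t : ℂ) • z • tanOne p) = t • z := by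
    rw [tanCoord_smul, tanCoord_smul, tanCoord_tanOne, mul_one, Complex.real_smul]
  refine ⟨_, isOrthonormalFrame_pair hg hunit, ?_⟩
  rw [isCommutingFrame_iff hE hg s A hk hK (isOrthonormalFrame_pair hg hunit),
    Matrix.cons_val_zero, hcoord, mul_smul_comm, map_smul, map_smul, Complex.real_smul,
    Complex.real_smul, map_mul, Complex.conj_ofReal, mul_mul_mul_comm, ← Complex.ofReal_mul,
    Complex.re_ofReal_mul, hre, mul_zero]

theorem isCommutingFrame_of_isNondegenerate (hA : IsNondegenerate g s A) {e : Fin 2 → Tan p}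
    (he : IsOrthonormalFrame g p e) : IsCommutingFrame g s A e := by
  obtain ⟨M, -, -, hM⟩ := hA
  have hkmem : k ∈ kerMu g s p := (hK k).2 ⟨1, (one_smul ℂ k).symm⟩
  have hunit : ‖(unitForm g k : KbarE g E p)‖ = 1 := (norm_unitForm hg k).trans hk
  rw [isCommutingFrame_iff hE hg s A hk hK he]
  refine re_mul_conj_rotate_eq_zero_of_conformal _
    (m := 2 * formScale g p ^ 2 * inner ℝ (M ⟨k, hkmem⟩) ⟨k, hkmem⟩) (fun z => ?_) _
  have hcoord : tanCoord (z • tanOne p) = z := mul_one z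
  have hinner : inner ℂ (unitForm g k) (nablaMu g s A (z • tanOne p) k) = kernelDeriv g s k z := by
    simpa only [one_smul, map_one, mul_one, hcoord] using
      inner_nablaMu hE hg s A hkmem (z • tanOne p) 1
  have hnorm := hM (z • tanOne p) ⟨k, hkmem⟩
  rw [orthogonalProjectionOnto_eq_lineEquiv hunit (mem_kerMuAdj_iff hg hK), ← Submodule.norm_coe,
    coe_lineEquiv, norm_smul, hunit, mul_one, hinner, metricAt_self hg, hcoord] at hnorm
  rw [hnorm]
  ring

variable {e : Fin 2 → Tan p} (he : IsOrthonormalFrame g p e) (hcomm : IsCommutingFrame g s A e)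

include he hcomm

theorem im_coefM_mul_conj_coefM_eq_zero : (coefM g s k e 0 * conj (coefM g s k e 1)).im = 0 := by
  rw [im_coefM_mul_conj_coefM hg s k he, (isCommutingFrame_iff hE hg s A hk hK he).1 hcomm,
    mul_zero]

theorem calK_of_det_kernelDeriv_pos (hdet : 0 < LinearMap.det (kernelDeriv g s k)) :
    Nonempty (calK g s A e ≃ₗ[ℝ] ℝ) ∧ calKHat g s A e = ⊥ := by
  have him := im_coefM_mul_conj_coefM_eq_zero hE hg s A hk hK he hcomm
  have hre := re_coefM_mul_conj_coefM_pos hg s k he hdet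
  refine ⟨nonempty_iInf_positiveSpace_equiv _ (opM_lineEquiv hE hg s A hk hK e) him hre,
    iInf_positiveSpace_eq_bot _ (opMHat_kerMuAdjEquiv hE hg s A hk hK e) ?_ ?_⟩
  · rw [coefMHat_mul_conj_coefMHat hg s k he, Complex.neg_im, him, neg_zero]
  · rw [coefMHat_mul_conj_coefMHat hg s k he, Complex.neg_re]
    exact neg_neg_of_pos hre

theorem calK_of_det_kernelDeriv_neg (hdet : LinearMap.det (kernelDeriv g s k) < 0) :
    calK g s A e = ⊥ ∧ Nonempty (calKHat g s A e ≃ₗ[ℝ] ℝ) := by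
  have him := im_coefM_mul_conj_coefM_eq_zero hE hg s A hk hK he hcomm
  have hre := re_coefM_mul_conj_coefM_neg hg s k he hdet
  refine ⟨iInf_positiveSpace_eq_bot _ (opM_lineEquiv hE hg s A hk hK e) him hre,
    nonempty_iInf_positiveSpace_equiv _ (opMHat_kerMuAdjEquiv hE hg s A hk hK e) ?_ ?_⟩
  · rw [coefMHat_mul_conj_coefMHat hg s k he, Complex.neg_im, him, neg_zero]
  · rw [coefMHat_mul_conj_coefMHat hg s k he, Complex.neg_re]
    exact neg_pos_of_neg hre

end CommutingFrames

end CrrLemma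

end

open CrrLemma in
theorem mainTheorem6
    (S : Type*) [TopologicalSpace S] [CompactSpace S] [T2Space S] [ChartedSpace ℂ S]
    [IsManifold 𝓘(ℂ, ℂ) ω S]
    (g : SurfaceMetric S) (hg : IsCompatible g)
    (r : ℕ) (E : S → Type*) [TopologicalSpace (TotalSpace (Fib r) E)]
    [∀ x, NormedAddCommGroup (E x)] [∀ x, InnerProductSpace ℂ (E x)]
    [∀ x, FiniteDimensional ℂ (E x)]
    [FiberBundle (Fib r) E] [VectorBundle ℂ (Fib r) E]
    [ContMDiffVectorBundle ω (Fib r) E 𝓘(ℂ, ℂ)]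
    (hE : IsSmoothHermitian r E) :
    IsOpen {s : QuadSection r E | HasTransverseZeros g s} ∧
    Dense {s : QuadSection r E | HasTransverseZeros g s} ∧
    ∀ s : QuadSection r E, HasTransverseZeros g s →
      (singularSet g s).Finite ∧
      singularSet g s = detZeros g s ∧
      ∀ p ∈ singularSet g s,
        (IsPositive g s p ∨ IsNegative g s p) ∧
        ∀ A : ConnectionsAt g E p,
          (∃ e, IsOrthonormalFrame g p e ∧ IsCommutingFrame g s A e) ∧
          (IsNondegenerate g s A → ∀ e, IsOrthonormalFrame g p e → IsCommutingFrame g s A e) ∧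
          ∀ e, IsOrthonormalFrame g p e → IsCommutingFrame g s A e →
            (IsPositive g s p →
              Nonempty (calK g s A e ≃ₗ[ℝ] ℝ) ∧ calKHat g s A e = ⊥) ∧
            (IsNegative g s p →
              calK g s A e = ⊥ ∧ Nonempty (calKHat g s A e ≃ₗ[ℝ] ℝ)) := by
  obtain ⟨hopen, hdense⟩ := isOpen_and_dense_hasTransverseZeros (r := r) (E := E) g
  refine ⟨hopen, hdense, fun s hs => ?_⟩
  rw [singularSet_eq_detZeros]
  refine ⟨hs.finite_detZeros, rfl, fun p hp => ⟨?_, fun A => ?_⟩⟩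
  · exact ((bijective_iff_det_ne_zero _).1 (hs p hp)).lt_or_gt.symm
  obtain ⟨k, hk, hmu⟩ := exists_unit_mu_eq_zero hp
  have hk0 : k ≠ 0 := norm_ne_zero_iff.1 (hk.symm ▸ one_ne_zero)
  have hK := mem_kerMu_iff_of_bijective_detDeriv (hs p hp) hk0 hmu
  obtain ⟨c, hc⟩ := exists_detDeriv_eq_smul_kernelDeriv g s hk0 hmu
  have hdet : LinearMap.det (detDeriv g s p : ℂ →ₗ[ℝ] ℂ) =
      ‖c‖ ^ 2 * LinearMap.det (kernelDeriv g s k) := by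
    rw [hc, det_complex_smul]
  refine ⟨exists_isCommutingFrame hE hg s A hk hK,
    fun hA e he => isCommutingFrame_of_isNondegenerate hE hg s A hk hK hA he,
    fun e he hcomm => ⟨fun h => ?_, fun h => ?_⟩⟩
  · rw [IsPositive, hdet] at h
    exact calK_of_det_kernelDeriv_pos hE hg s A hk hK he hcomm
      (pos_of_mul_pos_right h (sq_nonneg _))
  · rw [IsNegative, hdet] at h
    exact calK_of_det_kernelDeriv_neg hE hg s A hk hK he hcomm
      (neg_of_mul_neg_right h (sq_nonneg _))
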